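/- **Setting.** *Elements.* An element is a closed nondegenerate triangle or simple quadrilateral (convex or not). Its aspect ratio is the length of its longest side divided by the smallest distance from one of its vertices to a side not incident to that vertex (for triangles: longest side over shortest altitude). A *mesh covering* a set $\Omega\subset\mathbb R^2$ is a finite family of elements whose union contains $\Omega$ and in which any two distinct elements meet only in common vertices and along common sides. A *local size function* on $\Omega$ is a function $\sigma:\Omega\to(0,\infty)$; an element *obeys* $\sigma$ if all its sides have length at most $\sigma(p)$ for every $p\in\Omega$ that it contains, and a mesh obeys $\sigma$ if all its elements do. The local feature size is $\hat\sigma(p)=\inf_{q\in\Omega}\bigl(|p-q|+\sigma(q)\bigr)$. *Diamond-kite meshes.* Let $T$ be a rhombille tiling of the plane with side length $s_0$ (rhombi with angles $60^\circ$ and $120^\circ$, six meeting at their acute corners or three at their obtuse corners at each vertex). If exactly six edges of length $s$ meet at a vertex $p$ of a quadrilateral mesh obtained from $T$, their other ends are the vertices of a regular hexagon with center $p$; the *replacement step* $(p,s)$ makes each of these six edges the long diagonal of a new $60^\circ$–$120^\circ$ rhombus of side $s/\sqrt3$, and in each of the six quadrilaterals at $p$ it replaces the corner $p$ by the centroid of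 $p$ and its two neighbors in that quadrilateral. The *diamond-kite meshes formed from $T$* are the meshes obtained from $T$ by finitely many replacement steps; $M'$ is a refinement of $M$ if it is obtained from $M$ by finitely many such steps. The *coarsest* diamond-kite mesh for $\sigma$ is a diamond-kite mesh formed from $T$ that obeys $\sigma$ and of which every diamond-kite mesh formed from $T$ and obeying $\sigma$ is a refinement. *Domains.* For $\kappa\ge 0$, a bounded set $\Omega\subset\mathbb R^2$ is a *$\kappa$-domain* if it lies in the closure of its interior and any two points $p,q$ of the interior are joined by a path in the interior of length at most $\kappa|p-q|$. (Bounded convex sets with interior points are $1$-domains.) **Theorem.** For all $A$, $\kappa$ and $\lambda$ there is a constant $C=C(A,\kappa,\lambda)$ such that the following holds. Let $\Omega$ be a $\kappa$-domain, let $\sigma$ be a local size function on $\Omega$ that is bounded below by a positive constant, and let $T$ be a rhombille tiling whose side length $s_0$ is coarse in the sense that $\min(\hat\sigma(p),\operatorname{diam}\Omega)\le\lambda s_0$ for all $p\in\Omega$. Then a coarsest diamond-kite mesh formed from $T$ and obeying $\sigma$ exists, only finitely many of its elements meet $\Omega$, and the number of these is at most $C$ times the number of elements of any mesh that covers $\Omega$,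 obeys $\sigma$, and has all aspect ratios at most $A$. -/

import Mathlib

open scoped NNReal

noncomputable section

namespace DiamondKite

/-! The plane is `ℂ` with its Euclidean metric. -/

/-! ### Triangular and quadrilateral elements -/

/-- A mesh element, given by its vertices in cyclic order. Every simple quadrilateral (convex or not)
has a diagonal that runs inside it; its vertices are numbered so that this diagonal joins
vertex `0` to vertex `2`. -/
inductive Element : Type
  | tri (v : Fin 3 → ℂ) : Element
  | quad (v : Fin 4 → ℂ) : Element

namespace Element

/-- The set of vertices. -/
def vertices : Element → Set ℂ
  | tri v => Set.range v
  | quad v => Set.range v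

/-- `x` and `y` are the two ends of a side. -/
def IsSide : Element → ℂ → ℂ → Prop
  | tri v, x, y => ∃ i, (v i = x ∧ v (i + 1) = y) ∨ (v i = y ∧ v (i + 1) = x)
  | quad v, x, y => ∃ i, (v i = x ∧ v (i + 1) = y) ∨ (v i = y ∧ v (i + 1) = x)

/-- The closed region occupied by the element. -/
def region : Element → Set ℂ
  | tri v => convexHull ℝ {v 0, v 1, v 2}
  | quad v => convexHull ℝ {v 0, v 1, v 2} ∪ convexHull ℝ {v 0, v 2, v 3}

/-- The element is a nondegenerate triangle, or a simple quadrilateral that is cut by its diagonal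
from vertex `0` to vertex `2` into two nondegenerate triangles. -/
def IsProper : Element → Prop
  | tri v => AffineIndependent ℝ ![v 0, v 1, v 2]
  | quad v => AffineIndependent ℝ ![v 0, v 1, v 2] ∧ AffineIndependent ℝ ![v 0, v 2, v 3] ∧
      convexHull ℝ {v 0, v 1, v 2} ∩ convexHull ℝ {v 0, v 2, v 3} = segment ℝ (v 0) (v 2)

/-- The aspect ratio is at most `A`: no side is longer than `A` times the distance of any vertex
from any side not incident to it. For a triangle this is the usual bound on
(longest side) / (shortest altitude). -/
def AspectRatioLE (E : Element) (A : ℝ) : Prop :=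
  ∀ x y, E.IsSide x y → ∀ z w, E.IsSide z w → ∀ v ∈ E.vertices, v ≠ z → v ≠ w →
    dist x y ≤ A * Metric.infDist v (segment ℝ z w)

/-- At each point `p` of `Ω` that the element contains, its sides have length at most `σ p`
(the element is not oversized). -/
def Obeys (E : Element) (Ω : Set ℂ) (σ : ℂ → ℝ) : Prop :=
  ∀ p ∈ E.region ∩ Ω, ∀ x y, E.IsSide x y → dist x y ≤ σ p

end Element

/-- The elements `E 0, …, E (n - 1)` form a mesh that covers `Ω`, has aspect ratio at most `A`, and
obeys the size function `σ`. Distinct elements meet only in common vertices and along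
common sides. -/
structure IsMesh {n : ℕ} (E : Fin n → Element) (A : ℝ) (Ω : Set ℂ) (σ : ℂ → ℝ) : Prop where
  proper : ∀ i, (E i).IsProper
  conforming : ∀ i j, i ≠ j → ∀ x ∈ (E i).region ∩ (E j).region,
    x ∈ (E i).vertices ∩ (E j).vertices ∨
      ∃ y z, (E i).IsSide y z ∧ (E j).IsSide y z ∧ x ∈ segment ℝ y z
  covers : Ω ⊆ ⋃ i, (E i).region
  aspect : ∀ i, (E i).AspectRatioLE A
  obeys : ∀ i, (E i).Obeys Ω σ

/-! ### Diamond-kite meshes -/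

/-- The sixth root of unity `exp (i π / 3)`. -/
def zeta : ℂ := ⟨1 / 2, Real.sqrt 3 / 2⟩

/-- A (possibly infinite) set of quadrilaterals, each listed once. -/
abbrev QuadMesh : Type := Set (Fin 4 → ℂ)

/-- The rhombille tiling with a degree-six vertex at `o` and an edge from `o` to `o + a`; its side
length is `‖a‖`. The degree-six vertices are `p = o + a (1 + ζ) (m + n ζ)`. Each of them is
joined to `p + a ζ ^ k`, `0 ≤ k < 6`, and for `k = 0, 1, 2` it is listed as the first acute
vertex of a rhombus. -/
def rhombille (o a : ℂ) : QuadMesh :=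
  {Q | ∃ (m n : ℤ) (k : Fin 3) (p : ℂ), p = o + a * (1 + zeta) * (m + n * zeta) ∧
    Q = ![p, p + a * zeta ^ (k : ℕ), p + a * zeta ^ (k : ℕ) * (1 + zeta),
      p + a * zeta ^ ((k : ℕ) + 1)]}

/-- `x` and `y` are joined by an edge of the mesh. -/
def IsEdge (M : QuadMesh) (x y : ℂ) : Prop :=
  ∃ Q ∈ M, (Element.quad Q).IsSide x y

/-- The replacement step with center `p` and side length `s` may be performed: exactly six edges of
length `s` meet at `p`. The other ends of these edges are the vertices of the replaced hexagon. -/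
def Ready (M : QuadMesh) (p : ℂ) (s : ℝ) : Prop :=
  {u | IsEdge M p u ∧ dist p u = s}.ncard = 6

/-- A quadrilateral with a corner at `p` loses that corner: `p` is replaced by the
centroid of the triangle that `p` forms with its two neighbors in the quadrilateral. -/
def cutCorner (p : ℂ) (Q : Fin 4 → ℂ) : Fin 4 → ℂ :=
  fun i => if Q i = p then (Q (i - 1) + Q i + Q (i + 1)) / 3 else Q i

/-- The diamond with long diagonal from `p` to `u`, with acute angles at these two points. -/
def diamond (p u : ℂ) : Fin 4 → ℂ :=
  ![p, p + (u - p) * (1 + (starRingEnd ℂ) zeta) / 3, u, p + (u - p) * (1 + zeta) / 3]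

/-- The result of the local replacement with center `p` and side length `s`: each of the six edges of
length `s` at `p` becomes the long diagonal of a new diamond, the quadrilaterals that had a
corner at `p` retreat to the boundary of the new diamonds, and the others stay as they are. -/
def replaceAt (M : QuadMesh) (p : ℂ) (s : ℝ) : QuadMesh :=
  {Q | Q ∈ M ∧ p ∉ Set.range Q} ∪ {Q' | ∃ Q ∈ M, p ∈ Set.range Q ∧ Q' = cutCorner p Q} ∪
    {Q' | ∃ u, IsEdge M p u ∧ dist p u = s ∧ Q' = diamond p u}

/-- `M'` is obtained from `M` by one local replacement step. -/
def Step (M M' : QuadMesh) : Prop :=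
  ∃ p s, Ready M p s ∧ M' = replaceAt M p s

/-- `M'` is obtained from `M` by finitely many local replacement steps. The diamond-kite meshes formed
from `T` are the meshes `M` with `Refines T M`. -/
def Refines (M M' : QuadMesh) : Prop :=
  Relation.ReflTransGen Step M M'

/-- No quadrilateral of the mesh is oversized for the size function `σ` on `Ω`. -/
def ObeysSize (M : QuadMesh) (Ω : Set ℂ) (σ : ℂ → ℝ) : Prop :=
  ∀ Q ∈ M, (Element.quad Q).Obeys Ω σ

/-- `M` is the coarsest among the diamond-kite meshes that are formed from `T` and obey `σ` on `Ω`. -/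
structure IsCoarsest (T : QuadMesh) (Ω : Set ℂ) (σ : ℂ → ℝ) (M : QuadMesh) : Prop where
  refines : Refines T M
  obeys : ObeysSize M Ω σ
  coarsest : ∀ M', Refines T M' → ObeysSize M' Ω σ → Refines M M'

/-- The elements of the mesh that meet `Ω`. -/
def elementsMeeting (M : QuadMesh) (Ω : Set ℂ) : Set (Fin 4 → ℂ) :=
  {Q | Q ∈ M ∧ ((Element.quad Q).region ∩ Ω).Nonempty}

/-! ### Domains and size functions -/

/-- A bounded domain to be meshed: it lies in the closure of its interior, and any two points of the
interior are joined, inside the interior, by a path that is at most `κ` times as long as their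
distance (stated by a Lipschitz parametrization on `[0, 1]`). Every bounded convex set with
interior points is such a domain with `κ = 1`. -/
structure IsMeshDomain (κ : ℝ≥0) (Ω : Set ℂ) : Prop where
  bounded : Bornology.IsBounded Ω
  subset_closure : Ω ⊆ closure (interior Ω)
  joined : ∀ p ∈ interior Ω, ∀ q ∈ interior Ω, ∃ γ : ℝ → ℂ, γ 0 = p ∧ γ 1 = q ∧
    LipschitzOnWith (κ * nndist p q) γ (Set.Icc 0 1) ∧ ∀ t ∈ Set.Icc (0 : ℝ) 1, γ t ∈ interior Ω

/-- The local feature size at `p` of the size function `σ` on `Ω`. -/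
def localFeatureSize (Ω : Set ℂ) (σ : ℂ → ℝ) (p : ℂ) : ℝ :=
  ⨅ q : Ω, (dist p (q : ℂ) + σ q)

/-- Tiles of side length `s` are coarse for `σ` on `Ω`, up to the factor `lam`: nowhere are they much
smaller than both the local feature size and the whole domain. -/
def IsCoarse (lam : ℝ) (Ω : Set ℂ) (σ : ℂ → ℝ) (s : ℝ) : Prop :=
  ∀ p ∈ Ω, min (localFeatureSize Ω σ p) (Metric.diam Ω) ≤ lam * s

end DiamondKite

end

/-!
A replacement step of level `k` acts on edges of length `sideLen a k = ‖a‖ / √3 ^ k`, and its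
center lies in a lattice `lattice o a k`. The step needs a fixed set of steps of level `k - 1`:
those at its own center or at three neighbors. Diamond-kite meshes therefore correspond to finite
sets of steps that contain these prerequisites, and refinement corresponds to inclusion. Since
obeying `σ` is preserved by intersecting two such sets, the smallest set whose mesh obeys `σ` yields
the coarsest mesh. Each of its steps is caused by an oversized tile close to the center of the step,
up to a geometric series of prerequisites. Hence at every point of `Ω` the tiles are either of level
`0` or at least a constant times as large as the local feature size.

Conversely, in a mesh that obeys `σ` with aspect ratios at most `A`, every point of `Ω` lies in an
element that is at most a constant times as large as the local feature size. The angles at a vertex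
are bounded below, so boundedly many elements meet at it, and their sizes are comparable as long as
they form one fan of elements joined by common sides. Interpolating the smallest size in the fan
linearly along the sides gives a function whose variation along a path through `Ω` is controlled by
the length of the path. Such a path joins any point of `Ω` to a point that almost realizes the local
feature size, where the element is small because it obeys `σ`.

Finally, every tile of the coarsest mesh comes from a rhombus with an uncut acute corner, and these
corners are separated on the scale of the tiles. So only a bounded number of tiles can meet the part
of an element of the given mesh where the bound by the local feature size holds.
-/

noncomputable section

namespace DiamondKite

/-! ### Lattices and tiles -/

section Eisenstein

lemma sqrt_three_sq : Real.sqrt 3 ^ 2 = 3 := Real.sq_sqrt (by norm_num)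

lemma lt_sqrt_three : (1.73 : ℝ) < Real.sqrt 3 := by
  rw [Real.lt_sqrt (by norm_num)]
  norm_num

lemma sqrt_three_lt : Real.sqrt 3 < (1.74 : ℝ) := by
  rw [Real.sqrt_lt' (by norm_num)]
  norm_num

lemma norm_add_mul_zeta_sq (x y : ℝ) : ‖(x + y * zeta : ℂ)‖ ^ 2 = x ^ 2 + x * y + y ^ 2 := by
  rw [← Complex.normSq_eq_norm_sq, Complex.normSq_apply]
  simp only [zeta, Complex.add_re, Complex.add_im, Complex.mul_re, Complex.mul_im,
    Complex.ofReal_re, Complex.ofReal_im]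
  linear_combination y ^ 2 / 4 * sqrt_three_sq

lemma norm_zeta : ‖zeta‖ = 1 := by
  have h := norm_add_mul_zeta_sq 0 1
  norm_num at h
  exact h.resolve_right (by linarith [norm_nonneg zeta])

lemma conj_zeta : (starRingEnd ℂ) zeta = 1 - zeta := by
  apply Complex.ext <;> simp [zeta]
  norm_num

lemma zeta_sq : zeta ^ 2 = zeta - 1 := by
  have h : zeta * (starRingEnd ℂ) zeta = 1 := by
    rw [Complex.mul_conj, Complex.normSq_eq_norm_sq, norm_zeta]
    norm_num
  rw [conj_zeta] at h
  linear_combination -h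

lemma zeta_pow_three : zeta ^ 3 = -1 := by linear_combination (zeta + 1) * zeta_sq

lemma zeta_pow_add_three (j : ℕ) : zeta ^ (j + 3) = -zeta ^ j := by
  rw [pow_add, zeta_pow_three, mul_neg_one]

lemma isPrimitiveRoot_zeta : IsPrimitiveRoot zeta 6 := by
  refine Polynomial.isRoot_cyclotomic_iff.1 ?_
  simp only [Polynomial.cyclotomic_six, Polynomial.IsRoot, Polynomial.eval_add,
    Polynomial.eval_sub, Polynomial.eval_pow, Polynomial.eval_X, Polynomial.eval_one]
  linear_combination zeta_sq

lemma zeta_pow_add_six_mul (j m : ℕ) : zeta ^ (j + 6 * m) = zeta ^ j := by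
  rw [pow_add, pow_mul, isPrimitiveRoot_zeta.pow_eq_one, one_pow, mul_one]

/-- The ratio `1 + ζ` of the edge vectors of two consecutive levels of tilings; it also takes an
edge vector of a rhombus to its long diagonal. -/
def theta : ℂ := 1 + zeta

lemma theta_sq : theta ^ 2 = 3 * zeta := by
  unfold theta
  linear_combination zeta_sq

lemma norm_theta : ‖theta‖ = Real.sqrt 3 := by
  have h := norm_add_mul_zeta_sq 1 1
  norm_num at h
  rw [← Real.sqrt_sq (norm_nonneg theta), theta, h]

lemma theta_ne_zero : theta ≠ 0 := by
  rw [← norm_pos_iff, norm_theta]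
  positivity

/-- The ring of Eisenstein integers, as a subring of `ℂ`. -/
def eisenstein : Subring ℂ where
  carrier := {z | ∃ m n : ℤ, z = m + n * zeta}
  mul_mem' := by
    rintro _ _ ⟨m, n, rfl⟩ ⟨m', n', rfl⟩
    refine ⟨m * m' - n * n', m * n' + n * m' + n * n', ?_⟩
    push_cast
    linear_combination (n * n' : ℂ) * zeta_sq
  one_mem' := ⟨1, 0, by simp⟩
  add_mem' := by
    rintro _ _ ⟨m, n, rfl⟩ ⟨m', n', rfl⟩
    exact ⟨m + m', n + n', by push_cast; ring⟩
  zero_mem' := ⟨0, 0, by simp⟩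
  neg_mem' := by
    rintro _ ⟨m, n, rfl⟩
    exact ⟨-m, -n, by push_cast; ring⟩

lemma zeta_mem_eisenstein : zeta ∈ eisenstein := ⟨0, 1, by simp⟩

lemma theta_mem_eisenstein : theta ∈ eisenstein := add_mem (one_mem _) zeta_mem_eisenstein

lemma norm_intCast_add_mul_zeta_sq (m n : ℤ) :
    ‖(m + n * zeta : ℂ)‖ ^ 2 = ((m ^ 2 + m * n + n ^ 2 : ℤ) : ℝ) := by
  exact_mod_cast norm_add_mul_zeta_sq m n

lemma one_le_norm_of_mem_eisenstein {z : ℂ} (hz : z ∈ eisenstein) (h0 : z ≠ 0) : 1 ≤ ‖z‖ := by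
  obtain ⟨m, n, rfl⟩ := hz
  have hpos : 0 < ‖(m + n * zeta : ℂ)‖ ^ 2 := by positivity
  rw [← one_le_sq_iff₀ (norm_nonneg _)]
  rw [norm_intCast_add_mul_zeta_sq] at hpos ⊢
  exact_mod_cast Int.add_one_le_of_lt (Int.cast_pos.1 hpos)

lemma exists_eq_zeta_pow_of_norm_le_one {z : ℂ} (hz : z ∈ eisenstein) (h0 : z ≠ 0)
    (h1 : ‖z‖ ≤ 1) : ∃ j : ℕ, z = zeta ^ j := by
  have hnorm : ‖z‖ = 1 := le_antisymm h1 (one_le_norm_of_mem_eisenstein hz h0)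
  obtain ⟨m, n, rfl⟩ := hz
  have hmn : m ^ 2 + m * n + n ^ 2 = 1 := by
    have h := norm_intCast_add_mul_zeta_sq m n
    rw [hnorm, one_pow] at h
    exact_mod_cast h.symm
  obtain ⟨hm₁, hm₂⟩ : -1 ≤ m ∧ m ≤ 1 := by
    constructor <;> nlinarith [sq_nonneg (m + 2 * n)]
  obtain ⟨hn₁, hn₂⟩ : -1 ≤ n ∧ n ≤ 1 := by
    constructor <;> nlinarith [sq_nonneg (n + 2 * m)]
  have h4 : zeta ^ 4 = -zeta := by rw [zeta_pow_add_three 1, pow_one]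
  have h5 : zeta ^ 5 = 1 - zeta := by rw [zeta_pow_add_three 2, zeta_sq, neg_sub]
  interval_cases m <;> interval_cases n <;> try (exfalso; revert hmn; norm_num; done)
  · exact ⟨3, by rw [zeta_pow_three]; push_cast; ring⟩
  · exact ⟨2, by rw [zeta_sq]; push_cast; ring⟩
  · exact ⟨4, by rw [h4]; push_cast; ring⟩
  · exact ⟨1, by simp⟩
  · exact ⟨5, by rw [h5]; push_cast; ring⟩
  · exact ⟨0, by simp⟩

lemma exists_eq_theta_mul_of_dvd_sub {m n : ℤ} (h : 3 ∣ m - n) :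
    ∃ w ∈ eisenstein, (m + n * zeta : ℂ) = theta * w := by
  obtain ⟨l, hl⟩ := h
  refine ⟨n + l * (2 - zeta), ⟨n + 2 * l, -l, by push_cast; ring⟩, ?_⟩
  have hm : (m : ℂ) = n + 3 * l := by exact_mod_cast eq_add_of_sub_eq' hl
  rw [hm, theta]
  linear_combination (l : ℂ) * zeta_sq

-- `ℤ[ζ] / (θ)` is the field with three elements, and `ζ ≡ -1` modulo `θ`.
lemma exists_eq_theta_mul_or {z : ℂ} (hz : z ∈ eisenstein) :
    (∃ w ∈ eisenstein, z = theta * w) ∨ (∃ w ∈ eisenstein, z + 1 = theta * w) ∨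
      (∃ w ∈ eisenstein, z + zeta = theta * w) := by
  obtain ⟨m, n, rfl⟩ := hz
  have hmod : 3 ∣ m - n ∨ 3 ∣ m + 1 - n ∨ 3 ∣ m - (n + 1) := by omega
  rcases hmod with h | h | h
  · exact Or.inl (exists_eq_theta_mul_of_dvd_sub h)
  · obtain ⟨w, hw, h⟩ := exists_eq_theta_mul_of_dvd_sub h
    exact Or.inr (Or.inl ⟨w, hw, by rw [← h]; push_cast; ring⟩)
  · obtain ⟨w, hw, h⟩ := exists_eq_theta_mul_of_dvd_sub h
    exact Or.inr (Or.inr ⟨w, hw, by rw [← h]; push_cast; ring⟩)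

end Eisenstein

section Lattices

/-- An edge vector of the rhombille tiling of level `k`, which arises from the tiling of level `0`
with edge vector `a` when every possible replacement step of the levels below `k` is performed. -/
def edgeVec (a : ℂ) (k : ℕ) : ℂ := a / theta ^ k

/-- The degree-six vertices of the rhombille tiling of level `k`; these are the centers at which
replacement steps of level `k` are possible. -/
def lattice (o a : ℂ) (k : ℕ) : Set ℂ := {x | ∃ z ∈ eisenstein, x = o + edgeVec a k * theta * z}

/-- The side length of the rhombille tiling of level `k`. -/
def sideLen (a : ℂ) (k : ℕ) : ℝ := ‖edgeVec a k‖

lemma edgeVec_zero (a : ℂ) : edgeVec a 0 = a := by rw [edgeVec, pow_zero, div_one]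

lemma edgeVec_succ_mul_theta (a : ℂ) (k : ℕ) : edgeVec a (k + 1) * theta = edgeVec a k := by
  rw [edgeVec, edgeVec, pow_succ, ← div_div, div_mul_cancel₀ _ theta_ne_zero]

lemma edgeVec_ne_zero {a : ℂ} (ha : a ≠ 0) (k : ℕ) : edgeVec a k ≠ 0 :=
  div_ne_zero ha (pow_ne_zero _ theta_ne_zero)

lemma sideLen_zero (a : ℂ) : sideLen a 0 = ‖a‖ := by rw [sideLen, edgeVec_zero]

lemma sideLen_nonneg (a : ℂ) (k : ℕ) : 0 ≤ sideLen a k := norm_nonneg _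

lemma sideLen_pos {a : ℂ} (ha : a ≠ 0) (k : ℕ) : 0 < sideLen a k :=
  norm_pos_iff.2 (edgeVec_ne_zero ha k)

lemma sideLen_eq_sqrt_three_mul (a : ℂ) (k : ℕ) :
    sideLen a k = Real.sqrt 3 * sideLen a (k + 1) := by
  rw [sideLen, sideLen, ← edgeVec_succ_mul_theta, norm_mul, norm_theta, mul_comm]

lemma sideLen_eq_three_mul (a : ℂ) (k : ℕ) : sideLen a k = 3 * sideLen a (k + 2) := by
  rw [sideLen_eq_sqrt_three_mul, sideLen_eq_sqrt_three_mul, ← mul_assoc, ← pow_two, sqrt_three_sq]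

lemma sideLen_strictAnti {a : ℂ} (ha : a ≠ 0) : StrictAnti (sideLen a) := by
  refine strictAnti_nat_of_succ_lt fun k => ?_
  rw [sideLen_eq_sqrt_three_mul a k]
  nlinarith [sideLen_pos ha (k + 1), lt_sqrt_three]

lemma norm_edgeVec_mul_zeta_pow (a : ℂ) (k j : ℕ) : ‖edgeVec a k * zeta ^ j‖ = sideLen a k := by
  rw [norm_mul, norm_pow, norm_zeta, one_pow, mul_one, sideLen]

lemma dist_add_edgeVec_mul_zeta_pow (a x : ℂ) (k j : ℕ) :
    dist x (x + edgeVec a k * zeta ^ j) = sideLen a k := by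
  rw [dist_self_add_right, norm_edgeVec_mul_zeta_pow]

variable {o a x y z : ℂ} {k : ℕ}

lemma add_edgeVec_mul_theta_mul_mem_lattice (hx : x ∈ lattice o a k) (hz : z ∈ eisenstein) :
    x + edgeVec a k * (theta * z) ∈ lattice o a k := by
  obtain ⟨w, hw, rfl⟩ := hx
  exact ⟨w + z, add_mem hw hz, by ring⟩

lemma add_edgeVec_mul_mem_lattice_succ (hx : x ∈ lattice o a (k + 1)) (hz : z ∈ eisenstein) :
    x + edgeVec a k * z ∈ lattice o a (k + 1) := by
  rw [← edgeVec_succ_mul_theta, mul_assoc]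
  exact add_edgeVec_mul_theta_mul_mem_lattice hx hz

lemma lattice_subset_succ : lattice o a k ⊆ lattice o a (k + 1) := by
  rintro x ⟨z, hz, rfl⟩
  exact ⟨theta * z, mul_mem theta_mem_eisenstein hz, by rw [← edgeVec_succ_mul_theta a k]; ring⟩

lemma lattice_mono : Monotone (lattice o a) := monotone_nat_of_le_succ fun _ => lattice_subset_succ

lemma exists_eq_add_edgeVec_mul_theta_mul (hx : x ∈ lattice o a k) (hy : y ∈ lattice o a k) :
    ∃ z ∈ eisenstein, y = x + edgeVec a k * (theta * z) := by
  obtain ⟨w, hw, rfl⟩ := hx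
  obtain ⟨v, hv, rfl⟩ := hy
  exact ⟨v - w, sub_mem hv hw, by ring⟩

lemma eq_of_dist_lt_sqrt_three_mul_sideLen (hx : x ∈ lattice o a k) (hy : y ∈ lattice o a k)
    (h : dist x y < Real.sqrt 3 * sideLen a k) : x = y := by
  obtain ⟨z, hz, rfl⟩ := exists_eq_add_edgeVec_mul_theta_mul hx hy
  by_contra hne
  have h0 : z ≠ 0 := by
    rintro rfl
    simp at hne
  rw [dist_self_add_right, norm_mul, norm_mul, norm_theta, ← sideLen] at h
  have : 0 ≤ sideLen a k * Real.sqrt 3 := mul_nonneg (sideLen_nonneg a k) (Real.sqrt_nonneg 3)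
  nlinarith [one_le_norm_of_mem_eisenstein hz h0]

lemma eq_of_dist_le_sideLen (ha : a ≠ 0) (hx : x ∈ lattice o a k) (hy : y ∈ lattice o a k)
    (h : dist x y ≤ sideLen a k) : x = y :=
  eq_of_dist_lt_sqrt_three_mul_sideLen hx hy
    (h.trans_lt (by nlinarith [sideLen_pos ha k, lt_sqrt_three]))

lemma add_edgeVec_mul_zeta_pow_mem_lattice_succ (hx : x ∈ lattice o a k) (j : ℕ) :
    x + edgeVec a k * zeta ^ j ∈ lattice o a (k + 1) :=
  add_edgeVec_mul_mem_lattice_succ (lattice_subset_succ hx) (pow_mem zeta_mem_eisenstein _)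

lemma add_edgeVec_mul_zeta_pow_notMem_lattice (ha : a ≠ 0) (hx : x ∈ lattice o a k) (j : ℕ) :
    x + edgeVec a k * zeta ^ j ∉ lattice o a k := by
  intro h
  have hdist := dist_add_edgeVec_mul_zeta_pow a x k j
  rw [← eq_of_dist_le_sideLen ha hx h hdist.le, dist_self] at hdist
  exact (sideLen_pos ha k).ne hdist

lemma eq_or_exists_eq_add_edgeVec_mul_zeta_pow (ha : a ≠ 0) (hx : x ∈ lattice o a (k + 1))
    (hy : y ∈ lattice o a (k + 1)) (h : dist x y ≤ sideLen a k) :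
    y = x ∨ ∃ j : ℕ, y = x + edgeVec a k * zeta ^ j := by
  obtain ⟨z, hz, rfl⟩ := exists_eq_add_edgeVec_mul_theta_mul hx hy
  rw [← mul_assoc, edgeVec_succ_mul_theta] at h ⊢
  rcases eq_or_ne z 0 with rfl | h0
  · simp
  rw [dist_self_add_right, norm_mul, ← sideLen] at h
  obtain ⟨j, rfl⟩ := exists_eq_zeta_pow_of_norm_le_one hz h0
    (le_of_mul_le_mul_left (h.trans_eq (mul_one _).symm) (sideLen_pos ha k))
  exact Or.inr ⟨j, rfl⟩

-- `ζ² - 1 = (ζ - 1) θ`, so turning by `120°` does not change the class modulo `θ`.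
lemma add_edgeVec_mul_zeta_pow_two_mul_mem_lattice {w : ℂ} (hw : w ∈ eisenstein)
    (h : x + edgeVec a k * w ∈ lattice o a k) (m : ℕ) :
    x + edgeVec a k * (w * zeta ^ (2 * m)) ∈ lattice o a k := by
  induction m with
  | zero => simpa using h
  | succ m ih =>
    have := add_edgeVec_mul_theta_mul_mem_lattice ih
      (mul_mem (mul_mem hw (pow_mem zeta_mem_eisenstein (2 * m)))
        (sub_mem zeta_mem_eisenstein (one_mem _)))
    convert this using 1
    unfold theta
    ring

lemma mem_lattice_or_exists_neighbors (hx : x ∈ lattice o a (k + 1)) :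
    x ∈ lattice o a k ∨ ∃ i, ∀ m, x + edgeVec a k * zeta ^ (i + 2 * m) ∈ lattice o a k := by
  obtain ⟨z, hz, hxz⟩ := hx
  rw [edgeVec_succ_mul_theta] at hxz
  rcases exists_eq_theta_mul_or hz with ⟨w, hw, h⟩ | ⟨w, hw, h⟩ | ⟨w, hw, h⟩
  · exact Or.inl ⟨w, hw, by rw [hxz, h]; ring⟩
  · refine Or.inr ⟨0, fun m => ?_⟩
    have hx1 : x + edgeVec a k * 1 ∈ lattice o a k :=
      ⟨w, hw, by rw [hxz]; linear_combination edgeVec a k * h⟩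
    rw [zero_add, ← one_mul (zeta ^ _)]
    exact add_edgeVec_mul_zeta_pow_two_mul_mem_lattice (one_mem _) hx1 m
  · refine Or.inr ⟨1, fun m => ?_⟩
    have hx1 : x + edgeVec a k * zeta ∈ lattice o a k :=
      ⟨w, hw, by rw [hxz]; linear_combination edgeVec a k * h⟩
    rw [pow_add, pow_one]
    exact add_edgeVec_mul_zeta_pow_two_mul_mem_lattice zeta_mem_eisenstein hx1 m

end Lattices

section Tiles

lemma fin_four_cases (i l : Fin 4) : l = i ∨ l = i + 1 ∨ l = i + 2 ∨ l = i + 3 := by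
  revert i l
  decide

variable {o a : ℂ} {k : ℕ} {Q : Fin 4 → ℂ} {i l : Fin 4} {j : ℕ}

/-- The corners of `Q`, listed from the `i`-th on, are those of the rhombus whose acute corner `Q i`
has the two neighbors `Q i + edgeVec a k * ζ ^ j` and `Q i + edgeVec a k * ζ ^ (j + 1)`. -/
structure IsAcuteCorner (a : ℂ) (k : ℕ) (Q : Fin 4 → ℂ) (i : Fin 4) (j : ℕ) : Prop where
  one : Q (i + 1) = Q i + edgeVec a k * zeta ^ j
  two : Q (i + 2) = Q i + edgeVec a k * (theta * zeta ^ j)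
  three : Q (i + 3) = Q i + edgeVec a k * zeta ^ (j + 1)

/-- `Q` lists the corners of a tile of the rhombille tiling of level `k`; the list may start at any
corner. -/
def IsTile (o a : ℂ) (k : ℕ) (Q : Fin 4 → ℂ) : Prop :=
  ∃ i, Q i ∈ lattice o a k ∧ ∃ j, IsAcuteCorner a k Q i j

/-- The centroid of the triangle formed by the `i`-th corner of `Q` and its two neighbors. -/
def cornerCentroid (Q : Fin 4 → ℂ) (i : Fin 4) : ℂ := (Q (i - 1) + Q i + Q (i + 1)) / 3

namespace IsAcuteCorner

lemma opposite (h : IsAcuteCorner a k Q i j) : IsAcuteCorner a k Q (i + 2) (j + 3) := by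
  have h4 : zeta ^ (j + 3 + 1) = -zeta ^ (j + 1) := by rw [add_right_comm, zeta_pow_add_three]
  constructor <;>
    simp only [add_assoc i, Fin.reduceAdd, add_zero, h.one, h.two, h.three, h4,
      zeta_pow_add_three j] <;>
    unfold theta <;> ring

lemma mem_two (hi : Q i ∈ lattice o a k) (h : IsAcuteCorner a k Q i j) :
    Q (i + 2) ∈ lattice o a k := by
  rw [h.two]
  exact add_edgeVec_mul_theta_mul_mem_lattice hi (pow_mem zeta_mem_eisenstein j)

lemma eq_or_eq_add_two (ha : a ≠ 0) (hi : Q i ∈ lattice o a k) (h : IsAcuteCorner a k Q i j)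
    (hl : Q l ∈ lattice o a k) : l = i ∨ l = i + 2 := by
  rcases fin_four_cases i l with rfl | rfl | rfl | rfl
  · exact Or.inl rfl
  · exact absurd (h.one ▸ hl) (add_edgeVec_mul_zeta_pow_notMem_lattice ha hi _)
  · exact Or.inr rfl
  · exact absurd (h.three ▸ hl) (add_edgeVec_mul_zeta_pow_notMem_lattice ha hi _)

lemma eq_add_one_or_eq_add_three (hi : Q i ∈ lattice o a k) (h : IsAcuteCorner a k Q i j)
    (hl : Q l ∉ lattice o a k) : l = i + 1 ∨ l = i + 3 := by
  rcases fin_four_cases i l with rfl | rfl | rfl | rfl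
  · exact absurd hi hl
  · exact Or.inl rfl
  · exact absurd (h.mem_two hi) hl
  · exact Or.inr rfl

lemma cornerCentroid_eq (h : IsAcuteCorner a k Q i j) :
    cornerCentroid Q i = Q i + edgeVec a (k + 1) * zeta ^ (j + 1) := by
  rw [cornerCentroid, sub_eq_add_neg, show (-1 : Fin 4) = 3 from rfl, h.one, h.three,
    ← edgeVec_succ_mul_theta a k]
  unfold theta
  linear_combination edgeVec a (k + 1) / 3 * zeta ^ j * zeta_sq

lemma one_eq_cornerCentroid_add (h : IsAcuteCorner a k Q i j) :
    Q (i + 1) = cornerCentroid Q i + edgeVec a (k + 1) * zeta ^ j := by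
  rw [h.cornerCentroid_eq, h.one, ← edgeVec_succ_mul_theta a k]
  unfold theta
  ring

lemma three_eq_cornerCentroid_add (h : IsAcuteCorner a k Q i j) :
    Q (i + 3) = cornerCentroid Q i + edgeVec a (k + 1) * zeta ^ (j + 2) := by
  rw [h.cornerCentroid_eq, h.three, ← edgeVec_succ_mul_theta a k]
  unfold theta
  ring

lemma isSide_one (h : IsAcuteCorner a k Q i j) :
    (Element.quad Q).IsSide (Q i) (Q i + edgeVec a k * zeta ^ j) :=
  ⟨i, Or.inl ⟨rfl, h.one⟩⟩

lemma isSide_three (h : IsAcuteCorner a k Q i j) :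
    (Element.quad Q).IsSide (Q i) (Q i + edgeVec a k * zeta ^ (j + 1)) := by
  refine ⟨i + 3, Or.inr ⟨h.three, ?_⟩⟩
  rw [add_assoc, show (3 + 1 : Fin 4) = 0 from rfl, add_zero]

end IsAcuteCorner

namespace IsTile

lemma isAcuteCorner (ha : a ≠ 0) (h : IsTile o a k Q) (hi : Q i ∈ lattice o a k) :
    ∃ j, IsAcuteCorner a k Q i j := by
  obtain ⟨l, hl, j, hj⟩ := h
  rcases hj.eq_or_eq_add_two ha hl hi with rfl | rfl
  · exact ⟨j, hj⟩
  · exact ⟨j + 3, hj.opposite⟩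

lemma mem_lattice_or_mem_lattice_add_one (h : IsTile o a k Q) (i : Fin 4) :
    Q i ∈ lattice o a k ∨ Q (i + 1) ∈ lattice o a k := by
  obtain ⟨l, hl, j, hj⟩ := h
  rcases fin_four_cases l i with rfl | rfl | rfl | rfl
  · exact Or.inl hl
  · rw [add_assoc]
    exact Or.inr (hj.mem_two hl)
  · exact Or.inl (hj.mem_two hl)
  · rw [add_assoc, show (3 + 1 : Fin 4) = 0 from rfl, add_zero]
    exact Or.inr hl

lemma exists_eq_add (ha : a ≠ 0) (h : IsTile o a k Q) (hi : Q i ∈ lattice o a k)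
    (hl : Q l ∉ lattice o a k) : ∃ j : ℕ, Q l = Q i + edgeVec a k * zeta ^ j := by
  obtain ⟨j, hj⟩ := h.isAcuteCorner ha hi
  rcases hj.eq_add_one_or_eq_add_three hi hl with rfl | rfl
  exacts [⟨j, hj.one⟩, ⟨j + 1, hj.three⟩]

lemma dist_eq (ha : a ≠ 0) (h : IsTile o a k Q) (hi : Q i ∈ lattice o a k)
    (hl : Q l ∉ lattice o a k) : dist (Q i) (Q l) = sideLen a k := by
  obtain ⟨j, hj⟩ := h.exists_eq_add ha hi hl
  rw [hj, dist_add_edgeVec_mul_zeta_pow]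

lemma mem_lattice_succ (h : IsTile o a k Q) (l : Fin 4) : Q l ∈ lattice o a (k + 1) := by
  obtain ⟨i, hi, j, hj⟩ := h
  rcases fin_four_cases i l with rfl | rfl | rfl | rfl
  · exact lattice_subset_succ hi
  · exact hj.one ▸ add_edgeVec_mul_zeta_pow_mem_lattice_succ hi _
  · exact lattice_subset_succ (hj.mem_two hi)
  · exact hj.three ▸ add_edgeVec_mul_zeta_pow_mem_lattice_succ hi _

lemma cornerCentroid_eq_add (ha : a ≠ 0) (h : IsTile o a k Q) (hi : Q i ∈ lattice o a k)
    (hl : Q l ∉ lattice o a k) :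
    ∃ j : ℕ, cornerCentroid Q i = Q l + edgeVec a (k + 1) * zeta ^ j := by
  obtain ⟨j, hj⟩ := h.isAcuteCorner ha hi
  rcases hj.eq_add_one_or_eq_add_three hi hl with rfl | rfl
  · refine ⟨j + 3, ?_⟩
    rw [hj.one_eq_cornerCentroid_add, zeta_pow_add_three]
    ring
  · refine ⟨j + 2 + 3, ?_⟩
    rw [hj.three_eq_cornerCentroid_add, zeta_pow_add_three]
    ring

lemma dist_cornerCentroid (ha : a ≠ 0) (h : IsTile o a k Q) (hi : Q i ∈ lattice o a k) :
    dist (Q i) (cornerCentroid Q i) = sideLen a (k + 1) := by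
  obtain ⟨j, hj⟩ := h.isAcuteCorner ha hi
  rw [hj.cornerCentroid_eq, dist_add_edgeVec_mul_zeta_pow]

lemma dist_obtuse_cornerCentroid (ha : a ≠ 0) (h : IsTile o a k Q) (hi : Q i ∈ lattice o a k)
    (hl : Q l ∉ lattice o a k) : dist (Q l) (cornerCentroid Q i) = sideLen a (k + 1) := by
  obtain ⟨j, hj⟩ := h.cornerCentroid_eq_add ha hi hl
  rw [hj, dist_add_edgeVec_mul_zeta_pow]

lemma cornerCentroid_mem_lattice (ha : a ≠ 0) (h : IsTile o a k Q) (hi : Q i ∈ lattice o a k) :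
    cornerCentroid Q i ∈ lattice o a (k + 2) := by
  obtain ⟨j, hj⟩ := h.isAcuteCorner ha hi
  rw [hj.cornerCentroid_eq]
  exact add_edgeVec_mul_zeta_pow_mem_lattice_succ (lattice_subset_succ hi) _

lemma cornerCentroid_notMem_lattice (ha : a ≠ 0) (h : IsTile o a k Q)
    (hi : Q i ∈ lattice o a k) : cornerCentroid Q i ∉ lattice o a (k + 1) := by
  obtain ⟨j, hj⟩ := h.isAcuteCorner ha hi
  rw [hj.cornerCentroid_eq]
  exact add_edgeVec_mul_zeta_pow_notMem_lattice ha (lattice_subset_succ hi) _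

end IsTile

/-- The quadrilateral `Q` with each corner in `S` cut, that is, replaced by the centroid of
this corner and its two neighbors. -/
def cutCorners (S : Set ℂ) (Q : Fin 4 → ℂ) : Fin 4 → ℂ :=
  haveI := Classical.decPred (· ∈ S)
  fun i => if Q i ∈ S then cornerCentroid Q i else Q i

variable {S S' : Set ℂ}

lemma cutCorners_of_mem (h : Q i ∈ S) : cutCorners S Q i = cornerCentroid Q i := if_pos h

lemma cutCorners_of_notMem (h : Q i ∉ S) : cutCorners S Q i = Q i := if_neg h

lemma cutCorners_congr (h : ∀ i, Q i ∈ S ↔ Q i ∈ S') : cutCorners S Q = cutCorners S' Q := by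
  funext i
  by_cases hi : Q i ∈ S
  · rw [cutCorners_of_mem hi, cutCorners_of_mem ((h i).1 hi)]
  · rw [cutCorners_of_notMem hi, cutCorners_of_notMem (mt (h i).2 hi)]

lemma cutCorners_eq_self (h : ∀ i, Q i ∉ S) : cutCorners S Q = Q :=
  funext fun i => cutCorners_of_notMem (h i)

lemma IsTile.cutCorners_mem_lattice_succ_iff (ha : a ≠ 0) (hS : S ⊆ lattice o a k)
    (h : IsTile o a k Q) : cutCorners S Q l ∈ lattice o a (k + 1) ↔ Q l ∉ S := by
  by_cases hl : Q l ∈ S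
  · simpa only [cutCorners_of_mem hl, hl, not_true_eq_false, iff_false] using
      h.cornerCentroid_notMem_lattice ha (hS hl)
  · simpa only [cutCorners_of_notMem hl, hl, not_false_eq_true, iff_true] using
      h.mem_lattice_succ l

-- Cutting both acute corners turns the obtuse corners into the acute corners of a smaller rhombus.
lemma IsTile.isTile_cutCorners (ha : a ≠ 0) (hS : S ⊆ lattice o a k) (h : IsTile o a k Q)
    (hcut : ∀ i, Q i ∈ lattice o a k → Q i ∈ S) : IsTile o a (k + 1) (cutCorners S Q) := by
  obtain ⟨i, hi, j, hj⟩ := h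
  have n1 : Q (i + 1) ∉ S := fun hm =>
    add_edgeVec_mul_zeta_pow_notMem_lattice ha hi j (hj.one ▸ hS hm)
  have n3 : Q (i + 3) ∉ S := fun hm =>
    add_edgeVec_mul_zeta_pow_notMem_lattice ha hi (j + 1) (hj.three ▸ hS hm)
  have hopp := hj.opposite.cornerCentroid_eq
  refine ⟨i + 1, ?_, j + 2, ?_⟩
  · rw [cutCorners_of_notMem n1, hj.one]
    exact add_edgeVec_mul_zeta_pow_mem_lattice_succ hi j
  constructor <;> simp only [add_assoc i, Fin.reduceAdd, add_zero]
  · rw [cutCorners_of_mem (hcut _ (hj.mem_two hi)), cutCorners_of_notMem n1, hopp, hj.two, hj.one,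
      add_right_comm, zeta_pow_add_three, ← edgeVec_succ_mul_theta a k]
    unfold theta
    ring
  · rw [cutCorners_of_notMem n3, cutCorners_of_notMem n1, hj.three, hj.one,
      ← edgeVec_succ_mul_theta a k]
    unfold theta
    linear_combination -(edgeVec a (k + 1) * zeta ^ j * (1 + zeta)) * zeta_sq
  · rw [cutCorners_of_mem (hcut _ hi), cutCorners_of_notMem n1, hj.one_eq_cornerCentroid_add,
      add_right_comm, zeta_pow_add_three]
    ring

lemma isAcuteCorner_diamond (a x : ℂ) (k j : ℕ) :
    IsAcuteCorner a (k + 1) (diamond x (x + edgeVec a k * zeta ^ j)) 0 j := by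
  refine ⟨?_, ?_, ?_⟩ <;>
    simp only [diamond, zero_add, conj_zeta, ← edgeVec_succ_mul_theta a k, Matrix.cons_val,
      theta, add_sub_cancel_left]
  · linear_combination (-1 / 3 : ℂ) * edgeVec a (k + 1) * zeta ^ j * zeta_sq
  · ring
  · linear_combination (1 / 3 : ℂ) * edgeVec a (k + 1) * zeta ^ j * zeta_sq

lemma isTile_diamond {x : ℂ} (hx : x ∈ lattice o a k) (j : ℕ) :
    IsTile o a (k + 1) (diamond x (x + edgeVec a k * zeta ^ j)) :=
  ⟨0, lattice_subset_succ hx, j, isAcuteCorner_diamond a x k j⟩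

lemma isTile_of_mem_rhombille (h : Q ∈ rhombille o a) : IsTile o a 0 Q := by
  obtain ⟨m, n, j, p, hp, rfl⟩ := h
  refine ⟨0, ⟨m + n * zeta, ⟨m, n, rfl⟩, ?_⟩, j, ⟨?_, ?_, ?_⟩⟩ <;>
    simp only [edgeVec_zero, theta, zero_add, Matrix.cons_val]
  · exact hp
  · ring

end Tiles

/-! ### Sets of replacement steps and their meshes -/

section MeshOfReplacements

/-- The centers of the replacement steps of level `k` in `D`. A pair `(k, x)` in `D` stands for the
replacement step with center `x` and side length `sideLen a k`. -/
def level (D : Finset (ℕ × ℂ)) (k : ℕ) : Set ℂ := {x | (k, x) ∈ D}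

/-- `D` is a set of replacement steps that contains the prerequisites of each of its members: before
a step of level `k + 1` with center `x`, all steps of level `k` whose hexagons contain `x` have to
be performed. -/
structure IsDownClosed (o a : ℂ) (D : Finset (ℕ × ℂ)) : Prop where
  mem : ∀ k, level D k ⊆ lattice o a k
  down : ∀ k, ∀ x ∈ level D (k + 1), ∀ q ∈ lattice o a k, dist x q ≤ sideLen a k → q ∈ level D k

/-- All acute corners of the level `k` tile `Q` are centers of replacement steps in `D`; such a tile
disappears in the mesh, leaving behind a tile of level `k + 1`. -/
def IsFullyCut (o a : ℂ) (D : Finset (ℕ × ℂ)) (k : ℕ) (Q : Fin 4 → ℂ) : Prop :=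
  ∀ i, Q i ∈ lattice o a k → Q i ∈ level D k

/-- The tiles of level `k` that appear, possibly with cut corners, while the replacement steps in
`D` are performed. -/
def tiles (o a : ℂ) (D : Finset (ℕ × ℂ)) : ℕ → Set (Fin 4 → ℂ)
  | 0 => rhombille o a
  | k + 1 => {Q | ∃ x ∈ level D k, ∃ j : ℕ, Q = diamond x (x + edgeVec a k * zeta ^ j)} ∪
      {Q' | ∃ Q ∈ tiles o a D k, IsFullyCut o a D k Q ∧ Q' = cutCorners (level D k) Q}

/-- The mesh that results from performing the replacement steps in `D`. -/
def meshOf (o a : ℂ) (D : Finset (ℕ × ℂ)) : QuadMesh :=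
  {Q' | ∃ k, ∃ Q ∈ tiles o a D k, ¬ IsFullyCut o a D k Q ∧ Q' = cutCorners (level D k) Q}

variable {o a : ℂ} {k l : ℕ} {D : Finset (ℕ × ℂ)} {Q : Fin 4 → ℂ} {i j : Fin 4}

lemma not_isFullyCut_iff :
    ¬ IsFullyCut o a D k Q ↔ ∃ i, Q i ∈ lattice o a k ∧ Q i ∉ level D k := by
  simp only [IsFullyCut, not_forall, exists_prop]

lemma IsDownClosed.mem_level_of_le (hD : IsDownClosed o a D) (hlk : l ≤ k) {x : ℂ}
    (hx : x ∈ level D k) (hl : x ∈ lattice o a l) : x ∈ level D l := by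
  induction k, hlk using Nat.le_induction with
  | base => exact hx
  | succ k hk ih =>
    exact ih (hD.down k x hx x (lattice_mono hk hl) (by rw [dist_self]; exact sideLen_nonneg _ _))

lemma isTile_of_mem_tiles (ha : a ≠ 0) (hD : IsDownClosed o a D) (hQ : Q ∈ tiles o a D k) :
    IsTile o a k Q := by
  induction k generalizing Q with
  | zero => exact isTile_of_mem_rhombille hQ
  | succ k ih =>
    rcases hQ with ⟨x, hx, j, rfl⟩ | ⟨Q, hQ, hcut, rfl⟩
    · exact isTile_diamond (hD.mem k hx) j
    · exact (ih hQ).isTile_cutCorners ha (hD.mem k) hcut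

lemma isDownClosed_empty : IsDownClosed o a ∅ :=
  ⟨fun _ _ hx => absurd hx (Finset.notMem_empty _), fun _ _ hx => absurd hx (Finset.notMem_empty _)⟩

lemma meshOf_empty (ha : a ≠ 0) : meshOf o a ∅ = rhombille o a := by
  have hlevel : ∀ k x, x ∉ level ∅ k := fun k x => Finset.notMem_empty _
  have huncut : ∀ k, ∀ Q ∈ tiles o a ∅ k, ¬ IsFullyCut o a ∅ k Q := by
    intro k Q hQ hcut
    obtain ⟨i, hi, -⟩ := isTile_of_mem_tiles ha isDownClosed_empty hQ
    exact hlevel k _ (hcut i hi)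
  have htiles : ∀ k, ∀ Q ∈ tiles o a ∅ k, k = 0 := by
    rintro (_ | k) Q hQ
    · rfl
    · rcases hQ with ⟨x, hx, -⟩ | ⟨Q, hQ, hcut, -⟩
      exacts [absurd hx (hlevel k x), absurd hcut (huncut k Q hQ)]
  ext Q
  constructor
  · rintro ⟨k, Q, hQ, -, rfl⟩
    obtain rfl := htiles k Q hQ
    rwa [cutCorners_eq_self fun i => hlevel _ _]
  · intro hQ
    exact ⟨0, Q, hQ, huncut 0 Q hQ, (cutCorners_eq_self fun i => hlevel _ _).symm⟩

end MeshOfReplacements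

section Edges

variable {o a : ℂ} {k : ℕ} {D : Finset (ℕ × ℂ)} {Q : Fin 4 → ℂ} {i l : Fin 4} {x p c : ℂ}

/-- The point `c` is joined to `x` by an edge of the tiling of level `k` with center `x`, and the
replacement steps in `D` have created this edge and not removed it. -/
structure LevelEdge (o a : ℂ) (D : Finset (ℕ × ℂ)) (k : ℕ) (x c : ℂ) : Prop where
  mem : x ∈ lattice o a k
  notMem : x ∉ level D k
  eq : ∃ j : ℕ, c = x + edgeVec a k * zeta ^ j
  pred : ∀ l, k = l + 1 → ∃ y ∈ level D l, dist y c = sideLen a k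

lemma LevelEdge.dist_eq (h : LevelEdge o a D k x c) : dist x c = sideLen a k := by
  obtain ⟨j, rfl⟩ := h.eq
  exact dist_add_edgeVec_mul_zeta_pow a x k j

lemma exists_mem_level_dist_eq_of_notMem_lattice (ha : a ≠ 0) (hD : IsDownClosed o a D)
    (hQ : Q ∈ tiles o a D (k + 1)) (hl : Q l ∉ lattice o a (k + 1)) :
    ∃ y ∈ level D k, dist y (Q l) = sideLen a (k + 1) := by
  rcases hQ with ⟨x, hx, j, rfl⟩ | ⟨Q, hQ, -, rfl⟩
  · exact ⟨x, hx, (isTile_diamond (hD.mem k hx) j).dist_eq ha (i := 0)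
      (lattice_subset_succ (hD.mem k hx)) hl⟩
  · have hT := isTile_of_mem_tiles ha hD hQ
    have hm : Q l ∈ level D k := by
      rwa [hT.cutCorners_mem_lattice_succ_iff ha (hD.mem k), not_not] at hl
    exact ⟨Q l, hm, by rw [cutCorners_of_mem hm, hT.dist_cornerCentroid ha (hD.mem k hm)]⟩

lemma exists_mem_level_dist_le_of_mem_lattice (ha : a ≠ 0) (hD : IsDownClosed o a D)
    (hQ : Q ∈ tiles o a D (k + 1)) (hl : Q l ∈ lattice o a (k + 1)) :
    ∃ y ∈ level D k, dist y (Q l) ≤ sideLen a k := by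
  rcases hQ with ⟨x, hx, j, rfl⟩ | ⟨Q, hQ, hcut, rfl⟩
  · refine ⟨x, hx, ?_⟩
    rcases (isAcuteCorner_diamond a x k j).eq_or_eq_add_two ha
      (lattice_subset_succ (hD.mem k hx)) hl with rfl | rfl
    · exact (dist_self x).trans_le (sideLen_nonneg a k)
    · exact (dist_add_edgeVec_mul_zeta_pow a x k j).le
  · have hT := isTile_of_mem_tiles ha hD hQ
    rw [hT.cutCorners_mem_lattice_succ_iff ha (hD.mem k)] at hl
    have ⟨i, hi, _⟩ := hT
    rw [cutCorners_of_notMem hl]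
    exact ⟨Q i, hcut i hi, (hT.dist_eq ha hi fun h => hl (hcut l h)).le⟩

lemma levelEdge_of_notMem_level (ha : a ≠ 0) (hD : IsDownClosed o a D) (hQ : Q ∈ tiles o a D k)
    (hi : Q i ∈ lattice o a k) (hn : Q i ∉ level D k) (hl : Q l ∉ lattice o a k) :
    LevelEdge o a D k (Q i) (Q l) := by
  refine ⟨hi, hn, (isTile_of_mem_tiles ha hD hQ).exists_eq_add ha hi hl, ?_⟩
  rintro m rfl
  exact exists_mem_level_dist_eq_of_notMem_lattice ha hD hQ hl

lemma levelEdge_cornerCentroid (ha : a ≠ 0) (hD : IsDownClosed o a D) (hQ : Q ∈ tiles o a D k)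
    (hU : ¬ IsFullyCut o a D k Q) (hm : Q i ∈ level D k) (hl : Q l ∉ lattice o a k) :
    LevelEdge o a D (k + 1) (Q l) (cornerCentroid Q i) := by
  have hT := isTile_of_mem_tiles ha hD hQ
  have hi := hD.mem k hm
  refine ⟨hT.mem_lattice_succ l, fun hlm => ?_, hT.cornerCentroid_eq_add ha hi hl, ?_⟩
  · obtain ⟨m, hmk, hmn⟩ := not_isFullyCut_iff.1 hU
    exact hmn (hD.down k _ hlm _ hmk (by rw [dist_comm, hT.dist_eq ha hmk hl]))
  · intro m hm'
    obtain rfl : k = m := Nat.succ_injective hm'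
    exact ⟨Q i, hm, hT.dist_cornerCentroid ha hi⟩

lemma exists_levelEdge_of_mem_lattice (ha : a ≠ 0) (hD : IsDownClosed o a D)
    (hQ : Q ∈ tiles o a D k) (hU : ¬ IsFullyCut o a D k Q) (hi : Q i ∈ lattice o a k)
    (hl : Q l ∉ lattice o a k) :
    ∃ m, LevelEdge o a D m (cutCorners (level D k) Q i) (cutCorners (level D k) Q l) ∨
      LevelEdge o a D m (cutCorners (level D k) Q l) (cutCorners (level D k) Q i) := by
  rw [cutCorners_of_notMem fun h => hl (hD.mem k h)]
  by_cases hm : Q i ∈ level D k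
  · rw [cutCorners_of_mem hm]
    exact ⟨k + 1, Or.inr (levelEdge_cornerCentroid ha hD hQ hU hm hl)⟩
  · rw [cutCorners_of_notMem hm]
    exact ⟨k, Or.inl (levelEdge_of_notMem_level ha hD hQ hi hm hl)⟩

lemma IsTile.notMem_lattice_add_one_iff (ha : a ≠ 0) (h : IsTile o a k Q) (i : Fin 4) :
    Q (i + 1) ∉ lattice o a k ↔ Q i ∈ lattice o a k := by
  refine ⟨(h.mem_lattice_or_mem_lattice_add_one i).resolve_right, fun hi hi' => ?_⟩
  obtain ⟨j, hj⟩ := h.isAcuteCorner ha hi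
  rw [hj.one] at hi'
  exact add_edgeVec_mul_zeta_pow_notMem_lattice ha hi j hi'

lemma exists_levelEdge_of_mem_meshOf (ha : a ≠ 0) (hD : IsDownClosed o a D)
    (hQ : Q ∈ meshOf o a D) (i : Fin 4) :
    ∃ k, LevelEdge o a D k (Q i) (Q (i + 1)) ∨ LevelEdge o a D k (Q (i + 1)) (Q i) := by
  obtain ⟨k, Q, hQ, hU, rfl⟩ := hQ
  have hiff := (isTile_of_mem_tiles ha hD hQ).notMem_lattice_add_one_iff ha i
  by_cases hi : Q i ∈ lattice o a k
  · exact exists_levelEdge_of_mem_lattice ha hD hQ hU hi (hiff.2 hi)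
  · obtain ⟨m, h⟩ := exists_levelEdge_of_mem_lattice ha hD hQ hU (not_not.1 (mt hiff.1 hi)) hi
    exact ⟨m, h.symm⟩

lemma exists_levelEdge_of_isEdge (ha : a ≠ 0) (hD : IsDownClosed o a D)
    (h : IsEdge (meshOf o a D) x c) :
    ∃ k, LevelEdge o a D k x c ∨ LevelEdge o a D k c x := by
  obtain ⟨Q, hQ, i, ⟨rfl, rfl⟩ | ⟨rfl, rfl⟩⟩ := h
  · exact exists_levelEdge_of_mem_meshOf ha hD hQ i
  · obtain ⟨k, h⟩ := exists_levelEdge_of_mem_meshOf ha hD hQ i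
    exact ⟨k, h.symm⟩

end Edges

section Ready

variable {o a : ℂ} {k : ℕ} {D : Finset (ℕ × ℂ)} {p : ℂ}

/-- The six points joined to `p` by edges of the tiling of level `k`, for `p` in the lattice of
level `k`. -/
def hexagon (a : ℂ) (k : ℕ) (p : ℂ) : Set ℂ := Set.range fun j : ℕ => p + edgeVec a k * zeta ^ j

lemma add_edgeVec_mul_zeta_pow_inj (ha : a ≠ 0) {i j : ℕ} (hi : i < 6) (hj : j < 6)
    (h : p + edgeVec a k * zeta ^ i = p + edgeVec a k * zeta ^ j) : i = j :=
  isPrimitiveRoot_zeta.pow_inj hi hj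
    (mul_left_cancel₀ (edgeVec_ne_zero ha k) (add_left_cancel h))

lemma hexagon_eq_image (a : ℂ) (k : ℕ) (p : ℂ) :
    hexagon a k p = (fun j : ℕ => p + edgeVec a k * zeta ^ j) '' Finset.range 6 := by
  refine Set.Subset.antisymm ?_ (Set.image_subset_range _ _)
  rintro _ ⟨j, rfl⟩
  refine ⟨j % 6, Finset.mem_coe.2 (Finset.mem_range.2 (Nat.mod_lt _ (by norm_num))), ?_⟩
  simp only
  rw [← zeta_pow_add_six_mul (j % 6) (j / 6), Nat.mod_add_div]

lemma finite_hexagon (a : ℂ) (k : ℕ) (p : ℂ) : (hexagon a k p).Finite := by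
  rw [hexagon_eq_image]
  exact (Finset.finite_toSet _).image _

lemma ncard_hexagon (ha : a ≠ 0) (k : ℕ) (p : ℂ) : (hexagon a k p).ncard = 6 := by
  rw [hexagon_eq_image, Set.InjOn.ncard_image, Set.ncard_coe_finset, Finset.card_range]
  intro i hi j hj
  exact add_edgeVec_mul_zeta_pow_inj ha (Finset.mem_range.1 hi) (Finset.mem_range.1 hj)

/-- The replacement step of level `k` with center `p` is not in `D`, but its prerequisites are. -/
structure IsAddable (o a : ℂ) (D : Finset (ℕ × ℂ)) (k : ℕ) (p : ℂ) : Prop where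
  mem : p ∈ lattice o a k
  notMem : p ∉ level D k
  pred : ∀ l, k = l + 1 → ∀ q ∈ lattice o a l, dist p q ≤ sideLen a l → q ∈ level D l

lemma exists_forall_levelEdge_of_ready (ha : a ≠ 0) (hD : IsDownClosed o a D) {s : ℝ}
    (h : Ready (meshOf o a D) p s) :
    ∃ k, s = sideLen a k ∧ ∀ u ∈ hexagon a k p, LevelEdge o a D k p u ∨ LevelEdge o a D k u p := by
  set U := {u | IsEdge (meshOf o a D) p u ∧ dist p u = s} with hU
  have hcard : U.ncard = 6 := h
  have hlevel : ∀ u ∈ U, ∃ k, s = sideLen a k ∧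
      (LevelEdge o a D k p u ∨ LevelEdge o a D k u p) := by
    rintro u ⟨hu, rfl⟩
    obtain ⟨k, hk⟩ := exists_levelEdge_of_isEdge ha hD hu
    exact ⟨k, hk.elim (·.dist_eq) fun h => (dist_comm p u).trans h.dist_eq, hk⟩
  obtain ⟨u₀, hu₀⟩ := Set.nonempty_of_ncard_ne_zero (by rw [hcard]; norm_num)
  obtain ⟨k, hsk, -⟩ := hlevel u₀ hu₀
  have hall : ∀ u ∈ U, LevelEdge o a D k p u ∨ LevelEdge o a D k u p := by
    intro u hu
    obtain ⟨m, hsm, hm⟩ := hlevel u hu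
    rwa [(sideLen_strictAnti ha).injective (hsk.symm.trans hsm)]
  have hsub : U ⊆ hexagon a k p := by
    intro u hu
    rcases hall u hu with h' | h' <;> obtain ⟨j, rfl⟩ := h'.eq
    · exact ⟨j, rfl⟩
    · exact ⟨j + 3, by simp only [zeta_pow_add_three]; ring⟩
  have heq : U = hexagon a k p :=
    Set.eq_of_subset_of_ncard_le hsub (by rw [hcard, ncard_hexagon ha]) (finite_hexagon a k p)
  exact ⟨k, hsk, heq ▸ hall⟩

-- Adjacent vertices of the hexagon around `p` are too close to each other to be in the lattice.
lemma levelEdge_of_forall_hexagon (ha : a ≠ 0)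
    (h : ∀ u ∈ hexagon a k p, LevelEdge o a D k p u ∨ LevelEdge o a D k u p) (j : ℕ) :
    LevelEdge o a D k p (p + edgeVec a k * zeta ^ j) := by
  have hp : p ∈ lattice o a k := by
    by_contra hp
    have hmem : ∀ i : ℕ, p + edgeVec a k * zeta ^ i ∈ lattice o a k := fun i =>
      (h _ ⟨i, rfl⟩).elim (fun h' => absurd h'.mem hp) (·.mem)
    have hturn : p + edgeVec a k * zeta ^ 0 =
        p + edgeVec a k * zeta ^ 1 + edgeVec a k * zeta ^ 5 := by
      rw [show 5 = 2 + 3 from rfl, zeta_pow_add_three, zeta_sq]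
      ring
    have heq := eq_of_dist_le_sideLen ha (hmem 1) (hmem 0)
      (by rw [hturn, dist_add_edgeVec_mul_zeta_pow])
    exact absurd (add_edgeVec_mul_zeta_pow_inj ha (by norm_num) (by norm_num) heq) one_ne_zero
  exact (h _ ⟨j, rfl⟩).resolve_right fun h' =>
    add_edgeVec_mul_zeta_pow_notMem_lattice ha hp j h'.mem

lemma isAddable_of_forall_levelEdge (ha : a ≠ 0) (hD : IsDownClosed o a D)
    (h : ∀ j : ℕ, LevelEdge o a D k p (p + edgeVec a k * zeta ^ j)) : IsAddable o a D k p := by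
  refine ⟨(h 0).mem, (h 0).notMem, ?_⟩
  rintro l rfl q hq hd
  have hnear : ∀ j : ℕ, dist q (p + edgeVec a (l + 1) * zeta ^ j) = sideLen a (l + 1) →
      q ∈ level D l := by
    intro j hj
    obtain ⟨y, hy, hyd⟩ := (h j).pred l rfl
    have htri := dist_triangle_right q y (p + edgeVec a (l + 1) * zeta ^ j)
    rw [hj, hyd] at htri
    rwa [eq_of_dist_lt_sqrt_three_mul_sideLen hq (hD.mem l hy)]
    rw [sideLen_eq_sqrt_three_mul a l, ← mul_assoc, ← pow_two, sqrt_three_sq]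
    linarith [sideLen_pos ha (l + 1)]
  rcases eq_or_exists_eq_add_edgeVec_mul_zeta_pow ha (h 0).mem (lattice_subset_succ hq) hd
    with rfl | ⟨j, rfl⟩
  · exact hnear 0 (dist_add_edgeVec_mul_zeta_pow a q (l + 1) 0)
  · refine hnear j ?_
    rw [← edgeVec_succ_mul_theta a l, dist_comm,
      show p + edgeVec a (l + 1) * theta * zeta ^ j =
        p + edgeVec a (l + 1) * zeta ^ j + edgeVec a (l + 1) * zeta ^ (j + 1) by
          unfold theta; ring,
      dist_add_edgeVec_mul_zeta_pow]

lemma exists_isAddable_of_ready (ha : a ≠ 0) (hD : IsDownClosed o a D) {s : ℝ}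
    (h : Ready (meshOf o a D) p s) : ∃ k, s = sideLen a k ∧ IsAddable o a D k p := by
  obtain ⟨k, hs, hk⟩ := exists_forall_levelEdge_of_ready ha hD h
  exact ⟨k, hs, isAddable_of_forall_levelEdge ha hD (levelEdge_of_forall_hexagon ha hk)⟩

end Ready

section Insertion

variable {o a : ℂ} {k l : ℕ} {D D' : Finset (ℕ × ℂ)} {Q : Fin 4 → ℂ} {i : Fin 4} {p c : ℂ}

lemma mem_level_insert {x : ℂ} :
    x ∈ level (insert (k, p) D) l ↔ x ∈ level D l ∨ (l = k ∧ x = p) := by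
  simp only [level, Set.mem_ofPred_eq, Finset.mem_insert, Prod.mk.injEq, or_comm]

lemma level_subset_insert : level D l ⊆ level (insert (k, p) D) l :=
  fun _ hx => mem_level_insert.2 (Or.inl hx)

lemma mem_level_insert_self : p ∈ level (insert (k, p) D) k :=
  mem_level_insert.2 (Or.inr ⟨rfl, rfl⟩)

lemma level_insert_of_ne (h : l ≠ k) : level (insert (k, p) D) l = level D l := by
  ext x
  simp only [mem_level_insert, h, false_and, or_false]

lemma mem_level_insert_iff_of_notMem_range (h : ¬ (l = k ∧ p ∈ Set.range Q)) (i : Fin 4) :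
    Q i ∈ level (insert (k, p) D) l ↔ Q i ∈ level D l := by
  rw [mem_level_insert, or_iff_left]
  rintro ⟨hl, hi⟩
  exact h ⟨hl, i, hi⟩

lemma cutCorners_level_insert (h : ¬ (l = k ∧ p ∈ Set.range Q)) :
    cutCorners (level (insert (k, p) D) l) Q = cutCorners (level D l) Q :=
  cutCorners_congr (mem_level_insert_iff_of_notMem_range h)

lemma isFullyCut_insert_iff (h : ¬ (l = k ∧ p ∈ Set.range Q)) :
    IsFullyCut o a (insert (k, p) D) l Q ↔ IsFullyCut o a D l Q := by
  simp only [IsFullyCut, mem_level_insert_iff_of_notMem_range h]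

lemma tiles_mono (hD' : IsDownClosed o a D') (hsub : D ⊆ D') :
    tiles o a D k ⊆ tiles o a D' k := by
  induction k with
  | zero => exact subset_rfl
  | succ k ih =>
    rintro Q (⟨x, hx, j, rfl⟩ | ⟨Q, hQ, hcut, rfl⟩)
    · exact Or.inl ⟨x, hsub hx, j, rfl⟩
    · refine Or.inr ⟨Q, ih hQ, fun i hi => hsub (hcut i hi), cutCorners_congr fun i => ?_⟩
      exact ⟨fun h => hsub h, fun h => hcut i (hD'.mem k h)⟩

lemma isFullyCut_of_cutCorners_mem_level (ha : a ≠ 0) (hD : IsDownClosed o a D)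
    (hT : IsTile o a l Q) (hlk : l < k) (h : cutCorners (level D l) Q i ∈ level D k) :
    IsFullyCut o a D l Q := by
  have of_obtuse : ∀ m, Q m ∉ lattice o a l → Q m ∈ level D (l + 1) → IsFullyCut o a D l Q :=
    fun m hm hmem n hn => hD.down l _ hmem _ hn (by rw [dist_comm, hT.dist_eq ha hn hm])
  by_cases hm : Q i ∈ level D l
  · have hi := hD.mem l hm
    rw [cutCorners_of_mem hm] at h
    have hlk' : l + 2 ≤ k := by
      by_contra! hk
      exact hT.cornerCentroid_notMem_lattice ha hi (lattice_mono (by omega) (hD.mem k h))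
    have hobt := (hT.notMem_lattice_add_one_iff ha i).2 hi
    refine of_obtuse (i + 1) hobt (hD.down (l + 1) _
      (hD.mem_level_of_le hlk' h (hT.cornerCentroid_mem_lattice ha hi)) _
      (hT.mem_lattice_succ _) ?_)
    rw [dist_comm, hT.dist_obtuse_cornerCentroid ha hi hobt]
  · rw [cutCorners_of_notMem hm] at h
    exact of_obtuse i (fun hi => hm (hD.mem_level_of_le hlk.le h hi))
      (hD.mem_level_of_le hlk h (hT.mem_lattice_succ i))

lemma mem_level_of_mem_tiles_succ (ha : a ≠ 0) (hD : IsDownClosed o a D)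
    (hQ : Q ∈ tiles o a D (l + 1)) (hkl : k ≤ l) (h : Q i ∈ lattice o a k) :
    Q i ∈ level D k := by
  have hl := lattice_mono hkl h
  rcases hQ with ⟨x, hx, j, rfl⟩ | ⟨Q, hQ, hcut, rfl⟩
  · rcases (isAcuteCorner_diamond a x l j).eq_or_eq_add_two ha
      (lattice_subset_succ (hD.mem l hx)) (lattice_subset_succ hl) with rfl | rfl
    · exact hD.mem_level_of_le hkl hx h
    · exact absurd hl (add_edgeVec_mul_zeta_pow_notMem_lattice ha (hD.mem l hx) j)
  · have hn := ((isTile_of_mem_tiles ha hD hQ).cutCorners_mem_lattice_succ_iff ha (hD.mem l)).1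
      (lattice_subset_succ hl)
    rw [cutCorners_of_notMem hn] at hl
    exact absurd (hcut i hl) hn

lemma exists_mem_rhombille {j : ℕ} (hp : p ∈ lattice o a 0) (hj : j < 3) :
    ∃ Q ∈ rhombille o a, Q 0 = p ∧ IsAcuteCorner a 0 Q 0 j := by
  obtain ⟨z, ⟨m, n, rfl⟩, hz⟩ := hp
  rw [edgeVec_zero] at hz
  refine ⟨_, ⟨m, n, ⟨j, hj⟩, p, hz, rfl⟩, rfl, ⟨?_, ?_, ?_⟩⟩ <;>
    simp only [edgeVec_zero, theta, zero_add, Matrix.cons_val]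
  ring

lemma exists_mem_rhombille_isSide (hp : p ∈ lattice o a 0) (j : ℕ) :
    ∃ Q ∈ rhombille o a, (Element.quad Q).IsSide p (p + edgeVec a 0 * zeta ^ j) := by
  rw [← Nat.mod_add_div j 6, zeta_pow_add_six_mul]
  rcases lt_or_ge (j % 6) 3 with hj | hj
  · obtain ⟨Q, hQ, rfl, hc⟩ := exists_mem_rhombille hp hj
    exact ⟨Q, hQ, hc.isSide_one⟩
  · obtain ⟨i, hi⟩ := Nat.exists_eq_add_of_le' hj
    rw [hi]
    obtain ⟨Q, hQ, h0, hc⟩ := exists_mem_rhombille (j := i)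
      (add_edgeVec_mul_theta_mul_mem_lattice hp (pow_mem zeta_mem_eisenstein (i + 3))) (by omega)
    have h2 : Q (0 + 2) = p := by
      rw [hc.two, h0, zeta_pow_add_three]
      ring
    exact ⟨Q, hQ, h2 ▸ hc.opposite.isSide_one⟩

namespace IsAddable

lemma isDownClosed_insert (h : IsAddable o a D k p) (hD : IsDownClosed o a D) :
    IsDownClosed o a (insert (k, p) D) := by
  refine ⟨fun l x hx => ?_, fun l x hx q hq hd => level_subset_insert ?_⟩
  · rcases mem_level_insert.1 hx with hx | ⟨rfl, rfl⟩
    exacts [hD.mem l hx, h.mem]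
  · rcases mem_level_insert.1 hx with hx | ⟨hl, rfl⟩
    exacts [hD.down l x hx q hq hd, h.pred l hl.symm q hq hd]

lemma notMem_level_succ (h : IsAddable o a D k p) (hD : IsDownClosed o a D)
    (hd : dist c p ≤ sideLen a k) : c ∉ level (insert (k, p) D) (k + 1) := by
  rw [level_insert_of_ne (by omega)]
  exact fun hc => h.notMem (hD.down k c hc p h.mem hd)

lemma exists_mem_tiles_isSide (h : IsAddable o a D k p) (j : ℕ) :
    ∃ Q ∈ tiles o a D k, (Element.quad Q).IsSide p (p + edgeVec a k * zeta ^ j) := by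
  rcases k with _ | k
  · exact exists_mem_rhombille_isSide h.mem j
  rcases mem_lattice_or_exists_neighbors h.mem with hk | ⟨i, hi⟩
  · have hpk := h.pred k rfl p hk (by rw [dist_self]; exact sideLen_nonneg a k)
    exact ⟨_, Or.inl ⟨p, hpk, j, rfl⟩, (isAcuteCorner_diamond a p k j).isSide_one⟩
  · obtain ⟨m, hm⟩ : ∃ m, i + 2 * m = j + 6 * i ∨ i + 2 * m + 1 = j + 6 * i :=
      ⟨(j + 5 * i) / 2, by omega⟩
    set t := i + 2 * m
    have hx := h.pred k rfl _ (hi m) (dist_add_edgeVec_mul_zeta_pow a p k t).le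
    set x := p + edgeVec a k * zeta ^ t
    have hc := (isAcuteCorner_diamond a x k (t + 3)).opposite
    have h2 : diamond x (x + edgeVec a k * zeta ^ (t + 3)) (0 + 2) = p := by
      change x + edgeVec a k * zeta ^ (t + 3) = p
      rw [zeta_pow_add_three]
      ring
    refine ⟨_, Or.inl ⟨x, hx, t + 3, rfl⟩, ?_⟩
    rcases hm with hm | hm
    · have hside := hc.isSide_one
      rwa [h2, show t + 3 + 3 = j + 6 * (i + 1) by omega, zeta_pow_add_six_mul] at hside
    · have hside := hc.isSide_three
      rwa [h2, show t + 3 + 3 + 1 = j + 6 * (i + 1) by omega, zeta_pow_add_six_mul] at hside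

lemma not_isFullyCut (h : IsAddable o a D k p) (hp : p ∈ Set.range Q) :
    ¬ IsFullyCut o a D k Q := by
  obtain ⟨i, rfl⟩ := hp
  exact fun hcut => h.notMem (hcut i h.mem)

lemma isEdge (h : IsAddable o a D k p) (ha : a ≠ 0) (hD : IsDownClosed o a D) (j : ℕ) :
    IsEdge (meshOf o a D) p (p + edgeVec a k * zeta ^ j) := by
  obtain ⟨Q, hQ, i, hi⟩ := h.exists_mem_tiles_isSide j
  have hy : p + edgeVec a k * zeta ^ j ∉ level D k := fun hy =>
    add_edgeVec_mul_zeta_pow_notMem_lattice ha h.mem j (hD.mem k hy)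
  rcases hi with ⟨h0, h1⟩ | ⟨h0, h1⟩
  · refine ⟨_, ⟨k, Q, hQ, h.not_isFullyCut ⟨i, h0⟩, rfl⟩, i, Or.inl ⟨?_, ?_⟩⟩
    · rw [cutCorners_of_notMem (h0 ▸ h.notMem), h0]
    · rw [cutCorners_of_notMem (h1 ▸ hy), h1]
  · refine ⟨_, ⟨k, Q, hQ, h.not_isFullyCut ⟨i + 1, h1⟩, rfl⟩, i, Or.inr ⟨?_, ?_⟩⟩
    · rw [cutCorners_of_notMem (h0 ▸ hy), h0]
    · rw [cutCorners_of_notMem (h1 ▸ h.notMem), h1]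

lemma setOf_isEdge_eq_hexagon (h : IsAddable o a D k p) (ha : a ≠ 0) (hD : IsDownClosed o a D) :
    {u | IsEdge (meshOf o a D) p u ∧ dist p u = sideLen a k} = hexagon a k p := by
  ext u
  constructor
  · rintro ⟨hu, hd⟩
    obtain ⟨m, hm⟩ := exists_levelEdge_of_isEdge ha hD hu
    have hkm : sideLen a k = sideLen a m :=
      hd ▸ hm.elim (·.dist_eq) fun h' => (dist_comm p u).trans h'.dist_eq
    obtain rfl := (sideLen_strictAnti ha).injective hkm
    rcases hm with hm | hm <;> obtain ⟨j, hj⟩ := hm.eq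
    · exact ⟨j, hj.symm⟩
    · exact absurd h.mem (hj ▸ add_edgeVec_mul_zeta_pow_notMem_lattice ha hm.mem j)
  · rintro ⟨j, rfl⟩
    exact ⟨h.isEdge ha hD j, dist_add_edgeVec_mul_zeta_pow a p k j⟩

lemma ready (h : IsAddable o a D k p) (ha : a ≠ 0) (hD : IsDownClosed o a D) :
    Ready (meshOf o a D) p (sideLen a k) := by
  rw [Ready, h.setOf_isEdge_eq_hexagon ha hD, ncard_hexagon ha]

lemma eq_of_cutCorners_eq (h : IsAddable o a D k p) (ha : a ≠ 0) (hD : IsDownClosed o a D)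
    (hQ : Q ∈ tiles o a D l) (hU : ¬ IsFullyCut o a D l Q)
    (hi : cutCorners (level D l) Q i = p) : l = k ∧ Q i = p := by
  have hT := isTile_of_mem_tiles ha hD hQ
  rcases lt_or_ge l k with hlk | hkl
  · have hfull := isFullyCut_of_cutCorners_mem_level (i := i) ha (h.isDownClosed_insert hD) hT hlk
      (by rw [level_insert_of_ne hlk.ne, hi]; exact mem_level_insert_self)
    exact absurd ((isFullyCut_insert_iff fun hk => hlk.ne hk.1).1 hfull) hU
  · have hn : Q i ∉ level D l := by
      rw [← hT.cutCorners_mem_lattice_succ_iff ha (hD.mem l), hi]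
      exact lattice_mono (by omega) h.mem
    rw [cutCorners_of_notMem hn] at hi
    refine ⟨hkl.antisymm' (not_lt.1 fun hlt => ?_), hi⟩
    obtain ⟨l, rfl⟩ := Nat.exists_eq_succ_of_ne_zero (Nat.ne_zero_of_lt hlt)
    exact h.notMem (hi ▸ mem_level_of_mem_tiles_succ ha hD hQ (Nat.le_of_lt_succ hlt) (hi ▸ h.mem))

lemma mem_range_cutCorners_iff (h : IsAddable o a D k p) (ha : a ≠ 0) (hD : IsDownClosed o a D)
    (hQ : Q ∈ tiles o a D l) (hU : ¬ IsFullyCut o a D l Q) :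
    p ∈ Set.range (cutCorners (level D l) Q) ↔ l = k ∧ p ∈ Set.range Q := by
  constructor
  · rintro ⟨i, hi⟩
    obtain ⟨hl, hi⟩ := h.eq_of_cutCorners_eq ha hD hQ hU hi
    exact ⟨hl, i, hi⟩
  · rintro ⟨rfl, i, hi⟩
    exact ⟨i, by rw [cutCorners_of_notMem (hi ▸ h.notMem), hi]⟩

lemma cutCorner_cutCorners (h : IsAddable o a D k p) (ha : a ≠ 0) (hD : IsDownClosed o a D)
    (hQ : Q ∈ tiles o a D k) (hp : p ∈ Set.range Q) :
    cutCorner p (cutCorners (level D k) Q) = cutCorners (level (insert (k, p) D) k) Q := by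
  have hT := isTile_of_mem_tiles ha hD hQ
  have hU := h.not_isFullyCut hp
  funext i
  unfold cutCorner
  by_cases hi : Q i = p
  · have hik : Q i ∈ lattice o a k := hi ▸ h.mem
    have hprev : Q (i - 1) ∉ lattice o a k := fun hm =>
      (hT.notMem_lattice_add_one_iff ha (i - 1)).2 hm (by rwa [sub_add_cancel])
    have hnext := (hT.notMem_lattice_add_one_iff ha i).2 hik
    have hold : Q i ∉ level D k := hi ▸ h.notMem
    have hnew : Q i ∈ level (insert (k, p) D) k := hi ▸ mem_level_insert_self
    rw [cutCorners_of_notMem hold, if_pos hi, cutCorners_of_mem hnew,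
      cutCorners_of_notMem (fun hm => hnext (hD.mem k hm)),
      cutCorners_of_notMem (fun hm => hprev (hD.mem k hm)), cornerCentroid]
  · rw [if_neg fun h' => hi (h.eq_of_cutCorners_eq ha hD hQ hU h').2]
    by_cases hm : Q i ∈ level D k
    · rw [cutCorners_of_mem hm, cutCorners_of_mem (level_subset_insert hm)]
    · rw [cutCorners_of_notMem hm, cutCorners_of_notMem]
      simpa only [mem_level_insert, hm, hi, and_false, or_false] using hm

end IsAddable

/-- `Q` is one of the tiles of level `k + 1` that the replacement step of level `k` with center `p`
adds to those of `D`: a diamond around `p`, or what remains of a tile of level `k` when `p` is the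
last of its acute corners to be cut. -/
def IsNewTile (o a : ℂ) (D : Finset (ℕ × ℂ)) (k : ℕ) (p : ℂ) (Q : Fin 4 → ℂ) : Prop :=
  (∃ j : ℕ, Q = diamond p (p + edgeVec a k * zeta ^ j)) ∨
    ∃ Q₀ ∈ tiles o a D k, p ∈ Set.range Q₀ ∧ IsFullyCut o a (insert (k, p) D) k Q₀ ∧
      Q = cutCorners (level (insert (k, p) D) k) Q₀

namespace IsNewTile

lemma mem_tiles (hQ : IsNewTile o a D k p Q) (h : IsAddable o a D k p)
    (hD : IsDownClosed o a D) : Q ∈ tiles o a (insert (k, p) D) (k + 1) := by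
  rcases hQ with ⟨j, rfl⟩ | ⟨Q₀, hQ₀, -, hcut, rfl⟩
  · exact Or.inl ⟨p, mem_level_insert_self, j, rfl⟩
  · exact Or.inr
      ⟨Q₀, tiles_mono (h.isDownClosed_insert hD) (Finset.subset_insert _ _) hQ₀, hcut, rfl⟩

lemma notMem_level (hQ : IsNewTile o a D k p Q) (h : IsAddable o a D k p) (ha : a ≠ 0)
    (hD : IsDownClosed o a D) (i : Fin 4) : Q i ∉ level (insert (k, p) D) (k + 1) := by
  intro hmem
  have hD' := h.isDownClosed_insert hD
  have hi : Q i ∈ lattice o a (k + 1) := hD'.mem _ hmem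
  refine h.notMem_level_succ hD ?_ hmem
  rcases hQ with ⟨j, rfl⟩ | ⟨Q₀, hQ₀, ⟨l, rfl⟩, hcut, rfl⟩
  · rcases (isAcuteCorner_diamond a p k j).eq_or_eq_add_two ha
      (lattice_subset_succ h.mem) hi with rfl | rfl
    · exact (dist_self p).trans_le (sideLen_nonneg a k)
    · exact ((dist_comm _ _).trans (dist_add_edgeVec_mul_zeta_pow a p k j)).le
  · have hT := isTile_of_mem_tiles ha hD hQ₀
    have hm := (hT.cutCorners_mem_lattice_succ_iff ha (hD'.mem k)).1 hi
    rw [cutCorners_of_notMem hm, dist_comm]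
    exact (hT.dist_eq ha h.mem fun hk => hm (hcut i hk)).le

lemma not_isFullyCut (hQ : IsNewTile o a D k p Q) (h : IsAddable o a D k p) (ha : a ≠ 0)
    (hD : IsDownClosed o a D) : ¬ IsFullyCut o a (insert (k, p) D) (k + 1) Q := by
  obtain ⟨i, hi, -⟩ := isTile_of_mem_tiles ha (h.isDownClosed_insert hD) (hQ.mem_tiles h hD)
  exact fun hcut => hQ.notMem_level h ha hD i (hcut i hi)

lemma mem_meshOf (hQ : IsNewTile o a D k p Q) (h : IsAddable o a D k p) (ha : a ≠ 0)
    (hD : IsDownClosed o a D) : Q ∈ meshOf o a (insert (k, p) D) :=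
  ⟨k + 1, Q, hQ.mem_tiles h hD, hQ.not_isFullyCut h ha hD,
    (cutCorners_eq_self (hQ.notMem_level h ha hD)).symm⟩

end IsNewTile

namespace IsAddable

lemma mem_tiles_or_isNewTile (h : IsAddable o a D k p) (ha : a ≠ 0) (hD : IsDownClosed o a D)
    (hQ : Q ∈ tiles o a (insert (k, p) D) l) :
    Q ∈ tiles o a D l ∨ (l = k + 1 ∧ IsNewTile o a D k p Q) := by
  induction l generalizing Q with
  | zero => exact Or.inl hQ
  | succ l ih =>
    rcases hQ with ⟨x, hx, j, rfl⟩ | ⟨Q, hQ, hcut, rfl⟩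
    · rcases mem_level_insert.1 hx with hx | ⟨rfl, rfl⟩
      exacts [Or.inl (Or.inl ⟨x, hx, j, rfl⟩), Or.inr ⟨rfl, Or.inl ⟨j, rfl⟩⟩]
    · rcases ih hQ with hQ' | ⟨rfl, hnew⟩
      · by_cases hp : l = k ∧ p ∈ Set.range Q
        · obtain ⟨rfl, hp⟩ := hp
          exact Or.inr ⟨rfl, Or.inr ⟨Q, hQ', hp, hcut, rfl⟩⟩
        · exact Or.inl
            (Or.inr ⟨Q, hQ', (isFullyCut_insert_iff hp).1 hcut, cutCorners_level_insert hp⟩)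
      · exact absurd hcut (hnew.not_isFullyCut h ha hD)

lemma cutCorners_mem_replaceAt (h : IsAddable o a D k p) (ha : a ≠ 0) (hD : IsDownClosed o a D)
    (hQ : Q ∈ tiles o a D k) (hp : p ∈ Set.range Q) (s : ℝ) :
    cutCorners (level (insert (k, p) D) k) Q ∈ replaceAt (meshOf o a D) p s :=
  have hU := h.not_isFullyCut hp
  Or.inl (Or.inr ⟨_, ⟨k, Q, hQ, hU, rfl⟩, (h.mem_range_cutCorners_iff ha hD hQ hU).2 ⟨rfl, hp⟩,
    (h.cutCorner_cutCorners ha hD hQ hp).symm⟩)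

lemma replaceAt_subset_meshOf_insert (h : IsAddable o a D k p) (ha : a ≠ 0)
    (hD : IsDownClosed o a D) :
    replaceAt (meshOf o a D) p (sideLen a k) ⊆ meshOf o a (insert (k, p) D) := by
  have hmono : ∀ l, tiles o a D l ⊆ tiles o a (insert (k, p) D) l := fun _ =>
    tiles_mono (h.isDownClosed_insert hD) (Finset.subset_insert _ _)
  rintro Q' ((⟨⟨l, Q, hQ, hU, rfl⟩, hp⟩ | ⟨_, ⟨l, Q, hQ, hU, rfl⟩, hp, rfl⟩) | ⟨u, hu, hd, rfl⟩)
  · rw [h.mem_range_cutCorners_iff ha hD hQ hU] at hp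
    exact ⟨l, Q, hmono l hQ, mt (isFullyCut_insert_iff hp).1 hU, (cutCorners_level_insert hp).symm⟩
  · obtain ⟨rfl, hp⟩ := (h.mem_range_cutCorners_iff ha hD hQ hU).1 hp
    rw [h.cutCorner_cutCorners ha hD hQ hp]
    by_cases hcut : IsFullyCut o a (insert (l, p) D) l Q
    · exact IsNewTile.mem_meshOf (Or.inr ⟨Q, hQ, hp, hcut, rfl⟩) h ha hD
    · exact ⟨l, Q, hmono l hQ, hcut, rfl⟩
  · have hu' : u ∈ hexagon a k p := h.setOf_isEdge_eq_hexagon ha hD ▸ ⟨hu, hd⟩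
    obtain ⟨j, rfl⟩ := hu'
    exact IsNewTile.mem_meshOf (Or.inl ⟨j, rfl⟩) h ha hD

lemma meshOf_insert_subset_replaceAt (h : IsAddable o a D k p) (ha : a ≠ 0)
    (hD : IsDownClosed o a D) :
    meshOf o a (insert (k, p) D) ⊆ replaceAt (meshOf o a D) p (sideLen a k) := by
  rintro _ ⟨l, Q, hQ, hU, rfl⟩
  rcases h.mem_tiles_or_isNewTile ha hD hQ with hQ' | ⟨rfl, hnew⟩
  · by_cases hp : l = k ∧ p ∈ Set.range Q
    · obtain ⟨rfl, hp⟩ := hp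
      exact h.cutCorners_mem_replaceAt ha hD hQ' hp _
    · rw [isFullyCut_insert_iff hp] at hU
      rw [cutCorners_level_insert hp]
      exact Or.inl (Or.inl
        ⟨⟨l, Q, hQ', hU, rfl⟩, mt (h.mem_range_cutCorners_iff ha hD hQ' hU).1 hp⟩)
  · rw [cutCorners_eq_self (hnew.notMem_level h ha hD)]
    rcases hnew with ⟨j, rfl⟩ | ⟨Q₀, hQ₀, hp, -, rfl⟩
    · exact Or.inr ⟨_, h.isEdge ha hD j, dist_add_edgeVec_mul_zeta_pow a p k j, rfl⟩
    · exact h.cutCorners_mem_replaceAt ha hD hQ₀ hp _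

lemma replaceAt_meshOf (h : IsAddable o a D k p) (ha : a ≠ 0) (hD : IsDownClosed o a D) :
    replaceAt (meshOf o a D) p (sideLen a k) = meshOf o a (insert (k, p) D) :=
  (h.replaceAt_subset_meshOf_insert ha hD).antisymm (h.meshOf_insert_subset_replaceAt ha hD)

end IsAddable

end Insertion

section Refinement

variable {o a : ℂ} {k : ℕ} {D D' : Finset (ℕ × ℂ)} {M : QuadMesh}

lemma exists_eq_meshOf_of_refines (ha : a ≠ 0) (hD : IsDownClosed o a D)
    (h : Refines (meshOf o a D) M) : ∃ D', IsDownClosed o a D' ∧ D ⊆ D' ∧ M = meshOf o a D' := by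
  induction h with
  | refl => exact ⟨D, hD, subset_rfl, rfl⟩
  | tail _ hstep ih =>
    obtain ⟨D', hD', hsub, rfl⟩ := ih
    obtain ⟨p, s, hr, rfl⟩ := hstep
    obtain ⟨k, rfl, hadd⟩ := exists_isAddable_of_ready ha hD' hr
    exact ⟨_, hadd.isDownClosed_insert hD', hsub.trans (Finset.subset_insert _ _),
      hadd.replaceAt_meshOf ha hD'⟩

lemma exists_isAddable_of_ssubset (hD' : IsDownClosed o a D') (h : D ⊂ D') :
    ∃ k p, (k, p) ∈ D' \ D ∧ IsAddable o a D k p := by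
  obtain ⟨⟨k, p⟩, hkp, hmin⟩ :=
    Finset.exists_min_image (D' \ D) Prod.fst (Finset.sdiff_nonempty.2 h.2)
  have ⟨hp, hn⟩ := Finset.mem_sdiff.1 hkp
  refine ⟨k, p, hkp, hD'.mem k hp, hn, ?_⟩
  rintro l rfl q hq hd
  by_contra hql
  exact (hmin (l, q) (Finset.mem_sdiff.2 ⟨hD'.down l p hp q hq hd, hql⟩)).not_gt l.lt_succ_self

lemma refines_of_subset (ha : a ≠ 0) (hD : IsDownClosed o a D) (hD' : IsDownClosed o a D')
    (hsub : D ⊆ D') : Refines (meshOf o a D) (meshOf o a D') := by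
  induction hn : (D' \ D).card generalizing D with
  | zero =>
    rw [Finset.card_eq_zero, Finset.sdiff_eq_empty_iff_subset] at hn
    rw [hsub.antisymm hn]
    exact Relation.ReflTransGen.refl
  | succ n ih =>
    have hne : ¬ D' ⊆ D := fun hle => by
      rw [Finset.sdiff_eq_empty_iff_subset.2 hle, Finset.card_empty] at hn
      omega
    obtain ⟨k, p, hkp, hadd⟩ := exists_isAddable_of_ssubset hD' ⟨hsub, hne⟩
    refine Relation.ReflTransGen.head ⟨p, sideLen a k, hadd.ready ha hD, rfl⟩ ?_
    rw [hadd.replaceAt_meshOf ha hD]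
    refine ih (hadd.isDownClosed_insert hD)
      (Finset.insert_subset (Finset.mem_sdiff.1 hkp).1 hsub) ?_
    rw [Finset.sdiff_insert, Finset.card_erase_of_mem hkp, hn, Nat.add_sub_cancel]

lemma level_subset_of_meshOf_eq (ha : a ≠ 0) (hD : IsDownClosed o a D)
    (hD' : IsDownClosed o a D') (h : meshOf o a D = meshOf o a D')
    (hlevel : ∀ l < k, level D l = level D' l) : level D' k ⊆ level D k := by
  intro p hp
  by_contra hn
  have hadd : IsAddable o a D k p := by
    refine ⟨hD'.mem k hp, hn, ?_⟩
    rintro l rfl q hq hd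
    rw [hlevel l l.lt_succ_self]
    exact hD'.down l p hp q hq hd
  obtain ⟨k', hk', hadd'⟩ := exists_isAddable_of_ready ha hD' (h ▸ hadd.ready ha hD)
  rw [← (sideLen_strictAnti ha).injective hk'] at hadd'
  exact hadd'.notMem hp

lemma meshOf_injOn (ha : a ≠ 0) : Set.InjOn (meshOf o a) {D | IsDownClosed o a D} := by
  intro D hD D' hD' h
  have hlevel : ∀ k, level D k = level D' k := by
    intro k
    induction k using Nat.strong_induction_on with
    | _ k ih =>
      exact (level_subset_of_meshOf_eq ha hD' hD h.symm fun l hl => (ih l hl).symm).antisymm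
        (level_subset_of_meshOf_eq ha hD hD' h ih)
  ext ⟨k, x⟩
  exact Set.ext_iff.1 (hlevel k) x

lemma exists_eq_meshOf_of_refines_rhombille (ha : a ≠ 0) (h : Refines (rhombille o a) M) :
    ∃ D, IsDownClosed o a D ∧ M = meshOf o a D := by
  rw [← meshOf_empty ha] at h
  obtain ⟨D, hD, -, rfl⟩ := exists_eq_meshOf_of_refines ha isDownClosed_empty h
  exact ⟨D, hD, rfl⟩

lemma refines_rhombille_meshOf (ha : a ≠ 0) (hD : IsDownClosed o a D) :
    Refines (rhombille o a) (meshOf o a D) := by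
  rw [← meshOf_empty ha]
  exact refines_of_subset ha isDownClosed_empty hD (Finset.empty_subset _)

lemma subset_of_refines (ha : a ≠ 0) (hD : IsDownClosed o a D) (hD' : IsDownClosed o a D')
    (h : Refines (meshOf o a D) (meshOf o a D')) : D ⊆ D' := by
  obtain ⟨D'', hD'', hsub, he⟩ := exists_eq_meshOf_of_refines ha hD h
  rwa [meshOf_injOn ha hD' hD'' he]

end Refinement

/-! ### The coarsest mesh -/

section Regions

lemma region_quad_subset {v : Fin 4 → ℂ} {K : Set ℂ} (hK : Convex ℝ K) (hv : ∀ i, v i ∈ K) :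
    (Element.quad v).region ⊆ K := by
  apply Set.union_subset <;> refine convexHull_min ?_ hK <;>
    · rintro _ (rfl | rfl | rfl) <;> exact hv _

lemma mem_region_quad_of_mem_triangles {v : Fin 4 → ℂ} {i : Fin 4} {z : ℂ}
    (h02 : z ∈ convexHull ℝ {v i, v (i + 1), v (i + 2)} ∨
      z ∈ convexHull ℝ {v i, v (i + 2), v (i + 3)})
    (h13 : z ∈ convexHull ℝ {v i, v (i + 1), v (i + 3)} ∨
      z ∈ convexHull ℝ {v (i + 1), v (i + 2), v (i + 3)}) :
    z ∈ (Element.quad v).region := by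
  have hrot : ∀ A B C : ℂ, ({A, B, C} : Set ℂ) = {C, A, B} := fun A B C => by
    rw [Set.insert_comm C, Set.pair_comm C]
  fin_cases i <;>
    simp only [Fin.zero_eta, Fin.mk_one, Fin.reduceFinMk, Fin.isValue, zero_add,
      Fin.reduceAdd] at h02 h13
  · exact h02
  · rwa [hrot (v 1), hrot (v 2)] at h13
  · rwa [hrot (v 2) (v 3), hrot (v 2) (v 0), hrot (v 1), or_comm] at h02
  · rwa [hrot (v 3), hrot (v 2), or_comm] at h13

lemma add_mul_add_mul_mem_convexHull {A B C z : ℂ} {x y w : ℝ} (hx : 0 ≤ x) (hy : 0 ≤ y)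
    (hw : 0 ≤ w) (h : x + y + w = 1) (hz : z = x * A + y * B + w * C) :
    z ∈ convexHull ℝ {A, B, C} := by
  have hsum := (convex_convexHull ℝ {A, B, C}).sum_mem (t := Finset.univ) (w := ![x, y, w])
    (z := ![A, B, C]) (by simp [Fin.forall_fin_succ, hx, hy, hw]) (by simp [Fin.sum_univ_three, h])
    fun i _ => subset_convexHull ℝ _ (by fin_cases i <;> simp)
  simpa [Fin.sum_univ_three, hz] using hsum

lemma mem_region_of_kite {v : Fin 4 → ℂ} {i : Fin 4} {P e : ℂ} (h0 : v i = P + e * theta / 3)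
    (h1 : v (i + 1) = P + e) (h2 : v (i + 2) = P + e * theta) (h3 : v (i + 3) = P + e * zeta)
    {x y : ℝ} (hx : x ≤ 1) (hy : y ≤ 1) (hxy : 1 ≤ x + 2 * y) (hyx : 1 ≤ 2 * x + y) :
    P + e * (x + y * zeta) ∈ (Element.quad v).region := by
  apply mem_region_quad_of_mem_triangles (i := i) <;> rw [h0, h1, h2, h3, theta]
  · rcases le_total y x with hle | hle
    · refine Or.inl (add_mul_add_mul_mem_convexHull (x := 3 / 2 * (1 - x)) (y := x - y)
        (w := (2 * y + x - 1) / 2) (by linarith) (by linarith) (by linarith) (by ring) ?_)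
      push_cast
      ring
    · refine Or.inr (add_mul_add_mul_mem_convexHull (x := 3 / 2 * (1 - y))
        (y := (2 * x + y - 1) / 2) (w := y - x) (by linarith) (by linarith) (by linarith)
        (by ring) ?_)
      push_cast
      ring
  · rcases le_total (x + y) 1 with hle | hle
    · refine Or.inl (add_mul_add_mul_mem_convexHull (x := 3 * (1 - x - y)) (y := 2 * x + y - 1)
        (w := x + 2 * y - 1) (by linarith) (by linarith) (by linarith) (by ring) ?_)
      push_cast
      ring
    · refine Or.inr (add_mul_add_mul_mem_convexHull (x := 1 - y) (y := x + y - 1) (w := 1 - x)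
        (by linarith) (by linarith) (by linarith) (by ring) ?_)
      push_cast
      ring

lemma convex_parallelogram (P e f : ℂ) :
    Convex ℝ {z : ℂ | ∃ x y : ℝ, 0 ≤ x ∧ x ≤ 1 ∧ 0 ≤ y ∧ y ≤ 1 ∧ z = P + (x * e + y * f)} := by
  rintro _ ⟨x, y, hx, hx', hy, hy', rfl⟩ _ ⟨u, v, hu, hu', hv, hv', rfl⟩ s t hs ht hst
  refine ⟨s * x + t * u, s * y + t * v, by positivity, by nlinarith, by positivity, by nlinarith,
    ?_⟩
  have : (s : ℂ) + t = 1 := by exact_mod_cast hst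
  simp only [Complex.real_smul]
  push_cast
  linear_combination P * this

lemma norm_add_mul_zeta_le_one {x y : ℝ} (hx : 0 ≤ x) (hy : 0 ≤ y) (hxy : x + y ≤ 1) :
    ‖(x + y * zeta : ℂ)‖ ≤ 1 := by
  rw [← sq_le_one_iff₀ (norm_nonneg _), norm_add_mul_zeta_sq]
  nlinarith

variable {o a : ℂ} {k : ℕ} {Q : Fin 4 → ℂ} {S S' S₁ S₂ : Set ℂ} {i : Fin 4} {j : ℕ} {z : ℂ}

lemma sideLen_le_two_mul (a : ℂ) (k : ℕ) : sideLen a k ≤ 2 * sideLen a (k + 1) := by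
  rw [sideLen_eq_sqrt_three_mul]
  exact mul_le_mul_of_nonneg_right (by linarith [sqrt_three_lt]) (sideLen_nonneg a _)

namespace IsAcuteCorner

lemma exists_coords (h : IsAcuteCorner a k Q i j) (hz : z ∈ (Element.quad Q).region) :
    ∃ x y : ℝ, 0 ≤ x ∧ x ≤ 1 ∧ 0 ≤ y ∧ y ≤ 1 ∧
      z = Q i + edgeVec a k * zeta ^ j * (x + y * zeta) := by
  suffices ∀ l, ∃ x y : ℝ, 0 ≤ x ∧ x ≤ 1 ∧ 0 ≤ y ∧ y ≤ 1 ∧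
      Q l = Q i + (x * (edgeVec a k * zeta ^ j) + y * (edgeVec a k * zeta ^ (j + 1))) by
    obtain ⟨x, y, hx, hx', hy, hy', rfl⟩ := region_quad_subset (convex_parallelogram _ _ _) this hz
    exact ⟨x, y, hx, hx', hy, hy', by ring⟩
  intro l
  rcases fin_four_cases i l with rfl | rfl | rfl | rfl
  · exact ⟨0, 0, by simp⟩
  · exact ⟨1, 0, by simp [h.one]⟩
  · exact ⟨1, 1, by simp [h.two, theta]; ring⟩
  · exact ⟨0, 1, by simp [h.three]⟩

lemma add_one_notMem (ha : a ≠ 0) (hi : Q i ∈ lattice o a k) (h : IsAcuteCorner a k Q i j)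
    (hS : S ⊆ lattice o a k) : Q (i + 1) ∉ S := fun hm =>
  add_edgeVec_mul_zeta_pow_notMem_lattice ha hi j (h.one ▸ hS hm)

lemma add_three_notMem (ha : a ≠ 0) (hi : Q i ∈ lattice o a k) (h : IsAcuteCorner a k Q i j)
    (hS : S ⊆ lattice o a k) : Q (i + 3) ∉ S := fun hm =>
  add_edgeVec_mul_zeta_pow_notMem_lattice ha hi (j + 1) (h.three ▸ hS hm)

lemma cutCorners_congr (ha : a ≠ 0) (hi : Q i ∈ lattice o a k) (h : IsAcuteCorner a k Q i j)
    (hS : S ⊆ lattice o a k) (hS' : S' ⊆ lattice o a k) (h0 : Q i ∈ S ↔ Q i ∈ S')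
    (h2 : Q (i + 2) ∈ S ↔ Q (i + 2) ∈ S') : cutCorners S Q = cutCorners S' Q := by
  refine DiamondKite.cutCorners_congr fun l => ?_
  rcases fin_four_cases i l with rfl | rfl | rfl | rfl
  · exact h0
  · exact iff_of_false (h.add_one_notMem ha hi hS) (h.add_one_notMem ha hi hS')
  · exact h2
  · exact iff_of_false (h.add_three_notMem ha hi hS) (h.add_three_notMem ha hi hS')

lemma mem_region_cutCorners (ha : a ≠ 0) (hi : Q i ∈ lattice o a k) (h : IsAcuteCorner a k Q i j)
    (hS : S ⊆ lattice o a k) (h0 : Q i ∈ S) (h2 : Q (i + 2) ∉ S) {x y : ℝ} (hx : x ≤ 1)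
    (hy : y ≤ 1) (hxy : 1 ≤ x + 2 * y) (hyx : 1 ≤ 2 * x + y) :
    Q i + edgeVec a k * zeta ^ j * (x + y * zeta) ∈
      (Element.quad (cutCorners S Q)).region := by
  refine mem_region_of_kite (i := i) ?_ ?_ ?_ ?_ hx hy hxy hyx
  · rw [cutCorners_of_mem h0, cornerCentroid, sub_eq_add_neg, show (-1 : Fin 4) = 3 from rfl, h.one,
      h.three, theta]
    ring
  · rw [cutCorners_of_notMem (h.add_one_notMem ha hi hS), h.one]
  · rw [cutCorners_of_notMem h2, h.two]
    ring
  · rw [cutCorners_of_notMem (h.add_three_notMem ha hi hS), h.three]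
    ring

lemma region_subset_union (ha : a ≠ 0) (hi : Q i ∈ lattice o a k) (h : IsAcuteCorner a k Q i j)
    (hS₁ : S₁ ⊆ lattice o a k) (hS₂ : S₂ ⊆ lattice o a k) (h0 : Q i ∈ S₁) (h2 : Q (i + 2) ∉ S₁)
    (h0' : Q i ∉ S₂) (h2' : Q (i + 2) ∈ S₂) :
    (Element.quad Q).region ⊆
      (Element.quad (cutCorners S₁ Q)).region ∪ (Element.quad (cutCorners S₂ Q)).region := by
  intro z hz
  obtain ⟨x, y, hx, hx', hy, hy', rfl⟩ := h.exists_coords hz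
  rcases le_total 1 (x + y) with hs | hs
  · exact Or.inl (h.mem_region_cutCorners ha hi hS₁ h0 h2 hx' hy' (by linarith) (by linarith))
  · right
    have hback : Q (i + 2 + 2) ∉ S₂ := by
      rwa [add_assoc, show (2 + 2 : Fin 4) = 0 from rfl, add_zero]
    convert h.opposite.mem_region_cutCorners ha (h.mem_two hi) hS₂ h2' hback
      (x := 1 - x) (y := 1 - y) (by linarith) (by linarith) (by linarith) (by linarith) using 1
    rw [h.two, zeta_pow_add_three, theta]
    push_cast
    ring

lemma dist_le_or_dist_le (h : IsAcuteCorner a k Q i j) (hz : z ∈ (Element.quad Q).region) :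
    dist z (Q i) ≤ sideLen a k ∨ dist z (Q (i + 2)) ≤ sideLen a k := by
  have hle : ∀ {x y : ℝ}, 0 ≤ x → 0 ≤ y → x + y ≤ 1 →
      ‖edgeVec a k * zeta ^ j * (x + y * zeta)‖ ≤ sideLen a k := fun hx hy hxy => by
    rw [norm_mul, norm_edgeVec_mul_zeta_pow]
    exact mul_le_of_le_one_right (sideLen_nonneg a k) (norm_add_mul_zeta_le_one hx hy hxy)
  obtain ⟨x, y, hx, hx', hy, hy', rfl⟩ := h.exists_coords hz
  rcases le_total (x + y) 1 with hs | hs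
  · left
    rw [dist_self_add_left]
    exact hle hx hy hs
  · right
    have hsub : edgeVec a k * (theta * zeta ^ j) - edgeVec a k * zeta ^ j * (x + y * zeta) =
        edgeVec a k * zeta ^ j * ((1 - x : ℝ) + (1 - y : ℝ) * zeta) := by
      unfold theta
      push_cast
      ring
    rw [dist_comm, h.two, dist_add_left, dist_eq_norm, hsub]
    exact hle (by linarith) (by linarith) (by linarith)

lemma dist_add_two_cornerCentroid (h : IsAcuteCorner a k Q i j) :
    dist (Q i) (cornerCentroid Q (i + 2)) = 2 * sideLen a (k + 1) := by
  have hcentroid : cornerCentroid Q (i + 2) = Q i + 2 * (edgeVec a (k + 1) * zeta ^ (j + 1)) := by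
    rw [h.opposite.cornerCentroid_eq, h.two, ← edgeVec_succ_mul_theta a k, add_right_comm j 3,
      zeta_pow_add_three]
    linear_combination edgeVec a (k + 1) * zeta ^ j * theta_sq
  rw [hcentroid, dist_self_add_right, norm_mul, norm_edgeVec_mul_zeta_pow, Complex.norm_ofNat]

lemma region_cutCorners_subset_closedBall (ha : a ≠ 0) (hi : Q i ∈ lattice o a k)
    (h : IsAcuteCorner a k Q i j) (hS : S ⊆ lattice o a k) (h0 : Q i ∉ S) (h2 : Q (i + 2) ∈ S) :
    (Element.quad (cutCorners S Q)).region ⊆ Metric.closedBall (Q i) (2 * sideLen a (k + 1)) := by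
  refine region_quad_subset (convex_closedBall _ _) fun l => ?_
  rw [Metric.mem_closedBall, dist_comm]
  rcases fin_four_cases i l with rfl | rfl | rfl | rfl
  · rw [cutCorners_of_notMem h0, dist_self]
    exact mul_nonneg zero_le_two (sideLen_nonneg a _)
  · rw [cutCorners_of_notMem (h.add_one_notMem ha hi hS), h.one, dist_add_edgeVec_mul_zeta_pow]
    exact sideLen_le_two_mul a k
  · rw [cutCorners_of_mem h2, h.dist_add_two_cornerCentroid]
  · rw [cutCorners_of_notMem (h.add_three_notMem ha hi hS), h.three, dist_add_edgeVec_mul_zeta_pow]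
    exact sideLen_le_two_mul a k

end IsAcuteCorner

lemma IsTile.exists_notMem_dist_le (ha : a ≠ 0) (hQ : IsTile o a k Q) (hS : S ⊆ lattice o a k)
    (hi : Q i ∈ lattice o a k) (h0 : Q i ∉ S) (hz : z ∈ (Element.quad (cutCorners S Q)).region) :
    ∃ l, Q l ∈ lattice o a k ∧ Q l ∉ S ∧ dist z (Q l) ≤ 2 * sideLen a (k + 1) := by
  obtain ⟨j, hj⟩ := hQ.isAcuteCorner ha hi
  by_cases h2 : Q (i + 2) ∈ S
  · exact ⟨i, hi, h0, hj.region_cutCorners_subset_closedBall ha hi hS h0 h2 hz⟩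
  · have huncut : cutCorners S Q = Q := by
      rw [hj.cutCorners_congr ha hi hS (Set.empty_subset _) (iff_of_false h0 id)
        (iff_of_false h2 id), cutCorners_eq_self fun _ => id]
    rcases hj.dist_le_or_dist_le (huncut ▸ hz) with hd | hd
    exacts [⟨i, hi, h0, hd.trans (sideLen_le_two_mul a k)⟩,
      ⟨i + 2, hj.mem_two hi, h2, hd.trans (sideLen_le_two_mul a k)⟩]

end Regions

section ObeysSize

variable {o a : ℂ} {k : ℕ} {Q : Fin 4 → ℂ} {S S₁ S₂ : Set ℂ} {i l : Fin 4} {z : ℂ}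
  {D D' : Finset (ℕ × ℂ)} {Ω : Set ℂ} {σ : ℂ → ℝ}

lemma IsTile.dist_cutCorners_le (ha : a ≠ 0) (hQ : IsTile o a k Q) (hS : S ⊆ lattice o a k)
    (hi : Q i ∈ lattice o a k) (hl : Q l ∉ lattice o a k) :
    dist (cutCorners S Q i) (cutCorners S Q l) ≤ sideLen a k := by
  rw [cutCorners_of_notMem fun hm => hl (hS hm)]
  by_cases hm : Q i ∈ S
  · rw [cutCorners_of_mem hm, dist_comm, hQ.dist_obtuse_cornerCentroid ha hi hl]
    exact (sideLen_strictAnti ha k.lt_succ_self).le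
  · rw [cutCorners_of_notMem hm, hQ.dist_eq ha hi hl]

lemma IsTile.dist_cutCorners_add_one_le (ha : a ≠ 0) (hQ : IsTile o a k Q)
    (hS : S ⊆ lattice o a k) (i : Fin 4) :
    dist (cutCorners S Q i) (cutCorners S Q (i + 1)) ≤ sideLen a k := by
  by_cases hi : Q i ∈ lattice o a k
  · exact hQ.dist_cutCorners_le ha hS hi ((hQ.notMem_lattice_add_one_iff ha i).2 hi)
  · rw [dist_comm]
    exact hQ.dist_cutCorners_le ha hS
      ((hQ.mem_lattice_or_mem_lattice_add_one i).resolve_left hi) hi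

lemma obeysSize_meshOf_iff (ha : a ≠ 0) (hD : IsDownClosed o a D) :
    ObeysSize (meshOf o a D) Ω σ ↔ ∀ k, ∀ Q ∈ tiles o a D k, ¬ IsFullyCut o a D k Q →
      ∀ z ∈ (Element.quad (cutCorners (level D k) Q)).region ∩ Ω, sideLen a k ≤ σ z := by
  constructor
  · intro h k Q hQ hU z hz
    have hT := isTile_of_mem_tiles ha hD hQ
    obtain ⟨i, hi, hn⟩ := not_isFullyCut_iff.1 hU
    have hl := (hT.notMem_lattice_add_one_iff ha i).2 hi
    have hside := h _ ⟨k, Q, hQ, hU, rfl⟩ z hz _ _ ⟨i, Or.inl ⟨rfl, rfl⟩⟩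
    rwa [cutCorners_of_notMem hn, cutCorners_of_notMem fun hm => hl (hD.mem k hm),
      hT.dist_eq ha hi hl] at hside
  · rintro h _ ⟨k, Q, hQ, hU, rfl⟩ z hz x y ⟨i, hi⟩
    have hle := ((isTile_of_mem_tiles ha hD hQ).dist_cutCorners_add_one_le ha (hD.mem k) i).trans
      (h k Q hQ hU z hz)
    rcases hi with ⟨rfl, rfl⟩ | ⟨rfl, rfl⟩
    exacts [hle, dist_comm (cutCorners _ Q i) _ ▸ hle]

lemma IsDownClosed.inter (hD : IsDownClosed o a D) (hD' : IsDownClosed o a D') :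
    IsDownClosed o a (D ∩ D') := by
  refine ⟨fun k x hx => hD.mem k (Finset.mem_inter.1 hx).1, fun k x hx q hq hd => ?_⟩
  exact Finset.mem_inter.2 ⟨hD.down k x (Finset.mem_inter.1 hx).1 q hq hd,
    hD'.down k x (Finset.mem_inter.1 hx).2 q hq hd⟩

lemma level_inter (D D' : Finset (ℕ × ℂ)) (k : ℕ) : level (D ∩ D') k = level D k ∩ level D' k :=
  Set.ext fun _ => Finset.mem_inter

lemma IsTile.region_cutCorners_inter_subset (ha : a ≠ 0) (hQ : IsTile o a k Q)
    (hS₁ : S₁ ⊆ lattice o a k) (hS₂ : S₂ ⊆ lattice o a k) (hi : Q i ∈ lattice o a k)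
    (h₁ : Q i ∉ S₁) (hz : z ∈ (Element.quad (cutCorners (S₁ ∩ S₂) Q)).region) :
    z ∈ (Element.quad (cutCorners S₁ Q)).region ∨
      (∃ l, Q l ∈ lattice o a k ∧ Q l ∉ S₂) ∧ z ∈ (Element.quad (cutCorners S₂ Q)).region := by
  obtain ⟨j, hj⟩ := hQ.isAcuteCorner ha hi
  have hS : S₁ ∩ S₂ ⊆ lattice o a k := Set.inter_subset_left.trans hS₁
  have h₀ : Q i ∉ S₁ ∩ S₂ := fun hm => h₁ hm.1
  by_cases h : Q (i + 2) ∈ S₁ ∧ Q (i + 2) ∉ S₂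
  · obtain ⟨h2, h2'⟩ := h
    have hex : ∃ l, Q l ∈ lattice o a k ∧ Q l ∉ S₂ := ⟨i + 2, hj.mem_two hi, h2'⟩
    have h₂ : Q (i + 2) ∉ S₁ ∩ S₂ := fun hm => h2' hm.2
    by_cases h0 : Q i ∈ S₂
    · have huncut : cutCorners (S₁ ∩ S₂) Q = Q := by
        rw [hj.cutCorners_congr ha hi hS (Set.empty_subset _) (iff_of_false h₀ id)
          (iff_of_false h₂ id), cutCorners_eq_self fun _ => id]
      rw [huncut] at hz
      exact (hj.region_subset_union ha hi hS₂ hS₁ h0 h2' h₁ h2 hz).symm.imp_right (⟨hex, ·⟩)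
    · rw [hj.cutCorners_congr ha hi hS hS₂ (iff_of_false h₀ h0) (iff_of_false h₂ h2')] at hz
      exact Or.inr ⟨hex, hz⟩
  · rw [hj.cutCorners_congr ha hi hS hS₁ (iff_of_false h₀ h₁)
      (and_iff_left_of_imp fun h2 => by_contra fun h2' => h ⟨h2, h2'⟩)] at hz
    exact Or.inl hz

lemma ObeysSize.meshOf_inter (ha : a ≠ 0) (hD : IsDownClosed o a D) (hD' : IsDownClosed o a D')
    (h : ObeysSize (meshOf o a D) Ω σ) (h' : ObeysSize (meshOf o a D') Ω σ) :
    ObeysSize (meshOf o a (D ∩ D')) Ω σ := by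
  rw [obeysSize_meshOf_iff ha (hD.inter hD')]
  intro k Q hQ hU z hz
  obtain ⟨i, hi, hn⟩ := not_isFullyCut_iff.1 hU
  wlog h0 : Q i ∉ level D k generalizing D D'
  · rw [Finset.inter_comm] at hQ hU hz hn
    refine this hD' hD h' h hQ hU hz hn fun h0' => ?_
    rw [level_inter] at hn
    exact hn ⟨h0', not_not.1 h0⟩
  rw [level_inter] at hz
  have hT := isTile_of_mem_tiles ha (hD.inter hD') hQ
  rcases hT.region_cutCorners_inter_subset ha (hD.mem k) (hD'.mem k) hi h0 hz.1
    with hz' | ⟨hU', hz'⟩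
  · exact (obeysSize_meshOf_iff ha hD).1 h k Q (tiles_mono hD Finset.inter_subset_left hQ)
      (not_isFullyCut_iff.2 ⟨i, hi, h0⟩) z ⟨hz', hz.2⟩
  · exact (obeysSize_meshOf_iff ha hD').1 h' k Q (tiles_mono hD' Finset.inter_subset_right hQ)
      (not_isFullyCut_iff.2 hU') z ⟨hz', hz.2⟩

end ObeysSize

section Packing

variable {ι : Type*} {c : ι → ℂ} {z : ℂ} {r R : ℝ}

lemma card_le_of_pairwiseDisjoint_ball {S : Finset ι} (hr : 0 < r) (hR : ∀ i ∈ S, dist (c i) z ≤ R)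
    (hd : (S : Set ι).PairwiseDisjoint fun i => Metric.ball (c i) r) :
    (S.card : ℝ) ≤ ((R + r) / r) ^ 2 := by
  rcases S.eq_empty_or_nonempty with rfl | ⟨i₀, hi₀⟩
  · rw [Finset.card_empty, Nat.cast_zero]
    positivity
  have hR0 : 0 ≤ R := dist_nonneg.trans (hR i₀ hi₀)
  have hsub : (⋃ i ∈ S, Metric.ball (c i) r) ⊆ Metric.ball z (R + r) :=
    Set.iUnion₂_subset fun i hi => Metric.ball_subset_ball' (by linarith [hR i hi])
  have hvol := MeasureTheory.measure_mono (μ := MeasureTheory.volume) hsub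
  rw [MeasureTheory.measure_biUnion_finset hd fun i _ => measurableSet_ball] at hvol
  simp only [Complex.volume_ball, Finset.sum_const, nsmul_eq_mul] at hvol
  replace hvol := ENNReal.toReal_mono (by finiteness) hvol
  simp only [ENNReal.toReal_mul, ENNReal.toReal_natCast, ENNReal.toReal_pow,
    ENNReal.toReal_ofReal hr.le, ENNReal.toReal_ofReal (add_nonneg hR0 hr.le),
    ENNReal.coe_toReal, NNReal.coe_real_pi] at hvol
  rw [div_pow, le_div_iff₀ (by positivity)]
  exact le_of_mul_le_mul_right (by linarith) Real.pi_pos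

lemma finite_and_ncard_le_of_pairwiseDisjoint_ball {S : Set ι} (hr : 0 < r)
    (hR : ∀ i ∈ S, dist (c i) z ≤ R) (hd : S.PairwiseDisjoint fun i => Metric.ball (c i) r) :
    S.Finite ∧ (S.ncard : ℝ) ≤ ((R + r) / r) ^ 2 := by
  have hcard : ∀ T : Finset ι, ↑T ⊆ S → (T.card : ℝ) ≤ ((R + r) / r) ^ 2 := fun T hT =>
    card_le_of_pairwiseDisjoint_ball hr (fun i hi => hR i (hT hi)) (hd.subset hT)
  have hfin : S.Finite := by
    by_contra hinf
    obtain ⟨N, hN⟩ := exists_nat_gt (((R + r) / r) ^ 2)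
    obtain ⟨T, hTS, rfl⟩ := Set.Infinite.exists_subset_card_eq hinf N
    exact hN.not_ge (hcard T hTS)
  refine ⟨hfin, ?_⟩
  rw [Set.ncard_eq_toFinset_card S hfin]
  exact hcard _ hfin.coe_toFinset.subset

end Packing

section Gradation

variable {o a : ℂ} {k : ℕ} {D : Finset (ℕ × ℂ)} {x y : ℂ}

-- One of `v`, `v ζ ^ 2` and `v ζ ^ 4`, at angles of 120°, is within 60° of `w`.
lemma exists_norm_sub_mul_zeta_pow_le {w v : ℂ} (h : ‖v‖ ≤ ‖w‖) :
    ∃ m : ℕ, ‖w - v * zeta ^ (2 * m)‖ ≤ ‖w‖ := by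
  by_contra! hcon
  set c : ℕ → ℝ := fun m => inner ℝ w (v * zeta ^ (2 * m)) with hc
  have hlt : ∀ m, 2 * c m < ‖v‖ ^ 2 := fun m => by
    have hsq := pow_lt_pow_left₀ (hcon m) (norm_nonneg _) two_ne_zero
    rw [norm_sub_sq_real, norm_mul, norm_pow, norm_zeta, one_pow, mul_one] at hsq
    linarith
  have hsum : c 0 + c 1 + c 2 = 0 := by
    rw [hc, ← inner_add_right, ← inner_add_right, ← mul_add, ← mul_add,
      show zeta ^ (2 * 0) + zeta ^ (2 * 1) + zeta ^ (2 * 2) = 0 by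
        linear_combination (1 + zeta + zeta ^ 2) * zeta_sq, mul_zero, inner_zero_right]
  have hprod : c 0 * c 1 + c 1 * c 2 + c 2 * c 0 = -(3 / 4) * (‖w‖ ^ 2 * ‖v‖ ^ 2) := by
    have h4 : zeta ^ (2 * 2) = -zeta := by linear_combination zeta * zeta_pow_three
    simp only [hc, h4, mul_zero, pow_zero, mul_one, zeta_sq, Complex.inner,
      ← Complex.normSq_eq_norm_sq, Complex.normSq_apply]
    simp only [zeta, Complex.mul_re, Complex.mul_im, Complex.conj_re, Complex.conj_im,
      Complex.sub_re, Complex.sub_im, Complex.neg_re, Complex.neg_im, Complex.one_re,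
      Complex.one_im]
    linear_combination (-1 / 4 * (w.re * v.im - w.im * v.re) ^ 2) * sqrt_three_sq
  have hle : ‖v‖ ^ 2 * ‖v‖ ^ 2 ≤ ‖w‖ ^ 2 * ‖v‖ ^ 2 := by gcongr
  nlinarith [mul_pos (sub_pos.2 (hlt 0)) (sub_pos.2 (hlt 1)),
    mul_pos (sub_pos.2 (hlt 1)) (sub_pos.2 (hlt 2)),
    mul_pos (sub_pos.2 (hlt 2)) (sub_pos.2 (hlt 0))]

lemma exists_mem_lattice_dist_le (hx : x ∈ lattice o a (k + 1)) (h : sideLen a k ≤ dist x y) :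
    ∃ q ∈ lattice o a k, dist x q ≤ sideLen a k ∧ dist q y ≤ dist x y := by
  rcases mem_lattice_or_exists_neighbors hx with hxl | ⟨i, hi⟩
  · exact ⟨x, hxl, by rw [dist_self]; exact sideLen_nonneg _ _, le_rfl⟩
  · rw [dist_comm, dist_eq_norm, ← norm_edgeVec_mul_zeta_pow a k i] at h
    obtain ⟨m, hm⟩ := exists_norm_sub_mul_zeta_pow_le h
    refine ⟨_, hi m, (dist_add_edgeVec_mul_zeta_pow a x k _).le, ?_⟩
    rw [dist_comm, dist_eq_norm, dist_comm x, dist_eq_norm y x]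
    rwa [pow_add, ← mul_assoc, ← sub_sub]

lemma IsDownClosed.mem_level_of_dist_lt (hD : IsDownClosed o a D) {j : ℕ} (hkj : k ≤ j)
    (hx : x ∈ level D j) (hy : y ∈ lattice o a k) (hd : dist x y < Real.sqrt 3 * sideLen a k) :
    y ∈ level D k := by
  induction j, hkj using Nat.le_induction generalizing x with
  | base => rwa [← eq_of_dist_lt_sqrt_three_mul_sideLen (hD.mem _ hx) hy hd]
  | succ j hj ih =>
    rcases le_total (dist x y) (sideLen a j) with h | h
    · exact hD.mem_level_of_le hj (hD.down j x hx y (lattice_mono hj hy) h) hy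
    · obtain ⟨q, hq, hxq, hqy⟩ := exists_mem_lattice_dist_le (hD.mem _ hx) h
      exact ih (hD.down j x hx q hq hxq) (hqy.trans_lt hd)

end Gradation

section UncutCorners

/-- `Q'` is an element of the mesh of `D`, obtained from a tile of level `k`, and `y` is an acute
corner of that tile which has not been cut. The corners `y` are spread out, so they serve to count
the elements, and an element is close to each of its uncut corners. -/
structure IsUncutCorner (o a : ℂ) (D : Finset (ℕ × ℂ)) (k : ℕ) (y : ℂ) (Q' : Fin 4 → ℂ) :
    Prop where
  mem : y ∈ lattice o a k
  notMem : y ∉ level D k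
  exists_tile : ∃ Q ∈ tiles o a D k, ∃ i, Q i = y ∧ Q' = cutCorners (level D k) Q

/-- The rhombus with an acute corner at `y` whose edges at `y` are `e` and `e * ζ`. -/
def rhombus (y e : ℂ) : Fin 4 → ℂ := ![y, y + e, y + e * theta, y + e * zeta]

variable {o a : ℂ} {k k' : ℕ} {D : Finset (ℕ × ℂ)} {y y' z z' : ℂ} {Q Q' : Fin 4 → ℂ}

lemma IsAcuteCorner.eq_rhombus {i : Fin 4} {j : ℕ} (h : IsAcuteCorner a k Q i j) :
    Q = fun l => rhombus (Q i) (edgeVec a k * zeta ^ j) (l - i) := by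
  funext l
  rcases fin_four_cases i l with rfl | rfl | rfl | rfl
  · simp [rhombus]
  · simp [rhombus, h.one]
  · simp [rhombus, h.two, mul_assoc, mul_comm theta]
  · simp [rhombus, h.three, pow_succ, mul_assoc]

lemma exists_isUncutCorner (ha : a ≠ 0) (hD : IsDownClosed o a D) (hQ : Q ∈ meshOf o a D)
    (hz : z ∈ (Element.quad Q).region) :
    ∃ k y, IsUncutCorner o a D k y Q ∧ dist z y ≤ 2 * sideLen a (k + 1) := by
  obtain ⟨k, Q, hQ, hU, rfl⟩ := hQ
  obtain ⟨i, hi, hn⟩ := not_isFullyCut_iff.1 hU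
  obtain ⟨l, hl, hn, hd⟩ :=
    (isTile_of_mem_tiles ha hD hQ).exists_notMem_dist_le ha (hD.mem k) hi hn hz
  exact ⟨k, Q l, ⟨hl, hn, Q, hQ, l, rfl, rfl⟩, hd⟩

namespace IsUncutCorner

lemma exists_mem_level_dist_le (ha : a ≠ 0) (hD : IsDownClosed o a D)
    (h : IsUncutCorner o a D (k + 1) y Q) : ∃ x ∈ level D k, dist x y ≤ sideLen a k := by
  obtain ⟨Q, hQ, i, rfl, -⟩ := h.exists_tile
  exact exists_mem_level_dist_le_of_mem_lattice ha hD hQ h.mem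

lemma sqrt_three_mul_sideLen_le (ha : a ≠ 0) (hD : IsDownClosed o a D)
    (h : IsUncutCorner o a D k y Q) {m : ℕ} (h' : IsUncutCorner o a D (m + 1) y' Q') (hkm : k ≤ m) :
    Real.sqrt 3 * sideLen a k ≤ sideLen a m + dist y y' := by
  obtain ⟨x, hx, hxy⟩ := h'.exists_mem_level_dist_le ha hD
  by_contra! hlt
  exact h.notMem (hD.mem_level_of_dist_lt hkm hx h.mem
    ((dist_triangle_right x y y').trans_lt (by linarith)))

lemma level_le_add_four (ha : a ≠ 0) (hD : IsDownClosed o a D) (h : IsUncutCorner o a D k y Q)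
    (hz : dist z y ≤ 2 * sideLen a (k + 1)) (h' : IsUncutCorner o a D k' y' Q')
    (hz' : dist z' y' ≤ 2 * sideLen a (k' + 1)) (hd : dist z z' ≤ sideLen a k / 4) :
    k' ≤ k + 4 := by
  by_contra! hk
  obtain ⟨m, rfl⟩ : ∃ m, k' = m + 1 := ⟨k' - 1, by omega⟩
  have hle := h.sqrt_three_mul_sideLen_le ha hD h' (by omega)
  have htri : dist y y' ≤ dist z y + dist z z' + dist z' y' := by
    linarith [dist_triangle_left y y' z, dist_triangle z z' y']
  have hm : sideLen a m ≤ sideLen a (k + 4) := (sideLen_strictAnti ha).antitone (by omega)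
  have hpos := sideLen_pos ha (k + 1)
  have hk3 := sideLen_eq_three_mul a (k + 1)
  have hk4 := sideLen_eq_three_mul a k
  have hk5 := sideLen_eq_three_mul a (k + 2)
  have hm2 := sideLen_eq_three_mul a m
  have hk0 := sideLen_eq_sqrt_three_mul a k
  have hsq : Real.sqrt 3 * sideLen a k = 3 * sideLen a (k + 1) := by
    rw [hk0, ← mul_assoc, ← pow_two, sqrt_three_sq]
  have hk0' : sideLen a k ≤ 1.74 * sideLen a (k + 1) := by
    rw [hk0]
    exact mul_le_mul_of_nonneg_right sqrt_three_lt.le hpos.le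
  simp only [add_assoc, Nat.reduceAdd] at *
  linarith

lemma mul_sideLen_le_dist (ha : a ≠ 0) (hD : IsDownClosed o a D) (h : IsUncutCorner o a D k y Q)
    (h' : IsUncutCorner o a D k' y' Q') (hne : (k, y) ≠ (k', y')) :
    2 / 3 * sideLen a k ≤ dist y y' := by
  have hlt : ∀ {k k' y y' Q Q'}, IsUncutCorner o a D k y Q → IsUncutCorner o a D k' y' Q' →
      k < k' → 2 / 3 * sideLen a k ≤ dist y y' := by
    intro k k' y y' Q Q' h h' hk
    obtain ⟨m, rfl⟩ : ∃ m, k' = m + 1 := ⟨k' - 1, by omega⟩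
    have hle := h.sqrt_three_mul_sideLen_le ha hD h' (by omega)
    have hm : sideLen a m ≤ sideLen a k := (sideLen_strictAnti ha).antitone (by omega)
    nlinarith [sideLen_pos ha k, lt_sqrt_three]
  rcases lt_trichotomy k k' with hk | rfl | hk
  · exact hlt h h' hk
  · by_contra! hd
    exact hne (by rw [eq_of_dist_le_sideLen ha h.mem h'.mem (by linarith [sideLen_nonneg a k])])
  · rw [dist_comm]
    linarith [hlt h' h hk, (sideLen_strictAnti ha).antitone hk.le]

lemma exists_eq_cutCorners_rhombus (ha : a ≠ 0) (hD : IsDownClosed o a D)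
    (h : IsUncutCorner o a D k y Q) : ∃ (i : Fin 4) (j : Fin 6),
      Q = cutCorners (level D k) fun l => rhombus y (edgeVec a k * zeta ^ (j : ℕ)) (l - i) := by
  obtain ⟨Q, hQ, i, rfl, rfl⟩ := h.exists_tile
  obtain ⟨j, hj⟩ := (isTile_of_mem_tiles ha hD hQ).isAcuteCorner ha h.mem
  refine ⟨i, ⟨j % 6, Nat.mod_lt _ (by norm_num)⟩, ?_⟩
  rw [← zeta_pow_add_six_mul (j % 6) (j / 6), Nat.mod_add_div, ← hj.eq_rhombus]

end IsUncutCorner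

lemma finite_and_ncard_le_of_isUncutCorner (ha : a ≠ 0) (hD : IsDownClosed o a D)
    {S : Set (Fin 4 → ℂ)} {r R : ℝ} {w : ℂ} (hr : 0 < r)
    (hS : ∀ Q ∈ S, ∃ k y, IsUncutCorner o a D k y Q ∧ r ≤ sideLen a k ∧ dist y w ≤ R) :
    S.Finite ∧ (S.ncard : ℝ) ≤ 24 * (3 * R / r + 1) ^ 2 := by
  set K : Set (ℕ × ℂ) :=
    {q | ∃ Q, IsUncutCorner o a D q.1 q.2 Q ∧ r ≤ sideLen a q.1 ∧ dist q.2 w ≤ R}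
  have hK : K.Finite ∧ (K.ncard : ℝ) ≤ ((R + r / 3) / (r / 3)) ^ 2 := by
    refine finite_and_ncard_le_of_pairwiseDisjoint_ball (c := Prod.snd) (z := w) (by positivity)
      (fun q ⟨_, _, _, h⟩ => h) ?_
    rintro q ⟨Q, h, hrq, -⟩ q' ⟨Q', h', -, -⟩ hne
    refine Metric.ball_disjoint_ball ?_
    linarith [h.mul_sideLen_le_dist ha hD h' hne]
  -- An element with the uncut corner `y` comes from one of six rhombi, listed from any corner.
  set g : (ℕ × ℂ) × (Fin 4 × Fin 6) → (Fin 4 → ℂ) := fun t => cutCorners (level D t.1.1) fun l =>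
    rhombus t.1.2 (edgeVec a t.1.1 * zeta ^ (t.2.2 : ℕ)) (l - t.2.1)
  have hsub : S ⊆ g '' (K ×ˢ Set.univ) := by
    intro Q hQ
    obtain ⟨k, y, h, hr, hR⟩ := hS Q hQ
    obtain ⟨i, j, hij⟩ := h.exists_eq_cutCorners_rhombus ha hD
    exact ⟨((k, y), (i, j)), ⟨⟨Q, h, hr, hR⟩, trivial⟩, hij.symm⟩
  have hfin : (K ×ˢ (Set.univ : Set (Fin 4 × Fin 6))).Finite := hK.1.prod Set.finite_univ
  refine ⟨(hfin.image g).subset hsub, ?_⟩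
  have hcard := (Set.ncard_le_ncard hsub (hfin.image g)).trans (Set.ncard_image_le hfin)
  rw [Set.ncard_prod, Set.ncard_univ, Nat.card_prod, Nat.card_fin, Nat.card_fin] at hcard
  have hcard' : (S.ncard : ℝ) ≤ K.ncard * 24 := by exact_mod_cast hcard
  have hR : (R + r / 3) / (r / 3) = 3 * R / r + 1 := by field_simp
  rw [← hR]
  linarith [hK.2]

end UncutCorners

section Coarsest

lemma exists_sideLen_lt (a : ℂ) {δ : ℝ} (hδ : 0 < δ) : ∃ k, sideLen a k < δ := by
  have heq : sideLen a = fun k => ‖a‖ * (Real.sqrt 3)⁻¹ ^ k := funext fun k => by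
    rw [sideLen, edgeVec, norm_div, norm_pow, norm_theta, inv_pow, div_eq_mul_inv]
  have hlim : Filter.Tendsto (sideLen a) Filter.atTop (nhds (‖a‖ * 0)) := by
    rw [heq]
    exact (tendsto_pow_atTop_nhds_zero_of_lt_one (by positivity)
      (inv_lt_one_of_one_lt₀ (by linarith [lt_sqrt_three]))).const_mul _
  rw [mul_zero] at hlim
  exact (hlim.eventually_lt_const hδ).exists

variable {o a : ℂ}

lemma finite_lattice_inter_closedBall (ha : a ≠ 0) (k : ℕ) (w : ℂ) (R : ℝ) :
    (lattice o a k ∩ Metric.closedBall w R).Finite := by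
  refine (finite_and_ncard_le_of_pairwiseDisjoint_ball (c := id) (r := sideLen a k / 2)
    (half_pos (sideLen_pos ha k)) (fun x hx => hx.2) ?_).1
  refine fun x hx y hy hne => Metric.ball_disjoint_ball ?_
  by_contra! h
  rw [add_halves] at h
  exact hne (eq_of_dist_le_sideLen ha hx.1 hy.1 h.le)

/-- The replacement steps whose center is near a point at which their side length is too large for
`σ`. Together they lead from the rhombille tiling to a mesh that obeys `σ`. -/
def oversizedSteps (o a : ℂ) (Ω : Set ℂ) (σ : ℂ → ℝ) : Set (ℕ × ℂ) :=
  {t | t.2 ∈ lattice o a t.1 ∧ ∃ q ∈ Ω, dist t.2 q ≤ 3 * sideLen a t.1 ∧ σ q < sideLen a t.1}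

variable {Ω : Set ℂ} {σ : ℂ → ℝ} {δ : ℝ} {D : Finset (ℕ × ℂ)}

lemma finite_oversizedSteps (ha : a ≠ 0) (hΩ : Bornology.IsBounded Ω) (hδ : 0 < δ)
    (hσ : ∀ p ∈ Ω, δ ≤ σ p) : (oversizedSteps o a Ω σ).Finite := by
  obtain ⟨K, hK⟩ := exists_sideLen_lt a hδ
  obtain ⟨R, hR⟩ := hΩ.subset_closedBall 0
  have hanti := (sideLen_strictAnti ha).antitone
  refine ((Set.finite_Iio K).biUnion fun k _ => (finite_lattice_inter_closedBall (o := o) ha k 0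
    (3 * sideLen a 0 + R)).image (Prod.mk k)).subset ?_
  rintro ⟨k, x⟩ ⟨hx, q, hq, hd, hs⟩
  dsimp only at hx hd hs
  have hkK : k < K := by
    by_contra! h
    linarith [hanti h, hσ q hq]
  refine Set.mem_biUnion (Set.mem_Iio.2 hkK) ⟨x, ⟨hx, Metric.mem_closedBall.2 ?_⟩, rfl⟩
  linarith [dist_triangle x q 0, Metric.mem_closedBall.1 (hR hq), hanti (Nat.zero_le k)]

lemma isDownClosed_of_eq_oversizedSteps (ha : a ≠ 0)
    (hDσ : (D : Set (ℕ × ℂ)) = oversizedSteps o a Ω σ) : IsDownClosed o a D := by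
  have hmem : ∀ k x, x ∈ level D k ↔ (k, x) ∈ oversizedSteps o a Ω σ := fun k x => by
    rw [← hDσ, Finset.mem_coe, level, Set.mem_ofPred_eq]
  refine ⟨fun k x hx => ((hmem k x).1 hx).1, fun k x hx q hq hd => ?_⟩
  obtain ⟨-, t, ht, htd, hts⟩ := (hmem _ _).1 hx
  refine (hmem _ _).2 ⟨hq, t, ht, ?_, hts.trans (sideLen_strictAnti ha k.lt_succ_self)⟩
  dsimp only at htd ⊢
  nlinarith [dist_triangle_left q t x, sideLen_eq_sqrt_three_mul a k, sideLen_pos ha (k + 1),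
    lt_sqrt_three]

lemma obeysSize_meshOf_of_eq_oversizedSteps (ha : a ≠ 0)
    (hDσ : (D : Set (ℕ × ℂ)) = oversizedSteps o a Ω σ) : ObeysSize (meshOf o a D) Ω σ := by
  have hD := isDownClosed_of_eq_oversizedSteps ha hDσ
  rw [obeysSize_meshOf_iff ha hD]
  rintro k Q hQ hU z ⟨hz, hzΩ⟩
  obtain ⟨i, hi, hn⟩ := not_isFullyCut_iff.1 hU
  obtain ⟨l, hl, hn, hd⟩ :=
    (isTile_of_mem_tiles ha hD hQ).exists_notMem_dist_le ha (hD.mem k) hi hn hz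
  by_contra! hlt
  refine hn (Finset.mem_coe.1 (hDσ ▸ ⟨hl, z, hzΩ, ?_, hlt⟩))
  rw [dist_comm]
  linarith [sideLen_pos ha k, sideLen_strictAnti ha k.lt_succ_self]

lemma exists_isCoarsest (ha : a ≠ 0) (hΩ : Bornology.IsBounded Ω) (hδ : 0 < δ)
    (hσ : ∀ p ∈ Ω, δ ≤ σ p) : ∃ M, IsCoarsest (rhombille o a) Ω σ M := by
  classical
  have hDσ := (finite_oversizedSteps (o := o) ha hΩ hδ hσ).coe_toFinset
  have hex : ∃ n, ∃ D : Finset (ℕ × ℂ),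
      D.card = n ∧ IsDownClosed o a D ∧ ObeysSize (meshOf o a D) Ω σ :=
    ⟨_, _, rfl, isDownClosed_of_eq_oversizedSteps ha hDσ,
      obeysSize_meshOf_of_eq_oversizedSteps ha hDσ⟩
  obtain ⟨D, hcard, hD, hob⟩ := Nat.find_spec hex
  refine ⟨meshOf o a D, refines_rhombille_meshOf ha hD, hob, fun M' hM' hob' => ?_⟩
  obtain ⟨D', hD', rfl⟩ := exists_eq_meshOf_of_refines_rhombille ha hM'
  have hmin := Nat.find_min' hex ⟨D ∩ D', rfl, hD.inter hD', hob.meshOf_inter ha hD hD' hob'⟩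
  have heq : D ∩ D' = D :=
    Finset.eq_of_subset_of_card_le Finset.inter_subset_left (hcard.trans_le hmin)
  exact refines_of_subset ha hD hD' (Finset.inter_eq_left.1 heq)

lemma localFeatureSize_le (hσ : ∀ p ∈ Ω, 0 ≤ σ p) (z : ℂ) {q : ℂ} (hq : q ∈ Ω) :
    localFeatureSize Ω σ z ≤ dist z q + σ q :=
  ciInf_le (f := fun q : Ω => dist z q + σ q)
    ⟨0, Set.forall_mem_range.2 fun q => add_nonneg dist_nonneg (hσ q q.2)⟩ ⟨q, hq⟩

lemma localFeatureSize_le_of_mem_oversizedSteps (hσ : ∀ p ∈ Ω, 0 ≤ σ p) {k : ℕ} {x y z : ℂ}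
    (hx : (k, x) ∈ oversizedSteps o a Ω σ) (hxy : dist x y ≤ sideLen a k)
    (hzy : dist z y ≤ 2 * sideLen a (k + 2)) :
    localFeatureSize Ω σ z ≤ 10 * sideLen a (k + 1) := by
  obtain ⟨-, q, hq, hxq, hqs⟩ := hx
  have htri : dist z q ≤ dist z y + dist x y + dist x q := by
    linarith [dist_triangle z y q, dist_triangle_left y q x]
  have hlfs := localFeatureSize_le hσ z hq
  dsimp only at hxq hqs
  nlinarith [sideLen_eq_sqrt_three_mul a k, sideLen_eq_three_mul a k, sideLen_nonneg a (k + 1),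
    sqrt_three_lt]

lemma IsCoarsest.exists_eq_meshOf (ha : a ≠ 0) (hΩ : Bornology.IsBounded Ω) (hδ : 0 < δ)
    (hσ : ∀ p ∈ Ω, δ ≤ σ p) {M : QuadMesh} (hM : IsCoarsest (rhombille o a) Ω σ M) :
    ∃ D : Finset (ℕ × ℂ), IsDownClosed o a D ∧ (D : Set (ℕ × ℂ)) ⊆ oversizedSteps o a Ω σ ∧
      M = meshOf o a D := by
  obtain ⟨D, hD, rfl⟩ := exists_eq_meshOf_of_refines_rhombille ha hM.refines
  have hDσ := (finite_oversizedSteps (o := o) ha hΩ hδ hσ).coe_toFinset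
  have hD' := isDownClosed_of_eq_oversizedSteps ha hDσ
  have hsub := subset_of_refines ha hD hD' (hM.coarsest _ (refines_rhombille_meshOf ha hD')
    (obeysSize_meshOf_of_eq_oversizedSteps ha hDσ))
  exact ⟨D, hD, hDσ ▸ Finset.coe_subset.2 hsub, rfl⟩

lemma IsUncutCorner.eq_zero_or_localFeatureSize_le (ha : a ≠ 0) (hD : IsDownClosed o a D)
    (hσ : ∀ p ∈ Ω, 0 ≤ σ p) (hDσ : (D : Set (ℕ × ℂ)) ⊆ oversizedSteps o a Ω σ) {k : ℕ} {y z : ℂ}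
    {Q : Fin 4 → ℂ} (h : IsUncutCorner o a D k y Q) (hz : dist z y ≤ 2 * sideLen a (k + 1)) :
    k = 0 ∨ localFeatureSize Ω σ z ≤ 10 * sideLen a k := by
  rcases k with _ | k
  · exact Or.inl rfl
  · obtain ⟨x, hx, hxy⟩ := h.exists_mem_level_dist_le ha hD
    exact Or.inr (localFeatureSize_le_of_mem_oversizedSteps hσ (hDσ hx) hxy hz)

end Coarsest

/-! ### Sizes of elements in a mesh of bounded aspect ratio -/

section PlaneGeometry

open Module

lemma inter_frontier_nonempty_of_isPreconnected {X : Type*} [TopologicalSpace X] {s K : Set X}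
    (hs : IsPreconnected s) (h : (s ∩ K).Nonempty) (h' : (s ∩ Kᶜ).Nonempty) :
    (s ∩ frontier K).Nonempty := by
  by_contra! hempty
  have hsub : s ⊆ interior K ∪ interior Kᶜ := by
    rw [← compl_frontier_eq_union_interior]
    exact (Set.disjoint_iff_inter_eq_empty.2 hempty).subset_compl_right
  obtain ⟨x, hx, hxK⟩ := h
  obtain ⟨y, hy, hyK⟩ := h'
  obtain ⟨z, -, hz, hz'⟩ := hs _ _ isOpen_interior isOpen_interior hsub
    ⟨x, hx, (hsub hx).resolve_right fun h => interior_subset h hxK⟩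
    ⟨y, hy, (hsub hy).resolve_left fun h => hyK (interior_subset h)⟩
  exact interior_subset hz' (interior_subset hz)

section NormedSpaces

variable {V W : Type*} [NormedAddCommGroup V] [NormedSpace ℝ V] [NormedAddCommGroup W]
  [NormedSpace ℝ W]

lemma exists_add_smul_mem_frontier {K : Set V} {x v : V} (hx : x ∈ K) {T : ℝ} (hT : 0 ≤ T)
    (hxT : x + T • v ∉ K) : ∃ t ∈ Set.Icc 0 T, x + t • v ∈ frontier K := by
  have hconn : IsPreconnected ((fun t : ℝ => x + t • v) '' Set.Icc 0 T) :=
    isPreconnected_Icc.image _ (by fun_prop)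
  obtain ⟨_, ⟨t, ht, rfl⟩, hfr⟩ := inter_frontier_nonempty_of_isPreconnected (K := K) hconn
    ⟨x, ⟨0, ⟨le_rfl, hT⟩, by simp⟩, hx⟩ ⟨_, ⟨T, ⟨hT, le_rfl⟩, rfl⟩, hxT⟩
  exact ⟨t, ht, hfr⟩

lemma exists_add_smul_notMem {K : Set V} (hK : Bornology.IsBounded K) (x : V) {v : V}
    (hv : v ≠ 0) : ∃ T : ℝ, 0 ≤ T ∧ x + T • v ∉ K := by
  obtain ⟨R, hR, hKR⟩ := hK.subset_ball_lt 0 x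
  refine ⟨R / ‖v‖, by positivity, fun hmem => ?_⟩
  have hlt := hKR hmem
  rw [Metric.mem_ball, dist_self_add_left, norm_smul, norm_div, norm_norm,
    div_mul_cancel₀ _ (norm_ne_zero_iff.2 hv), Real.norm_of_nonneg hR.le] at hlt
  exact hlt.false

/-- A minimum modulus principle: move towards the zero of the map if it is bijective, and along its
kernel otherwise. -/
lemma exists_mem_frontier_norm_add_le [FiniteDimensional ℝ V] [FiniteDimensional ℝ W]
    (hVW : finrank ℝ V = finrank ℝ W) (f : V →ₗ[ℝ] W) (c : W) {K : Set V}
    (hK : Bornology.IsBounded K) (hne : ∀ x ∈ K, f x + c ≠ 0) {x : V} (hx : x ∈ K) :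
    ∃ y ∈ frontier K, ‖f y + c‖ ≤ ‖f x + c‖ := by
  by_cases hf : Function.Injective f
  · obtain ⟨v, hv⟩ := (LinearMap.injective_iff_surjective_of_finrank_eq_finrank hVW).1 hf (f x + c)
    have hval : ∀ t : ℝ, f (x + t • -v) + c = (1 - t) • (f x + c) := by
      intro t
      rw [map_add, map_smul, map_neg, hv]
      module
    obtain ⟨t, ht, hfr⟩ := exists_add_smul_mem_frontier (T := 1) hx zero_le_one
      fun h => hne _ h (by rw [hval, sub_self, zero_smul])
    refine ⟨_, hfr, ?_⟩
    rw [hval, norm_smul, Real.norm_of_nonneg (sub_nonneg.2 ht.2)]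
    exact mul_le_of_le_one_left (norm_nonneg _) (by linarith [ht.1])
  · obtain ⟨v, hfv, hv⟩ : ∃ v, f v = 0 ∧ v ≠ 0 := by
      simpa [injective_iff_map_eq_zero] using hf
    obtain ⟨T, hT, hxT⟩ := exists_add_smul_notMem hK x hv
    obtain ⟨t, -, hfr⟩ := exists_add_smul_mem_frontier hx hT hxT
    exact ⟨_, hfr, by rw [map_add, map_smul, hfv, smul_zero, add_zero]⟩

lemma le_dist_of_mem_frontier_Icc_prod {x y z w : V} {m : ℝ}
    (hx : m ≤ Metric.infDist x (segment ℝ z w)) (hy : m ≤ Metric.infDist y (segment ℝ z w))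
    (hz : m ≤ Metric.infDist z (segment ℝ x y)) (hw : m ≤ Metric.infDist w (segment ℝ x y))
    {s t : ℝ} (hst : (s, t) ∈ frontier (Set.Icc (0 : ℝ) 1 ×ˢ Set.Icc (0 : ℝ) 1)) :
    m ≤ dist (x + s • (y - x)) (z + t • (w - z)) := by
  obtain ⟨hs, ht⟩ := (isClosed_Icc.prod isClosed_Icc).frontier_subset hst
  have hp : x + s • (y - x) ∈ segment ℝ x y := by
    rw [segment_eq_image']
    exact ⟨s, hs, rfl⟩
  have hq : z + t • (w - z) ∈ segment ℝ z w := by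
    rw [segment_eq_image']
    exact ⟨t, ht, rfl⟩
  rw [frontier_prod_eq, frontier_Icc zero_le_one] at hst
  rcases hst with ⟨-, rfl | rfl⟩ | ⟨rfl | rfl, -⟩
  · simpa [dist_comm] using hz.trans (Metric.infDist_le_dist_of_mem hp)
  · simpa [dist_comm] using hw.trans (Metric.infDist_le_dist_of_mem hp)
  · simpa using hx.trans (Metric.infDist_le_dist_of_mem hq)
  · simpa using hy.trans (Metric.infDist_le_dist_of_mem hq)

lemma le_dist_of_disjoint_segment (hV : finrank ℝ V = 2) {x y z w : V} {m : ℝ}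
    (hdisj : Disjoint (segment ℝ x y) (segment ℝ z w))
    (hx : m ≤ Metric.infDist x (segment ℝ z w)) (hy : m ≤ Metric.infDist y (segment ℝ z w))
    (hz : m ≤ Metric.infDist z (segment ℝ x y)) (hw : m ≤ Metric.infDist w (segment ℝ x y))
    {p q : V} (hp : p ∈ segment ℝ x y) (hq : q ∈ segment ℝ z w) : m ≤ dist p q := by
  have : FiniteDimensional ℝ V := Module.finite_of_finrank_pos (by omega)
  let f : ℝ × ℝ →ₗ[ℝ] V := (LinearMap.fst ℝ ℝ ℝ).smulRight (y - x) -
    (LinearMap.snd ℝ ℝ ℝ).smulRight (w - z)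
  have hf : ∀ t : ℝ × ℝ, ‖f t + (x - z)‖ = dist (x + t.1 • (y - x)) (z + t.2 • (w - z)) := by
    intro t
    rw [dist_eq_norm]
    congr 1
    simp only [f, LinearMap.sub_apply, LinearMap.smulRight_apply, LinearMap.fst_apply,
      LinearMap.snd_apply]
    abel
  rw [segment_eq_image'] at hp hq hdisj
  rw [segment_eq_image' ℝ z w] at hdisj
  obtain ⟨s, hs, rfl⟩ := hp
  obtain ⟨t, ht, rfl⟩ := hq
  obtain ⟨τ, hτ, hle⟩ := exists_mem_frontier_norm_add_le (by simp [hV]) f (x - z)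
    (K := Set.Icc 0 1 ×ˢ Set.Icc 0 1) (x := (s, t))
    (Metric.isBounded_Icc _ _ |>.prod (Metric.isBounded_Icc _ _))
    (fun t ht h0 => by
      rw [← norm_eq_zero, hf, dist_eq_zero] at h0
      exact Set.disjoint_left.1 hdisj ⟨t.1, ht.1, rfl⟩ ⟨t.2, ht.2, h0.symm⟩) ⟨hs, ht⟩
  rw [hf, hf] at hle
  exact (le_dist_of_mem_frontier_Icc_prod hx hy hz hw hτ).trans hle

lemma mul_max_le_norm_smul_sub_smul {v w u : V} {m : ℝ}
    (hw : m ≤ Metric.infDist w (segment ℝ v u)) (hu : m ≤ Metric.infDist u (segment ℝ v w))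
    {s t : ℝ} (hs : 0 ≤ s) (ht : 0 ≤ t) : m * max s t ≤ ‖s • (w - v) - t • (u - v)‖ := by
  wlog hle : t ≤ s generalizing w u s t
  · rw [max_comm, norm_sub_rev]
    exact this hu hw ht hs (le_of_not_ge hle)
  rcases hs.eq_or_lt with rfl | hpos
  · simp [le_antisymm hle ht]
  have hmem : v + (t / s) • (u - v) ∈ segment ℝ v u := by
    rw [segment_eq_image']
    exact ⟨t / s, ⟨by positivity, (div_le_one hpos).2 hle⟩, rfl⟩
  rw [max_eq_left hle]
  calc m * s ≤ dist w (v + (t / s) • (u - v)) * s := by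
        gcongr
        exact hw.trans (Metric.infDist_le_dist_of_mem hmem)
    _ = ‖s • (w - (v + (t / s) • (u - v)))‖ := by
        rw [norm_smul, Real.norm_of_nonneg hs, dist_eq_norm, mul_comm]
    _ = ‖s • (w - v) - t • (u - v)‖ := by
        rw [← sub_sub, smul_sub s (w - v), smul_smul, mul_div_cancel₀ _ hpos.ne']

lemma linearIndependent_sub_of_not_collinear {x y z : V} (h : ¬Collinear ℝ {x, y, z}) :
    LinearIndependent ℝ ![y - x, z - x] := by
  rw [LinearIndependent.pair_iff' (sub_ne_zero.2 (ne₁₂_of_not_collinear h).symm)]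
  refine fun c hc => h ((collinear_iff_of_mem (p₀ := x) (by simp)).2 ⟨y - x, ?_⟩)
  rintro p (rfl | rfl | rfl)
  · exact ⟨0, by simp⟩
  · exact ⟨1, by simp⟩
  · exact ⟨c, by simp [hc]⟩

lemma eq_of_mem_segment_of_mem_segment {x y z p : V} (h : ¬Collinear ℝ {x, y, z})
    (hy : p ∈ segment ℝ x y) (hz : p ∈ segment ℝ x z) : p = x := by
  have hinter := segment_inter_eq_endpoint_of_linearIndependent_sub ℝ
    (linearIndependent_sub_of_not_collinear h)
  exact hinter.subset ⟨hy, hz⟩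

lemma convexHull_subset_closure_interior (hV : finrank ℝ V = 2) {x y z : V}
    (h : ¬Collinear ℝ {x, y, z}) :
    convexHull ℝ {x, y, z} ⊆ closure (interior (convexHull ℝ {x, y, z})) := by
  have : FiniteDimensional ℝ V := Module.finite_of_finrank_pos (by omega)
  have hspan := (affineIndependent_iff_not_collinear_set.2
    h).affineSpan_eq_top_iff_card_eq_finrank_add_one.2 (by simp [hV])
  rw [Matrix.range_cons, Matrix.range_cons, Matrix.range_cons, Matrix.range_empty,
    Set.union_empty, Set.singleton_union, Set.singleton_union] at hspan
  rw [(convex_convexHull ℝ _).closure_interior_eq_closure_of_nonempty_interior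
    (interior_convexHull_nonempty_iff_affineSpan_eq_top.2 hspan)]
  exact subset_closure

end NormedSpaces

lemma norm_add_mul_norm_sub_eq_two_mul_abs_areaForm {V : Type*} [NormedAddCommGroup V]
    [InnerProductSpace ℝ V] [Fact (finrank ℝ V = 2)] (o : Orientation ℝ V (Fin 2)) {u w : V}
    (hu : ‖u‖ = 1) (hw : ‖w‖ = 1) : ‖u + w‖ * ‖u - w‖ = 2 * |o.areaForm u w| := by
  rw [← sq_eq_sq₀ (by positivity) (by positivity), mul_pow, mul_pow, sq_abs, norm_add_sq_real,
    norm_sub_sq_real, hu, hw]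
  have h := o.inner_sq_add_areaForm_sq u w
  rw [hu, hw] at h
  linear_combination -4 * h

/-- The set `K` contains balls of radius `c * r` within distance `r` of `v`, for all small `r`.
For convex `K` this is a lower bound on its angle at `v`. -/
def IsFatAt (c : ℝ) (K : Set ℂ) (v : ℂ) : Prop :=
  ∀ᶠ r in nhdsWithin (0 : ℝ) (Set.Ioi 0), ∃ y, dist y v ≤ r ∧ Metric.ball y (r * c) ⊆ K

lemma IsFatAt.mono {c c' : ℝ} {K K' : Set ℂ} {v : ℂ} (h : IsFatAt c K v) (hc : c' ≤ c)
    (hK : K ⊆ K') : IsFatAt c' K' v := by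
  filter_upwards [h, self_mem_nhdsWithin] with r ⟨y, hy, hsub⟩ hr
  exact ⟨y, hy, (Metric.ball_subset_ball
    (mul_le_mul_of_nonneg_left hc (Set.mem_Ioi.1 hr).le)).trans (hsub.trans hK)⟩

section FatCorners

attribute [local instance] Complex.finrank_real_complex_fact

local notation "ω" => Complex.orientation.areaForm

lemma areaForm_smul (u w z : ℂ) : ω u w • z = ω z w • u + ω u z • w := by
  apply Complex.ext <;>
    simp only [Complex.areaForm, Complex.real_smul, Complex.mul_re, Complex.mul_im,
      Complex.conj_re, Complex.conj_im, Complex.add_re, Complex.add_im, Complex.ofReal_re,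
      Complex.ofReal_im] <;>
    ring

lemma areaForm_ne_zero {u w : ℂ} (h : LinearIndependent ℝ ![u, w]) : ω u w ≠ 0 := by
  intro h0
  have hrel := areaForm_smul u w (Complex.orientation.rightAngleRotation u)
  rw [h0, zero_smul, Orientation.areaForm_rightAngleRotation_right, eq_comm] at hrel
  have hu := (LinearIndependent.pair_iff.1 h _ _ hrel).2
  exact h.ne_zero 0 (inner_self_eq_zero.1 hu)

lemma mem_convexHull_of_areaForm_nonneg {v w u z : ℂ} (hpos : 0 < ω (w - v) (u - v))
    (hw : 0 ≤ ω (z - v) (u - v)) (hu : 0 ≤ ω (w - v) (z - v))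
    (hz : ‖z - v‖ * (‖w - v‖ + ‖u - v‖) ≤ ω (w - v) (u - v)) : z ∈ convexHull ℝ {v, w, u} := by
  set c := ω (w - v) (u - v)
  have hsum : ω (z - v) (u - v) + ω (w - v) (z - v) ≤ c := by
    linarith [Complex.orientation.areaForm_le (z - v) (u - v),
      Complex.orientation.areaForm_le (w - v) (z - v)]
  refine add_mul_add_mul_mem_convexHull
    (x := (c - (ω (z - v) (u - v) + ω (w - v) (z - v))) / c) (y := ω (z - v) (u - v) / c)
    (w := ω (w - v) (z - v) / c) (div_nonneg (by linarith) hpos.le) (by positivity)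
    (by positivity) (by field_simp; ring) ?_
  have hdec := areaForm_smul (w - v) (u - v) (z - v)
  have hc : (c : ℂ) ≠ 0 := by exact_mod_cast hpos.ne'
  simp only [Complex.real_smul] at hdec
  push_cast
  field_simp
  linear_combination hdec

lemma exists_norm_eq_one_areaForm_eq {a b : ℂ} (ha : ‖a‖ = 1) (hb : ‖b‖ = 1) (hab : 0 < ω a b) :
    ∃ m : ℂ, ‖m‖ = 1 ∧ ω a m = ‖a - b‖ / 2 ∧ ω m b = ‖a - b‖ / 2 := by
  have hprod := norm_add_mul_norm_sub_eq_two_mul_abs_areaForm Complex.orientation ha hb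
  rw [abs_of_pos hab] at hprod
  have hs : ‖a + b‖ ≠ 0 := fun h0 => by
    rw [h0] at hprod
    linarith
  refine ⟨NormedSpace.normalize (a + b), NormedSpace.norm_normalize (norm_ne_zero_iff.1 hs),
    ?_, ?_⟩ <;>
  · simp only [NormedSpace.normalize, map_smul, LinearMap.smul_apply, map_add, LinearMap.add_apply,
      Orientation.areaForm_apply_self, add_zero, zero_add, smul_eq_mul]
    field_simp
    linarith

lemma ball_add_smul_subset_convexHull {v w u m : ℂ} {c r : ℝ} (hr : 0 ≤ r) (hc : c ≤ 1)
    (hm : ‖m‖ ≤ 1) (hpos : 0 < ω (w - v) (u - v)) (hw : ‖w - v‖ * c ≤ ω (w - v) m)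
    (hu : c * ‖u - v‖ ≤ ω m (u - v))
    (hrle : 2 * r * (‖w - v‖ + ‖u - v‖) ≤ ω (w - v) (u - v)) :
    Metric.ball (v + r • m) (r * c) ⊆ convexHull ℝ {v, w, u} := by
  intro z hz
  obtain ⟨e, rfl⟩ : ∃ e, z = v + (r • m + e) := ⟨z - (v + r • m), by ring⟩
  rw [Metric.mem_ball, ← add_assoc, dist_self_add_left] at hz
  refine mem_convexHull_of_areaForm_nonneg hpos ?_ ?_ ?_ <;> rw [add_sub_cancel_left]
  · rw [map_add, LinearMap.add_apply, map_smul, LinearMap.smul_apply, smul_eq_mul]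
    have heu := (abs_le.1 (Complex.orientation.abs_areaForm_le e (u - v))).1
    have hez := mul_le_mul_of_nonneg_right hz.le (norm_nonneg (u - v))
    linarith [mul_le_mul_of_nonneg_left hu hr]
  · rw [map_add, map_smul, smul_eq_mul]
    have hwe := (abs_le.1 (Complex.orientation.abs_areaForm_le (w - v) e)).1
    have hez := mul_le_mul_of_nonneg_left hz.le (norm_nonneg (w - v))
    linarith [mul_le_mul_of_nonneg_left hw hr]
  · have hze : ‖r • m + e‖ ≤ 2 * r := by
      refine (norm_add_le _ _).trans ?_
      rw [norm_smul, Real.norm_of_nonneg hr]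
      linarith [mul_le_mul_of_nonneg_left hm hr, mul_le_mul_of_nonneg_left hc hr]
    exact (mul_le_mul_of_nonneg_right hze (by positivity)).trans hrle

-- The centers of the balls lie on the bisector of the angle at `v`.
lemma isFatAt_convexHull {v w u : ℂ} (h : ¬Collinear ℝ {v, w, u}) :
    IsFatAt (‖NormedSpace.normalize (w - v) - NormedSpace.normalize (u - v)‖ / 2)
      (convexHull ℝ {v, w, u}) v := by
  have hne := areaForm_ne_zero (linearIndependent_sub_of_not_collinear h)
  wlog hpos : 0 < ω (w - v) (u - v) generalizing w u
  · rw [Set.pair_comm, norm_sub_rev]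
    rw [Set.pair_comm] at h
    rw [Complex.orientation.areaForm_swap, neg_ne_zero] at hne
    refine this h hne (lt_of_le_of_ne ?_ hne.symm)
    rw [Complex.orientation.areaForm_swap]
    linarith
  have hw := NormedSpace.norm_normalize (sub_ne_zero.2 (ne₁₂_of_not_collinear h).symm)
  have hu := NormedSpace.norm_normalize (sub_ne_zero.2 (ne₁₃_of_not_collinear h).symm)
  have hwa := NormedSpace.norm_smul_normalize (w - v)
  have hub := NormedSpace.norm_smul_normalize (u - v)
  set a := NormedSpace.normalize (w - v)
  set b := NormedSpace.normalize (u - v)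
  have hab : 0 < ω a b := by
    rw [← hwa, ← hub, map_smul, map_smul, LinearMap.smul_apply, smul_smul, smul_eq_mul] at hpos
    exact pos_of_mul_pos_right hpos (by positivity)
  obtain ⟨m, hm, ham, hmb⟩ := exists_norm_eq_one_areaForm_eq hw hu hab
  have hw0 : 0 < ‖w - v‖ := norm_pos_iff.2 (sub_ne_zero.2 (ne₁₂_of_not_collinear h).symm)
  have hr₀ : 0 < ω (w - v) (u - v) / (2 * (‖w - v‖ + ‖u - v‖)) := by positivity
  filter_upwards [Ioc_mem_nhdsGT hr₀] with r ⟨hr, hr₀⟩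
  rw [le_div_iff₀ (by positivity)] at hr₀
  refine ⟨v + r • m, ?_, ball_add_smul_subset_convexHull hr.le ?_ hm.le hpos ?_ ?_
    (by linarith)⟩
  · rw [dist_self_add_left, norm_smul, hm, mul_one, Real.norm_of_nonneg hr.le]
  · linarith [norm_sub_le a b]
  · conv_rhs => rw [← hwa, map_smul, LinearMap.smul_apply, ham, smul_eq_mul]
  · conv_rhs => rw [← hub, map_smul, hmb, smul_eq_mul, mul_comm]

end FatCorners

end PlaneGeometry

lemma disjoint_segment_of_convexHull_inter_subset {V : Type*} [NormedAddCommGroup V]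
    [NormedSpace ℝ V] {a b c d : V} (hb : ¬Collinear ℝ {a, b, c}) (hd : ¬Collinear ℝ {a, c, d})
    (h : convexHull ℝ {a, b, c} ∩ convexHull ℝ {a, c, d} ⊆ segment ℝ a c) :
    Disjoint (segment ℝ a b) (segment ℝ c d) := by
  rw [Set.disjoint_left]
  intro p hab hcd
  have hac : p ∈ segment ℝ a c :=
    h ⟨segment_subset_convexHull (by simp) (by simp) hab,
      segment_subset_convexHull (by simp) (by simp) hcd⟩
  have hpa := eq_of_mem_segment_of_mem_segment hb hab hac
  rw [Set.insert_comm, Set.pair_comm] at hd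
  have hpc := eq_of_mem_segment_of_mem_segment hd hcd (by rwa [segment_symm])
  exact ne₁₃_of_not_collinear hb (hpa.symm.trans hpc)

namespace Element

variable {E : Element} {A : ℝ}

/-- The length of the longest side. -/
def size : Element → ℝ
  | tri v => Finset.univ.sup' Finset.univ_nonempty fun i => dist (v i) (v (i + 1))
  | quad v => Finset.univ.sup' Finset.univ_nonempty fun i => dist (v i) (v (i + 1))

lemma IsSide.dist_le_size {x y : ℂ} (h : E.IsSide x y) : dist x y ≤ E.size := by
  cases E with
  | tri v | quad v =>
    obtain ⟨i, h⟩ := h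
    have hi := Finset.le_sup' (fun i => dist (v i) (v (i + 1))) (Finset.mem_univ i)
    obtain ⟨rfl, rfl⟩ | ⟨rfl, rfl⟩ := h
    · exact hi
    · rwa [dist_comm]

lemma exists_isSide_dist_eq_size (E : Element) : ∃ x y, E.IsSide x y ∧ dist x y = E.size := by
  cases E with
  | tri v | quad v =>
    obtain ⟨i, -, hi⟩ := Finset.exists_mem_eq_sup' Finset.univ_nonempty
      fun i => dist (v i) (v (i + 1))
    exact ⟨_, _, ⟨i, Or.inl ⟨rfl, rfl⟩⟩, hi.symm⟩

lemma IsSide.symm {x y : ℂ} (h : E.IsSide x y) : E.IsSide y x := by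
  cases E <;> exact h.imp fun i => Or.symm

lemma IsSide.mem_left {x y : ℂ} (h : E.IsSide x y) : x ∈ E.vertices := by
  cases E <;> obtain ⟨i, ⟨rfl, rfl⟩ | ⟨rfl, rfl⟩⟩ := h <;> exact ⟨_, rfl⟩

lemma IsSide.mem_right {x y : ℂ} (h : E.IsSide x y) : y ∈ E.vertices := h.symm.mem_left

lemma tri_injective {v : Fin 3 → ℂ} (h : (tri v).IsProper) : Function.Injective v := by
  have hv : ![v 0, v 1, v 2] = v := by
    ext i
    fin_cases i <;> rfl
  exact hv ▸ AffineIndependent.injective h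

lemma quad_injective {v : Fin 4 → ℂ} (h : (quad v).IsProper) : Function.Injective v := by
  obtain ⟨h₁, h₃, hinter⟩ := h
  rw [affineIndependent_iff_not_collinear_set] at h₁ h₃
  have h01 := ne₁₂_of_not_collinear h₁
  have h02 := ne₁₃_of_not_collinear h₁
  have h12 := ne₂₃_of_not_collinear h₁
  have h03 := ne₁₃_of_not_collinear h₃
  have h23 := ne₂₃_of_not_collinear h₃
  have h13 : v 1 ≠ v 3 := by
    intro h13
    have hdisj := disjoint_segment_of_convexHull_inter_subset h₁ h₃ hinter.subset
    exact Set.disjoint_left.1 hdisj (right_mem_segment ℝ _ _) (h13 ▸ right_mem_segment ℝ _ _)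
  intro i j hij
  fin_cases i <;> fin_cases j <;> first | rfl | exact absurd hij ‹_› | exact absurd hij.symm ‹_›

lemma IsSide.ne (hp : E.IsProper) {x y : ℂ} (h : E.IsSide x y) : x ≠ y := by
  cases E with
  | tri v => obtain ⟨i, ⟨rfl, rfl⟩ | ⟨rfl, rfl⟩⟩ := h <;> simp [(tri_injective hp).eq_iff]
  | quad v => obtain ⟨i, ⟨rfl, rfl⟩ | ⟨rfl, rfl⟩⟩ := h <;> simp [(quad_injective hp).eq_iff]

lemma IsSide.exists_isSide_ne (hp : E.IsProper) {x y : ℂ} (h : E.IsSide x y) :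
    ∃ u, E.IsSide y u ∧ u ≠ x := by
  cases E with
  | tri v =>
    obtain ⟨i, ⟨rfl, rfl⟩ | ⟨rfl, rfl⟩⟩ := h
    · exact ⟨v (i + 1 + 1), ⟨i + 1, Or.inl ⟨rfl, rfl⟩⟩, (tri_injective hp).ne (by grind)⟩
    · exact ⟨v (i - 1), ⟨i - 1, Or.inr ⟨rfl, by rw [sub_add_cancel]⟩⟩,
        (tri_injective hp).ne (by grind)⟩
  | quad v =>
    obtain ⟨i, ⟨rfl, rfl⟩ | ⟨rfl, rfl⟩⟩ := h
    · exact ⟨v (i + 1 + 1), ⟨i + 1, Or.inl ⟨rfl, rfl⟩⟩, (quad_injective hp).ne (by grind)⟩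
    · exact ⟨v (i - 1), ⟨i - 1, Or.inr ⟨rfl, by rw [sub_add_cancel]⟩⟩,
        (quad_injective hp).ne (by grind)⟩

lemma size_pos (hp : E.IsProper) : 0 < E.size := by
  obtain ⟨x, y, h, hxy⟩ := E.exists_isSide_dist_eq_size
  exact hxy ▸ dist_pos.2 (h.ne hp)

lemma quad_disjoint_segment {v : Fin 4 → ℂ} (h : (quad v).IsProper) (i : Fin 4) :
    Disjoint (segment ℝ (v i) (v (i + 1))) (segment ℝ (v (i + 2)) (v (i + 3))) := by
  obtain ⟨h₁, h₃, hinter⟩ := h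
  rw [affineIndependent_iff_not_collinear_set] at h₁ h₃
  have h01 := disjoint_segment_of_convexHull_inter_subset h₁ h₃ hinter.subset
  have h12 : Disjoint (segment ℝ (v 2) (v 1)) (segment ℝ (v 0) (v 3)) := by
    rw [Set.pair_comm, Set.insert_comm, Set.pair_comm] at h₁ hinter
    rw [Set.insert_comm] at h₃
    rw [Set.insert_comm (v 0) (v 2)] at hinter
    exact disjoint_segment_of_convexHull_inter_subset h₁ h₃ (segment_symm ℝ (v 0) _ ▸ hinter.subset)
  rw [segment_symm, segment_symm ℝ (v 0)] at h12
  fin_cases i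
  exacts [h01, h12, h01.symm, h12.symm]

lemma IsSide.disjoint_segment (hp : E.IsProper) {x y z w : ℂ} (h : E.IsSide x y)
    (h' : E.IsSide z w) (hxz : x ≠ z) (hxw : x ≠ w) (hyz : y ≠ z) (hyw : y ≠ w) :
    Disjoint (segment ℝ x y) (segment ℝ z w) := by
  cases E with
  | tri v =>
    obtain ⟨i, hi⟩ := h
    obtain ⟨j, hj⟩ := h'
    have hij : j = i ∨ j = i + 1 ∨ i = j + 1 := by
      clear hi hj
      decide +revert
    rcases hij with rfl | rfl | rfl <;> grind
  | quad v =>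
    obtain ⟨i, hi⟩ := h
    obtain ⟨j, hj⟩ := h'
    have hij : j = i ∨ j = i + 1 ∨ i = j + 1 ∨ j = i + 2 := by
      clear hi hj
      decide +revert
    rcases hij with rfl | rfl | rfl | rfl
    · grind
    · grind
    · grind
    · have hdisj := quad_disjoint_segment hp i
      rw [show i + 2 + 1 = i + 3 by grind] at hj
      rcases hi with ⟨rfl, rfl⟩ | ⟨rfl, rfl⟩ <;> rcases hj with ⟨rfl, rfl⟩ | ⟨rfl, rfl⟩ <;>
        simpa only [segment_symm ℝ] using hdisj

lemma isClosed_region (E : Element) : IsClosed E.region := by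
  have h : ∀ x y z : ℂ, IsClosed (convexHull ℝ {x, y, z}) := fun x y z =>
    (Set.toFinite {x, y, z}).isClosed_convexHull ℝ
  cases E with
  | tri v => exact h _ _ _
  | quad v => exact (h _ _ _).union (h _ _ _)

lemma region_subset_closedBall (E : Element) :
    ∃ c, E.region ⊆ Metric.closedBall c (2 * E.size) := by
  cases E with
  | tri v =>
    have h01 : dist (v 0) (v 1) ≤ (tri v).size := IsSide.dist_le_size ⟨0, Or.inl ⟨rfl, rfl⟩⟩
    have h20 : dist (v 2) (v 0) ≤ (tri v).size := IsSide.dist_le_size ⟨2, Or.inl ⟨rfl, rfl⟩⟩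
    have h0 : 0 ≤ (tri v).size := dist_nonneg.trans h01
    refine ⟨v 0, convexHull_min ?_ (convex_closedBall _ _)⟩
    rintro _ (rfl | rfl | rfl) <;> rw [Metric.mem_closedBall]
    · rw [dist_self]
      positivity
    · rw [dist_comm]
      linarith
    · linarith
  | quad v =>
    have h01 : dist (v 0) (v 1) ≤ (quad v).size := IsSide.dist_le_size ⟨0, Or.inl ⟨rfl, rfl⟩⟩
    have h12 : dist (v 1) (v 2) ≤ (quad v).size := IsSide.dist_le_size ⟨1, Or.inl ⟨rfl, rfl⟩⟩
    have h30 : dist (v 3) (v 0) ≤ (quad v).size := IsSide.dist_le_size ⟨3, Or.inl ⟨rfl, rfl⟩⟩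
    have h0 : 0 ≤ (quad v).size := dist_nonneg.trans h01
    refine ⟨v 0, region_quad_subset (convex_closedBall _ _) fun i => ?_⟩
    rw [Metric.mem_closedBall, dist_comm]
    rcases fin_four_cases 0 i with rfl | rfl | rfl | rfl
    · rw [dist_self]
      positivity
    · exact h01.trans (by linarith)
    · exact (dist_triangle _ (v 1) _).trans (by rw [two_mul]; exact add_le_add h01 h12)
    · rw [dist_comm]
      exact h30.trans (by linarith)

lemma dist_le_of_mem_region {p q : ℂ} (hp : p ∈ E.region) (hq : q ∈ E.region) :
    dist p q ≤ 4 * E.size := by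
  obtain ⟨c, hc⟩ := E.region_subset_closedBall
  linarith [dist_triangle_right p q c, Metric.mem_closedBall.1 (hc hp),
    Metric.mem_closedBall.1 (hc hq)]

lemma region_subset_closure_interior (hp : E.IsProper) :
    E.region ⊆ closure (interior E.region) := by
  have h : ∀ x y z : ℂ, AffineIndependent ℝ ![x, y, z] →
      convexHull ℝ {x, y, z} ⊆ closure (interior (convexHull ℝ {x, y, z})) := fun x y z hxyz =>
    convexHull_subset_closure_interior Complex.finrank_real_complex
      (affineIndependent_iff_not_collinear_set.1 hxyz)
  cases E with
  | tri v => exact h _ _ _ hp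
  | quad v =>
    exact Set.union_subset
      ((h _ _ _ hp.1).trans (closure_mono (interior_mono Set.subset_union_left)))
      ((h _ _ _ hp.2.1).trans (closure_mono (interior_mono Set.subset_union_right)))

namespace AspectRatioLE

lemma size_le_mul_infDist (hA : E.AspectRatioLE A) {z w v : ℂ} (h : E.IsSide z w)
    (hv : v ∈ E.vertices) (hz : v ≠ z) (hw : v ≠ w) :
    E.size ≤ A * Metric.infDist v (segment ℝ z w) := by
  obtain ⟨x, y, hxy, heq⟩ := E.exists_isSide_dist_eq_size
  exact heq ▸ hA x y hxy z w h v hv hz hw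

lemma mono (hA : E.AspectRatioLE A) {B : ℝ} (hAB : A ≤ B) : E.AspectRatioLE B :=
  fun x y hs z w h v hv hz hw => (hA x y hs z w h v hv hz hw).trans
    (mul_le_mul_of_nonneg_right hAB Metric.infDist_nonneg)

lemma size_le_mul_dist (hA : E.AspectRatioLE A) (hp : E.IsProper) (hA0 : 0 < A)
    {x y : ℂ} (h : E.IsSide x y) : E.size ≤ A * dist x y := by
  obtain ⟨u, hu, hux⟩ := h.exists_isSide_ne hp
  refine (hA.size_le_mul_infDist hu h.mem_left (h.ne hp) hux.symm).trans ?_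
  gcongr
  exact Metric.infDist_le_dist_of_mem (left_mem_segment ℝ y u)

lemma size_div_le_infDist (hA : E.AspectRatioLE A) (hA0 : 0 < A) {z w v : ℂ} (h : E.IsSide z w)
    (hv : v ∈ E.vertices) (hz : v ≠ z) (hw : v ≠ w) :
    E.size / A ≤ Metric.infDist v (segment ℝ z w) :=
  (div_le_iff₀' hA0).2 (hA.size_le_mul_infDist h hv hz hw)

lemma one_div_le_norm_normalize_sub (hA : E.AspectRatioLE A) (hp : E.IsProper) (hA0 : 0 < A)
    {v w u : ℂ} (hw : E.IsSide v w) (hu : E.IsSide v u) (hwu : w ≠ u) :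
    1 / A ≤ ‖NormedSpace.normalize (w - v) - NormedSpace.normalize (u - v)‖ := by
  have hsize : 0 < E.size := size_pos hp
  have hw0 : 0 < ‖w - v‖ := norm_pos_iff.2 (sub_ne_zero.2 (hw.ne hp).symm)
  have hwle : ‖w - v‖ ≤ E.size := by
    rw [← dist_eq_norm, dist_comm]
    exact hw.dist_le_size
  calc 1 / A = E.size / A * E.size⁻¹ := by field_simp
    _ ≤ E.size / A * max ‖w - v‖⁻¹ ‖u - v‖⁻¹ := by
        gcongr
        exact le_max_of_le_left (by gcongr)
    _ ≤ ‖‖w - v‖⁻¹ • (w - v) - ‖u - v‖⁻¹ • (u - v)‖ :=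
        mul_max_le_norm_smul_sub_smul
          (hA.size_div_le_infDist hA0 hu hw.mem_right (hw.ne hp).symm hwu)
          (hA.size_div_le_infDist hA0 hw hu.mem_right (hu.ne hp).symm hwu.symm)
          (by positivity) (by positivity)

lemma isFatAt_of_triangle (hA : E.AspectRatioLE A) (hp : E.IsProper) (hA0 : 0 < A) {v w u : ℂ}
    (hw : E.IsSide v w) (hu : E.IsSide v u) (h : ¬Collinear ℝ {v, w, u})
    (hsub : convexHull ℝ {v, w, u} ⊆ E.region) : IsFatAt (1 / (4 * A)) E.region v := by
  refine (isFatAt_convexHull h).mono ?_ hsub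
  have hsep := hA.one_div_le_norm_normalize_sub hp hA0 hw hu (ne₂₃_of_not_collinear h)
  have hA' : 1 / (4 * A) = 1 / A / 4 := by field_simp
  linarith [one_div_pos.2 hA0]

-- The diagonal `v d` leaves at least half of the angle at `v` on one of its sides.
lemma isFatAt_of_diagonal (hA : E.AspectRatioLE A) (hp : E.IsProper) (hA0 : 0 < A)
    {v w d u : ℂ} (hw : E.IsSide v w) (hu : E.IsSide v u) (hwu : w ≠ u)
    (hwd : ¬Collinear ℝ {v, w, d}) (hdu : ¬Collinear ℝ {v, d, u})
    (hsub : convexHull ℝ {v, w, d} ∪ convexHull ℝ {v, d, u} ⊆ E.region) :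
    IsFatAt (1 / (4 * A)) E.region v := by
  have hsep := hA.one_div_le_norm_normalize_sub hp hA0 hw hu hwu
  have htri := norm_sub_le_norm_sub_add_norm_sub (NormedSpace.normalize (w - v))
    (NormedSpace.normalize (d - v)) (NormedSpace.normalize (u - v))
  have hA' : 1 / (4 * A) = 1 / A / 4 := by field_simp
  obtain ⟨hsub₁, hsub₂⟩ := Set.union_subset_iff.1 hsub
  rcases le_total (1 / A / 2)
    ‖NormedSpace.normalize (w - v) - NormedSpace.normalize (d - v)‖ with h | h
  · exact (isFatAt_convexHull hwd).mono (by linarith) hsub₁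
  · exact (isFatAt_convexHull hdu).mono (by linarith) hsub₂

lemma isFatAt_region (hA : E.AspectRatioLE A) (hp : E.IsProper) (hA0 : 0 < A) {v : ℂ}
    (hv : v ∈ E.vertices) : IsFatAt (1 / (4 * A)) E.region v := by
  cases E with
  | tri v =>
    have hset : ∀ i : Fin 3, ({v i, v (i + 1), v (i + 2)} : Set ℂ) = {v 0, v 1, v 2} := by
      intro i
      ext
      fin_cases i <;> simp <;> tauto
    obtain ⟨i, rfl⟩ := hv
    refine hA.isFatAt_of_triangle hp hA0 (w := v (i + 1)) (u := v (i + 2))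
      ⟨i, Or.inl ⟨rfl, rfl⟩⟩ ⟨i + 2, Or.inr ⟨rfl, by congr; grind⟩⟩ ?_ ?_
    · rw [hset]
      exact affineIndependent_iff_not_collinear_set.1 hp
    · rw [hset]
      exact subset_rfl
  | quad v =>
    have h13 : v 1 ≠ v 3 := (quad_injective hp).ne (by decide)
    have h₁ := affineIndependent_iff_not_collinear_set.1 hp.1
    have h₃ := affineIndependent_iff_not_collinear_set.1 hp.2.1
    have h10 : ({v 1, v 0, v 2} : Set ℂ) = {v 0, v 1, v 2} := Set.insert_comm _ _ _
    have h21 : ({v 2, v 1, v 0} : Set ℂ) = {v 0, v 1, v 2} := by grind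
    have h20 : ({v 2, v 0, v 3} : Set ℂ) = {v 0, v 2, v 3} := Set.insert_comm _ _ _
    have h32 : ({v 3, v 0, v 2} : Set ℂ) = {v 0, v 2, v 3} := by grind
    obtain ⟨i, rfl⟩ := hv
    rcases fin_four_cases 0 i with rfl | rfl | rfl | rfl
    · exact hA.isFatAt_of_diagonal hp hA0 ⟨0, Or.inl ⟨rfl, rfl⟩⟩ ⟨3, Or.inr ⟨rfl, rfl⟩⟩ h13 h₁ h₃
        subset_rfl
    · exact hA.isFatAt_of_triangle hp hA0 ⟨0, Or.inr ⟨rfl, rfl⟩⟩ ⟨1, Or.inl ⟨rfl, rfl⟩⟩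
        (h10 ▸ h₁) (h10 ▸ Set.subset_union_left)
    · exact hA.isFatAt_of_diagonal hp hA0 ⟨1, Or.inr ⟨rfl, rfl⟩⟩ ⟨2, Or.inl ⟨rfl, rfl⟩⟩ h13
        (h21 ▸ h₁) (h20 ▸ h₃) (h21 ▸ h20 ▸ subset_rfl)
    · exact hA.isFatAt_of_triangle hp hA0 ⟨3, Or.inl ⟨rfl, rfl⟩⟩ ⟨2, Or.inr ⟨rfl, rfl⟩⟩
        (h32 ▸ h₃) (h32 ▸ Set.subset_union_right)

end AspectRatioLE

end Element

section EdgeInterp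

variable {V : Type*} [NormedAddCommGroup V]

/-- The linear interpolation along the segment from `x` to `y` of the values of `f` at its ends. It
is written symmetrically in the two ends, and it is `0` if they coincide. -/
def edgeInterp (f : V → ℝ) (x y p : V) : ℝ :=
  (f x * dist p y + f y * dist p x) / dist x y

lemma edgeInterp_comm (f : V → ℝ) (x y p : V) : edgeInterp f x y p = edgeInterp f y x p := by
  rw [edgeInterp, edgeInterp, dist_comm x y, add_comm]

lemma edgeInterp_congr {f g : V → ℝ} {x y : V} (hx : f x = g x) (hy : f y = g y) (p : V) :
    edgeInterp f x y p = edgeInterp g x y p := by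
  rw [edgeInterp, edgeInterp, hx, hy]

variable [NormedSpace ℝ V]

lemma edgeInterp_add_smul (f : V → ℝ) {x y : V} (hxy : x ≠ y) {t : ℝ}
    (ht : t ∈ Set.Icc (0 : ℝ) 1) : edgeInterp f x y (x + t • (y - x)) = f x + t * (f y - f x) := by
  have hd : dist x y ≠ 0 := dist_ne_zero.2 hxy
  have h : x + t • (y - x) = AffineMap.lineMap x y t := by
    rw [AffineMap.lineMap_apply_module', add_comm]
  rw [edgeInterp, h, dist_lineMap_left, dist_lineMap_right, Real.norm_of_nonneg ht.1,
    Real.norm_of_nonneg (sub_nonneg.2 ht.2)]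
  field_simp
  ring

lemma edgeInterp_mem_Icc {f : V → ℝ} {x y p : V} (hxy : x ≠ y) {l u : ℝ}
    (hx : f x ∈ Set.Icc l u) (hy : f y ∈ Set.Icc l u) (hp : p ∈ segment ℝ x y) :
    edgeInterp f x y p ∈ Set.Icc l u := by
  rw [segment_eq_image'] at hp
  obtain ⟨t, ht, rfl⟩ := hp
  rw [edgeInterp_add_smul f hxy ht]
  exact (convex_Icc l u).add_smul_sub_mem hx hy ht

lemma abs_edgeInterp_sub_le {f : V → ℝ} {x y p q : V} (hxy : x ≠ y) {L : ℝ}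
    (hf : |f y - f x| ≤ L * dist x y) (hp : p ∈ segment ℝ x y) (hq : q ∈ segment ℝ x y) :
    |edgeInterp f x y p - edgeInterp f x y q| ≤ L * dist p q := by
  rw [segment_eq_image'] at hp hq
  obtain ⟨s, hs, rfl⟩ := hp
  obtain ⟨t, ht, rfl⟩ := hq
  rw [edgeInterp_add_smul f hxy hs, edgeInterp_add_smul f hxy ht, add_sub_add_left_eq_sub,
    ← sub_mul, abs_mul]
  calc |s - t| * |f y - f x| ≤ |s - t| * (L * dist x y) := by gcongr
    _ = L * dist (x + s • (y - x)) (x + t • (y - x)) := by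
        rw [dist_comm x y, dist_eq_norm y, dist_add_left, dist_eq_norm, ← sub_smul, norm_smul,
          Real.norm_eq_abs]
        ring

lemma abs_edgeInterp_sub_edgeInterp_le_of_corner {f : V → ℝ} {v w u p q : V} (hvw : v ≠ w)
    (hvu : v ≠ u) {m L : ℝ} (hL : 0 ≤ L) (hw : m ≤ Metric.infDist w (segment ℝ v u))
    (hu : m ≤ Metric.infDist u (segment ℝ v w)) (hfw : |f w - f v| ≤ L * m)
    (hfu : |f u - f v| ≤ L * m) (hp : p ∈ segment ℝ v w) (hq : q ∈ segment ℝ v u) :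
    |edgeInterp f v w p - edgeInterp f v u q| ≤ 2 * L * dist p q := by
  rw [segment_eq_image'] at hp hq
  obtain ⟨s, hs, rfl⟩ := hp
  obtain ⟨t, ht, rfl⟩ := hq
  have : 0 ≤ L * m := (abs_nonneg _).trans hfw
  rw [edgeInterp_add_smul f hvw hs, edgeInterp_add_smul f hvu ht, add_sub_add_left_eq_sub]
  calc |s * (f w - f v) - t * (f u - f v)| ≤ |s * (f w - f v)| + |t * (f u - f v)| := abs_sub _ _
    _ ≤ max s t * (L * m) + max s t * (L * m) := by
        rw [abs_mul, abs_mul, abs_of_nonneg hs.1, abs_of_nonneg ht.1]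
        gcongr
        exacts [le_max_of_le_left hs.1, le_max_left _ _, le_max_of_le_left hs.1, le_max_right _ _]
    _ = 2 * L * (m * max s t) := by ring
    _ ≤ 2 * L * dist (v + s • (w - v)) (v + t • (u - v)) := by
        gcongr
        rw [dist_add_left, dist_eq_norm]
        exact mul_max_le_norm_smul_sub_smul hw hu hs.1 ht.1

end EdgeInterp

namespace Element

variable {E : Element} {A : ℝ}

/-- The union of the sides, that is, the boundary of the region of a proper element. -/
def sides (E : Element) : Set ℂ := {p | ∃ x y, E.IsSide x y ∧ p ∈ segment ℝ x y}

namespace AspectRatioLE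

lemma abs_edgeInterp_sub_edgeInterp_le_of_left (hA : E.AspectRatioLE A) (hp : E.IsProper)
    (hA0 : 0 < A) {f : ℂ → ℝ} (hf : ∀ v ∈ E.vertices, f v ∈ Set.Icc 0 E.size) {v w u p q : ℂ}
    (hw : E.IsSide v w) (hu : E.IsSide v u) (hpw : p ∈ segment ℝ v w) (hqu : q ∈ segment ℝ v u) :
    |edgeInterp f v w p - edgeInterp f v u q| ≤ 2 * A * dist p q := by
  have hdiff : ∀ {x}, E.IsSide v x → |f x - f v| ≤ E.size := fun h =>
    abs_sub_le_of_nonneg_of_le (hf _ h.mem_right).1 (hf _ h.mem_right).2 (hf _ h.mem_left).1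
      (hf _ h.mem_left).2
  rcases eq_or_ne w u with rfl | hwu
  · refine (abs_edgeInterp_sub_le (hw.ne hp)
      ((hdiff hw).trans (hA.size_le_mul_dist hp hA0 hw)) hpw hqu).trans ?_
    rw [two_mul]
    gcongr
    exact le_add_of_nonneg_left hA0.le
  · have hAm : A * (E.size / A) = E.size := mul_div_cancel₀ _ hA0.ne'
    exact abs_edgeInterp_sub_edgeInterp_le_of_corner (hw.ne hp) (hu.ne hp) hA0.le
      (hA.size_div_le_infDist hA0 hu hw.mem_right (hw.ne hp).symm hwu)
      (hA.size_div_le_infDist hA0 hw hu.mem_right (hu.ne hp).symm hwu.symm)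
      ((hdiff hw).trans_eq hAm.symm) ((hdiff hu).trans_eq hAm.symm) hpw hqu

lemma size_div_le_dist (hA : E.AspectRatioLE A) (hp : E.IsProper) (hA0 : 0 < A)
    {x y z w p q : ℂ} (h : E.IsSide x y) (h' : E.IsSide z w) (hxz : x ≠ z) (hxw : x ≠ w)
    (hyz : y ≠ z) (hyw : y ≠ w) (hpxy : p ∈ segment ℝ x y) (hqzw : q ∈ segment ℝ z w) :
    E.size / A ≤ dist p q :=
  le_dist_of_disjoint_segment Complex.finrank_real_complex
    (h.disjoint_segment hp h' hxz hxw hyz hyw)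
    (hA.size_div_le_infDist hA0 h' h.mem_left hxz hxw)
    (hA.size_div_le_infDist hA0 h' h.mem_right hyz hyw)
    (hA.size_div_le_infDist hA0 h h'.mem_left hxz.symm hyz.symm)
    (hA.size_div_le_infDist hA0 h h'.mem_right hxw.symm hyw.symm) hpxy hqzw

lemma abs_edgeInterp_sub_edgeInterp_le (hA : E.AspectRatioLE A) (hp : E.IsProper) (hA0 : 0 < A)
    {f : ℂ → ℝ} (hf : ∀ v ∈ E.vertices, f v ∈ Set.Icc 0 E.size) {x y z w p q : ℂ}
    (h : E.IsSide x y) (h' : E.IsSide z w) (hpxy : p ∈ segment ℝ x y) (hqzw : q ∈ segment ℝ z w) :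
    |edgeInterp f x y p - edgeInterp f z w q| ≤ 2 * A * dist p q := by
  by_cases hxz : x = z
  · subst hxz
    exact hA.abs_edgeInterp_sub_edgeInterp_le_of_left hp hA0 hf h h' hpxy hqzw
  by_cases hxw : x = w
  · subst hxw
    rw [segment_symm] at hqzw
    rw [edgeInterp_comm f z]
    exact hA.abs_edgeInterp_sub_edgeInterp_le_of_left hp hA0 hf h h'.symm hpxy hqzw
  by_cases hyz : y = z
  · subst hyz
    rw [segment_symm] at hpxy
    rw [edgeInterp_comm f x]
    exact hA.abs_edgeInterp_sub_edgeInterp_le_of_left hp hA0 hf h.symm h' hpxy hqzw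
  by_cases hyw : y = w
  · subst hyw
    rw [segment_symm] at hpxy hqzw
    rw [edgeInterp_comm f x, edgeInterp_comm f z]
    exact hA.abs_edgeInterp_sub_edgeInterp_le_of_left hp hA0 hf h.symm h'.symm hpxy hqzw
  have hdist := hA.size_div_le_dist hp hA0 h h' hxz hxw hyz hyw hpxy hqzw
  rw [div_le_iff₀' hA0] at hdist
  have hx := edgeInterp_mem_Icc (h.ne hp) (hf x h.mem_left) (hf y h.mem_right) hpxy
  have hz := edgeInterp_mem_Icc (h'.ne hp) (hf z h'.mem_left) (hf w h'.mem_right) hqzw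
  refine (abs_sub_le_of_nonneg_of_le hx.1 hx.2 hz.1 hz.2).trans ?_
  linarith [size_pos hp]

lemma exists_lipschitzWith_eq_edgeInterp (hA : E.AspectRatioLE A) (hp : E.IsProper) (hA0 : 0 < A)
    {f : ℂ → ℝ} {l : ℝ} (hl : 0 ≤ l) (hf : ∀ v ∈ E.vertices, f v ∈ Set.Icc l E.size) :
    ∃ G : ℂ → ℝ, LipschitzWith (2 * A).toNNReal G ∧ (∀ p, G p ∈ Set.Icc l E.size) ∧
      ∀ x y p, E.IsSide x y → p ∈ segment ℝ x y → G p = edgeInterp f x y p := by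
  have hf0 : ∀ v ∈ E.vertices, f v ∈ Set.Icc 0 E.size := fun v hv =>
    ⟨hl.trans (hf v hv).1, (hf v hv).2⟩
  have hls : l ≤ E.size := by
    obtain ⟨x, y, h, -⟩ := E.exists_isSide_dist_eq_size
    exact (hf x h.mem_left).1.trans (hf x h.mem_left).2
  have hval : ∀ p ∈ E.sides, ∃ g : ℝ, ∀ x y, E.IsSide x y → p ∈ segment ℝ x y →
      g = edgeInterp f x y p := by
    rintro p ⟨x, y, h, hpxy⟩
    refine ⟨edgeInterp f x y p, fun z w h' hpzw => ?_⟩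
    have heq := hA.abs_edgeInterp_sub_edgeInterp_le hp hA0 hf0 h h' hpxy hpzw
    rw [dist_self, mul_zero] at heq
    exact sub_eq_zero.1 (abs_nonpos_iff.1 heq)
  choose! g hg using hval
  have hlip : LipschitzOnWith (2 * A).toNNReal g E.sides := by
    refine LipschitzOnWith.of_dist_le_mul ?_
    rintro p ⟨x, y, h, hpxy⟩ q ⟨z, w, h', hqzw⟩
    rw [hg p ⟨x, y, h, hpxy⟩ x y h hpxy, hg q ⟨z, w, h', hqzw⟩ z w h' hqzw, Real.dist_eq,
      Real.coe_toNNReal _ (by positivity)]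
    exact hA.abs_edgeInterp_sub_edgeInterp_le hp hA0 hf0 h h' hpxy hqzw
  obtain ⟨G, hG, hgG⟩ := hlip.extend_real
  refine ⟨fun p => max l (min E.size (G p)), (hG.const_min _).const_max _,
    fun p => ⟨le_max_left _ _, max_le hls (min_le_left _ _)⟩, fun x y p h hpxy => ?_⟩
  have hmem := edgeInterp_mem_Icc (h.ne hp) (hf x h.mem_left) (hf y h.mem_right) hpxy
  have hGp : G p = edgeInterp f x y p :=
    (hgG ⟨x, y, h, hpxy⟩).symm.trans (hg p ⟨x, y, h, hpxy⟩ x y h hpxy)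
  simp only [hGp]
  rw [min_eq_right hmem.2, max_eq_right hmem.1]

end AspectRatioLE

lemma finite_vertices (E : Element) : E.vertices.Finite := by
  cases E <;> exact Set.finite_range _

lemma exists_isSide {v : ℂ} (hv : v ∈ E.vertices) : ∃ w, E.IsSide v w := by
  cases E <;> obtain ⟨i, rfl⟩ := hv <;> exact ⟨_, i, Or.inl ⟨rfl, rfl⟩⟩

end Element

lemma dimH_segment_le {V : Type*} [NormedAddCommGroup V] [NormedSpace ℝ V] (x y : V) :
    dimH (segment ℝ x y) ≤ 1 := by
  have hdiff : ContDiff ℝ 1 fun t : ℝ => x + t • (y - x) := by fun_prop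
  rw [segment_eq_image']
  exact (dimH_mono (Set.image_subset_range _ _)).trans (hdiff.dimH_range_le.trans_eq (by simp))

lemma Element.dimH_sides_le (E : Element) : dimH E.sides ≤ 1 := by
  have hsub : E.sides ⊆ ⋃ q ∈ E.vertices ×ˢ E.vertices, segment ℝ q.1 q.2 := by
    rintro p ⟨x, y, h, hp⟩
    exact Set.mem_biUnion (x := (x, y)) ⟨h.mem_left, h.mem_right⟩ hp
  refine (dimH_mono hsub).trans ?_
  rw [dimH_bUnion (E.finite_vertices.prod E.finite_vertices).countable]
  exact iSup₂_le fun q _ => dimH_segment_le _ _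

lemma dense_compl_of_dimH_le_one {s : Set ℂ} (hs : dimH s ≤ 1) : Dense sᶜ := by
  refine dense_compl_of_dimH_lt_finrank (hs.trans_lt ?_)
  rw [Complex.finrank_real_complex]
  norm_num

section LipschitzPaths

lemma dist_le_mul_sub_of_eventually_dist_le {X : Type*} [PseudoMetricSpace X] {g : ℝ → X}
    {a b L : ℝ} (hab : a ≤ b) (h : ∀ t ∈ Set.Icc a b,
      ∀ᶠ s in nhdsWithin t (Set.Icc a b), dist (g s) (g t) ≤ L * dist s t) :
    dist (g a) (g b) ≤ L * (b - a) := by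
  have hcont : ContinuousOn g (Set.Icc a b) := fun t ht => by
    refine tendsto_iff_dist_tendsto_zero.2
      (squeeze_zero' (Filter.Eventually.of_forall fun _ => dist_nonneg) (h t ht) ?_)
    have hlim : Continuous fun s : ℝ => L * dist s t := by fun_prop
    simpa using (hlim.tendsto t).mono_left nhdsWithin_le_nhds
  have hclosed : IsClosed ({t | dist (g a) (g t) ≤ L * (t - a)} ∩ Set.Icc a b) := by
    rw [Set.inter_comm]
    exact isClosed_Icc.isClosed_le (f := fun t => dist (g a) (g t)) (g := fun t => L * (t - a))
      (by fun_prop) (by fun_prop)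
  refine hclosed.Icc_subset_of_forall_mem_nhdsWithin (by simp) ?_ ⟨hab, le_rfl⟩
  rintro t ⟨ht, htI⟩
  have hle : nhdsWithin t (Set.Ioi t) ≤ nhdsWithin t (Set.Icc a b) :=
    nhdsWithin_le_of_mem (Filter.mem_of_superset (Ioc_mem_nhdsGT htI.2)
      fun s hs => ⟨htI.1.trans hs.1.le, hs.2⟩)
  filter_upwards [hle (h t ⟨htI.1, htI.2.le⟩), self_mem_nhdsWithin] with s hs hts
  rw [Real.dist_eq, abs_of_pos (sub_pos.2 hts), dist_comm] at hs
  calc dist (g a) (g s) ≤ dist (g a) (g t) + dist (g t) (g s) := dist_triangle _ _ _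
    _ ≤ L * (t - a) + L * (s - t) := add_le_add ht hs
    _ = L * (s - a) := by ring

lemma dist_le_of_piecewise_lipschitz {ι X Y : Type*} [Finite ι] [PseudoMetricSpace X]
    [PseudoMetricSpace Y] {R : ι → Set X} (hR : ∀ i, IsClosed (R i)) {G : ι → X → Y} {L K : ℝ≥0}
    (hG : ∀ i, LipschitzWith L (G i)) {γ : ℝ → X} (hγ : LipschitzOnWith K γ (Set.Icc 0 1))
    (hcover : ∀ t ∈ Set.Icc (0 : ℝ) 1, ∃ i, γ t ∈ R i)
    (hagree : ∀ t ∈ Set.Icc (0 : ℝ) 1, ∀ i j, γ t ∈ R i → γ t ∈ R j → G i (γ t) = G j (γ t))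
    {i j : ι} (hi : γ 0 ∈ R i) (hj : γ 1 ∈ R j) : dist (G i (γ 0)) (G j (γ 1)) ≤ L * K := by
  have : Nonempty ι := ⟨i⟩
  choose! idx hidx using hcover
  have h0 : (0 : ℝ) ∈ Set.Icc (0 : ℝ) 1 := by simp
  have h1 : (1 : ℝ) ∈ Set.Icc (0 : ℝ) 1 := by simp
  rw [hagree 0 h0 i (idx 0) hi (hidx 0 h0), hagree 1 h1 j (idx 1) hj (hidx 1 h1)]
  have hlocal : ∀ t ∈ Set.Icc (0 : ℝ) 1, ∀ᶠ s in nhdsWithin t (Set.Icc 0 1),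
      dist (G (idx s) (γ s)) (G (idx t) (γ t)) ≤ L * K * dist s t := by
    intro t ht
    have hmem : ∀ k, ∀ᶠ s in nhdsWithin t (Set.Icc 0 1), γ s ∈ R k → γ t ∈ R k := by
      intro k
      by_cases hk : γ t ∈ R k
      · exact Filter.Eventually.of_forall fun _ _ => hk
      · filter_upwards [(hγ.continuousOn t ht).eventually ((hR k).isOpen_compl.mem_nhds hk)]
          with s hs hs'
        exact absurd hs' hs
    filter_upwards [Filter.eventually_all.2 hmem, self_mem_nhdsWithin] with s hs hsI
    have hst := hs _ (hidx s hsI)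
    rw [hagree t ht (idx t) (idx s) (hidx t ht) hst, mul_assoc]
    exact ((hG (idx s)).dist_le_mul _ _).trans (by gcongr; exact hγ.dist_le_mul s hsI t ht)
  simpa using dist_le_mul_sub_of_eventually_dist_le (g := fun t => G (idx t) (γ t))
    zero_le_one hlocal

lemma dense_setOf_forall_add_notMem {γ : ℝ → ℂ} {K : ℝ≥0} {I : Set ℝ}
    (hγ : LipschitzOnWith K γ I) {V : Set ℂ} (hV : V.Countable) :
    Dense {z | ∀ t ∈ I, γ t + z ∉ V} := by
  have hdim : dimH (⋃ v ∈ V, (fun t => v - γ t) '' I) ≤ 1 := by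
    rw [dimH_bUnion hV]
    refine iSup₂_le fun v _ => ?_
    have hlip : LipschitzOnWith K (fun t => v - γ t) I :=
      .of_dist_le_mul fun s hs t ht => by rw [dist_sub_left]; exact hγ.dist_le_mul s hs t ht
    exact hlip.dimH_image_le.trans ((dimH_mono (Set.subset_univ _)).trans_eq Real.dimH_univ)
  refine (dense_compl_of_dimH_le_one hdim).mono ?_
  intro z hz t ht hv
  exact hz (Set.mem_biUnion hv ⟨t, ht, add_sub_cancel_left _ _⟩)

lemma eventually_nhds_zero_forall_add_mem {G : Type*} [TopologicalSpace G] [AddMonoid G]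
    [ContinuousAdd G]
    {K U : Set G} (hK : IsCompact K) (hKU : K ⊆ interior U) :
    ∀ᶠ z in nhds 0, ∀ x ∈ K, x + z ∈ U := by
  obtain ⟨V, hV, hKV⟩ := compact_open_separated_add_right hK isOpen_interior hKU
  filter_upwards [hV] with z hz x hx
  exact interior_subset (hKV (Set.add_mem_add hx hz))

end LipschitzPaths

namespace IsMesh

variable {n : ℕ} {E : Fin n → Element} {A : ℝ} {Ω : Set ℂ} {σ : ℂ → ℝ}

lemma inter_subset_sides (hE : IsMesh E A Ω σ) {i j : Fin n} (hij : i ≠ j) :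
    (E i).region ∩ (E j).region ⊆ (E i).sides := by
  intro x hx
  rcases hE.conforming i j hij x hx with hv | ⟨y, z, hside, -, hxyz⟩
  · obtain ⟨w, hw⟩ := Element.exists_isSide hv.1
    exact ⟨x, w, hw, left_mem_segment ℝ _ _⟩
  · exact ⟨y, z, hside, hxyz⟩

lemma disjoint_of_isOpen (hE : IsMesh E A Ω σ) {i j : Fin n} (hij : i ≠ j) {U W : Set ℂ}
    (hU : IsOpen U) (hW : IsOpen W) (hUE : U ⊆ (E i).region) (hWE : W ⊆ (E j).region) :
    Disjoint U W := by
  by_contra hUW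
  obtain ⟨x, hx, hxs⟩ := (dense_compl_of_dimH_le_one (E i).dimH_sides_le).inter_open_nonempty _
    (hU.inter hW) (Set.not_disjoint_iff_nonempty_inter.1 hUW)
  exact hxs (hE.inter_subset_sides hij ⟨hUE hx.1, hWE hx.2⟩)

lemma ncard_setOf_mem_vertices_le (hE : IsMesh E A Ω σ) (hA0 : 0 < A) (v : ℂ) :
    ({i | v ∈ (E i).vertices}.ncard : ℝ) ≤ (4 * A + 1) ^ 2 := by
  have hfat : ∀ᶠ r in nhdsWithin (0 : ℝ) (Set.Ioi 0), ∀ i ∈ {i | v ∈ (E i).vertices},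
      ∃ y, dist y v ≤ r ∧ Metric.ball y (r * (1 / (4 * A))) ⊆ (E i).region :=
    (Filter.eventually_all_finite (Set.toFinite _)).2 fun i hi =>
      (hE.aspect i).isFatAt_region (hE.proper i) hA0 hi
  obtain ⟨r, hball, hr⟩ := (hfat.and self_mem_nhdsWithin).exists
  choose! c hcv hc using hball
  have : 0 < r := hr
  refine (finite_and_ncard_le_of_pairwiseDisjoint_ball (by positivity) hcv
    fun i hi j hj hij => hE.disjoint_of_isOpen hij Metric.isOpen_ball Metric.isOpen_ball
      (hc i hi) (hc j hj)).2.trans_eq ?_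
  field_simp

/-- The graph on the elements of a mesh in which two distinct elements are adjacent if they share a
side that ends at `v`. Its connected components are the fans of elements around `v`. -/
def adjAt (E : Fin n → Element) (v : ℂ) : SimpleGraph (Fin n) where
  Adj i j := i ≠ j ∧ ∃ w, (E i).IsSide v w ∧ (E j).IsSide v w
  symm := ⟨fun _ _ h => ⟨h.1.symm, h.2.imp fun _ h => h.symm⟩⟩
  loopless := ⟨fun _ h => h.1 rfl⟩

lemma size_le_of_walk (hE : IsMesh E A Ω σ) (hA0 : 0 < A) {v : ℂ} {i j : Fin n}
    (p : (adjAt E v).Walk i j) : (E i).size ≤ A ^ p.length * (E j).size := by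
  induction p with
  | nil => simp
  | @cons i k j h p ih =>
    obtain ⟨w, hi, hk⟩ := h.2
    calc (E i).size ≤ A * dist v w := (hE.aspect i).size_le_mul_dist (hE.proper i) hA0 hi
      _ ≤ A * (E k).size := by gcongr; exact hk.dist_le_size
      _ ≤ A * (A ^ p.length * (E j).size) := by gcongr
      _ = A ^ (SimpleGraph.Walk.cons h p).length * (E j).size := by
          rw [SimpleGraph.Walk.length_cons]; ring

lemma mem_vertices_of_mem_support {v : ℂ} {i j k : Fin n} (p : (adjAt E v).Walk i j)
    (hi : v ∈ (E i).vertices) (hk : k ∈ p.support) : v ∈ (E k).vertices := by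
  induction p with
  | nil => rwa [List.mem_singleton.1 hk]
  | cons h p ih =>
    obtain ⟨w, -, hw⟩ := h.2
    rcases List.mem_cons.1 hk with rfl | hk
    · exact hi
    · exact ih hw.mem_left hk

/-- A bound for the ratio of the sizes of two elements in the same fan: `A` for each of the at most
`(4 * A + 1) ^ 2` elements around a vertex. -/
def sizeRatio (A : ℝ) : ℝ := A ^ ⌈(4 * A + 1) ^ 2⌉₊

lemma one_le_sizeRatio (hA : 1 ≤ A) : 1 ≤ sizeRatio A := one_le_pow₀ hA

lemma size_le_of_reachable (hE : IsMesh E A Ω σ) (hA : 1 ≤ A) {v : ℂ} {i j : Fin n}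
    (hi : v ∈ (E i).vertices) (h : (adjAt E v).Reachable i j) :
    (E i).size ≤ sizeRatio A * (E j).size := by
  classical
  have hA0 : 0 < A := one_pos.trans_le hA
  obtain ⟨p, hp⟩ := h.exists_isPath
  have hcard : p.length + 1 ≤ {i | v ∈ (E i).vertices}.ncard := by
    rw [← SimpleGraph.Walk.length_support, ← List.toFinset_card_of_nodup hp.support_nodup,
      ← Set.ncard_coe_finset]
    refine Set.ncard_le_ncard (fun k hk => ?_) (Set.toFinite _)
    exact mem_vertices_of_mem_support p hi (List.mem_toFinset.1 hk)
  have hlength : p.length ≤ ⌈(4 * A + 1) ^ 2⌉₊ := by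
    refine (Nat.le_succ _).trans (hcard.trans ((Nat.cast_le (α := ℝ)).1 ?_))
    exact (hE.ncard_setOf_mem_vertices_le hA0 v).trans (Nat.le_ceil _)
  refine (hE.size_le_of_walk hA0 p).trans ?_
  have := Element.size_pos (hE.proper j)
  unfold sizeRatio
  gcongr

/-- The smallest size in the fan of the element `E i` around `v`. -/
def fanSize (E : Fin n → Element) (i : Fin n) (v : ℂ) : ℝ :=
  ⨅ j : {j // (adjAt E v).Reachable i j}, (E j).size

lemma fanSize_le_of_reachable {v : ℂ} {i j : Fin n} (h : (adjAt E v).Reachable i j) :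
    fanSize E i v ≤ (E j).size :=
  ciInf_le (Set.finite_range fun j : {j // (adjAt E v).Reachable i j} => (E j).size).bddBelow ⟨j, h⟩

lemma le_fanSize_of_forall {v : ℂ} {i : Fin n} {c : ℝ}
    (h : ∀ j, (adjAt E v).Reachable i j → c ≤ (E j).size) : c ≤ fanSize E i v :=
  have : Nonempty {j // (adjAt E v).Reachable i j} := ⟨⟨i, .refl i⟩⟩
  le_ciInf fun j => h j j.2

lemma fanSize_mem_Icc (hE : IsMesh E A Ω σ) (hA : 1 ≤ A) {v : ℂ} {i : Fin n}
    (hi : v ∈ (E i).vertices) :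
    fanSize E i v ∈ Set.Icc ((E i).size / sizeRatio A) (E i).size :=
  ⟨le_fanSize_of_forall fun _ hj => (div_le_iff₀' (one_pos.trans_le (one_le_sizeRatio hA))).2
    (hE.size_le_of_reachable hA hi hj), fanSize_le_of_reachable (.refl i)⟩

lemma fanSize_eq_of_isSide {v w : ℂ} {i j : Fin n} (hi : (E i).IsSide v w)
    (hj : (E j).IsSide v w) : fanSize E i v = fanSize E j v := by
  rcases eq_or_ne i j with rfl | hij
  · rfl
  have h : (adjAt E v).Reachable i j := SimpleGraph.Adj.reachable ⟨hij, w, hi, hj⟩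
  exact le_antisymm (le_fanSize_of_forall fun k hk => fanSize_le_of_reachable (h.trans hk))
    (le_fanSize_of_forall fun k hk => fanSize_le_of_reachable (h.symm.trans hk))

lemma size_div_le_of_lipschitzOnWith (hE : IsMesh E A Ω σ) (hA : 1 ≤ A) {γ : ℝ → ℂ} {K : ℝ≥0}
    (hγ : LipschitzOnWith K γ (Set.Icc 0 1)) (hγΩ : ∀ t ∈ Set.Icc (0 : ℝ) 1, γ t ∈ Ω)
    (hγV : ∀ t ∈ Set.Icc (0 : ℝ) 1, γ t ∉ ⋃ k, (E k).vertices) {i j : Fin n}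
    (hi : γ 0 ∈ (E i).region) (hj : γ 1 ∈ (E j).region) :
    (E i).size / sizeRatio A ≤ (E j).size + 2 * A * K := by
  have hA0 : 0 < A := one_pos.trans_le hA
  have hratio : 0 < sizeRatio A := one_pos.trans_le (one_le_sizeRatio hA)
  have hpotential := fun k => (hE.aspect k).exists_lipschitzWith_eq_edgeInterp (hE.proper k) hA0
    (div_nonneg (Element.size_pos (hE.proper k)).le hratio.le) fun v hv => hE.fanSize_mem_Icc hA hv
  choose G hGlip hGmem hGedge using hpotential
  have hagree : ∀ t ∈ Set.Icc (0 : ℝ) 1, ∀ k l, γ t ∈ (E k).region → γ t ∈ (E l).region →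
      G k (γ t) = G l (γ t) := by
    intro t ht k l hk hl
    rcases eq_or_ne k l with rfl | hkl
    · rfl
    rcases hE.conforming k l hkl _ ⟨hk, hl⟩ with hv | ⟨y, w, hyk, hyl, hyw⟩
    · exact absurd (Set.mem_iUnion.2 ⟨k, hv.1⟩) (hγV t ht)
    · rw [hGedge k y w _ hyk hyw, hGedge l y w _ hyl hyw]
      exact edgeInterp_congr (fanSize_eq_of_isSide hyk hyl)
        (fanSize_eq_of_isSide hyk.symm hyl.symm) _
  have hdist := dist_le_of_piecewise_lipschitz (fun k => (E k).isClosed_region) hGlip hγ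
    (fun t ht => Set.mem_iUnion.1 (hE.covers (hγΩ t ht))) hagree hi hj
  rw [Real.dist_eq, Real.coe_toNNReal _ (by positivity)] at hdist
  linarith [le_abs_self (G i (γ 0) - G j (γ 1)), (hGmem i (γ 0)).1, (hGmem j (γ 1)).2]

variable {κ : ℝ≥0}

/-- A path from `p` to `q` is moved by a small translation `z`, so that it avoids the vertices. -/
lemma size_div_le_of_mem_interior (hE : IsMesh E A Ω σ) (hA : 1 ≤ A) (hΩ : IsMeshDomain κ Ω)
    {i j : Fin n} {p q : ℂ} (hp : p ∈ interior (E i).region ∩ interior Ω)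
    (hq : q ∈ interior (E j).region ∩ interior Ω) :
    (E i).size / sizeRatio A ≤ (E j).size + 2 * A * (κ * dist p q) := by
  obtain ⟨γ, h0, h1, hγ, hγΩ⟩ := hΩ.joined p hp.2 q hq.2
  have hpath := eventually_nhds_zero_forall_add_mem
    (isCompact_Icc.image_of_continuousOn hγ.continuousOn) (Set.image_subset_iff.2 hγΩ)
  have hends : ∀ {x k}, x ∈ interior (E k).region → ∀ᶠ z in nhds 0, x + z ∈ (E k).region := by
    intro x k hx
    simpa using eventually_nhds_zero_forall_add_mem isCompact_singleton
      (Set.singleton_subset_iff.2 hx)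
  have hfreq := mem_closure_iff_frequently.1
    (dense_setOf_forall_add_notMem hγ
      (Set.countable_iUnion fun k => (E k).finite_vertices.countable) 0)
  obtain ⟨z, hzV, hzΩ, hzi, hzj⟩ :=
    (hfreq.and_eventually (hpath.and ((hends hp.1).and (hends hq.1)))).exists
  have hγz : LipschitzOnWith (κ * nndist p q) (fun t => γ t + z) (Set.Icc 0 1) :=
    .of_dist_le_mul fun s hs t ht => by rw [dist_add_right]; exact hγ.dist_le_mul s hs t ht
  simpa using hE.size_div_le_of_lipschitzOnWith hA hγz (fun t ht => hzΩ _ ⟨t, ht, rfl⟩) hzV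
    (by simpa only [h0] using hzi) (by simpa only [h1] using hzj)

lemma exists_mem_closure (hE : IsMesh E A Ω σ) (hΩ : Ω ⊆ closure (interior Ω)) {p : ℂ}
    (hp : p ∈ Ω) : ∃ i, p ∈ closure (interior (E i).region ∩ interior Ω) := by
  have hsub : interior Ω ⊆ ⋃ i, closure (interior (E i).region ∩ interior Ω) := by
    intro x hx
    obtain ⟨i, hi⟩ := Set.mem_iUnion.1 (hE.covers (interior_subset hx))
    exact Set.mem_iUnion.2 ⟨i, isOpen_interior.closure_inter
      ⟨Element.region_subset_closure_interior (hE.proper i) hi, hx⟩⟩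
  have hclosed : IsClosed (⋃ i, closure (interior (E i).region ∩ interior Ω)) :=
    isClosed_iUnion_of_finite fun _ => isClosed_closure
  exact Set.mem_iUnion.1 (closure_minimal hsub hclosed (hΩ hp))

lemma size_div_le_of_mem_closure (hE : IsMesh E A Ω σ) (hA : 1 ≤ A) (hΩ : IsMeshDomain κ Ω)
    {i j : Fin n} {p q : ℂ} (hp : p ∈ closure (interior (E i).region ∩ interior Ω))
    (hq : q ∈ closure (interior (E j).region ∩ interior Ω)) :
    (E i).size / sizeRatio A ≤ (E j).size + 2 * A * (κ * dist p q) := by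
  have hclosed : IsClosed {x : ℂ × ℂ |
      (E i).size / sizeRatio A ≤ (E j).size + 2 * A * (κ * dist x.1 x.2)} :=
    isClosed_le continuous_const (by fun_prop)
  have hmem : (p, q) ∈ closure
      ((interior (E i).region ∩ interior Ω) ×ˢ (interior (E j).region ∩ interior Ω)) := by
    rw [closure_prod_eq]
    exact ⟨hp, hq⟩
  exact closure_minimal (fun x hx => hE.size_div_le_of_mem_interior hA hΩ hx.1 hx.2) hclosed hmem

lemma exists_size_le_localFeatureSize (hE : IsMesh E A Ω σ) (hA : 1 ≤ A) (hΩ : IsMeshDomain κ Ω)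
    {p : ℂ} (hp : p ∈ Ω) : ∃ i, p ∈ (E i).region ∧
      (E i).size ≤ sizeRatio A * (1 + 2 * A * κ) * localFeatureSize Ω σ p := by
  have hratio : 0 < sizeRatio A := one_pos.trans_le (one_le_sizeRatio hA)
  have hκ : 0 < 1 + 2 * A * κ := by positivity
  have hregion : ∀ k, closure (interior (E k).region ∩ interior Ω) ⊆ (E k).region := fun k =>
    closure_minimal (Set.inter_subset_left.trans interior_subset) (E k).isClosed_region
  obtain ⟨i, hi⟩ := hE.exists_mem_closure hΩ.subset_closure hp
  refine ⟨i, hregion i hi, ?_⟩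
  rw [mul_assoc, ← div_le_iff₀' hratio, ← div_le_iff₀' hκ]
  have : Nonempty Ω := ⟨⟨p, hp⟩⟩
  refine le_ciInf fun ⟨q, hq⟩ => ?_
  obtain ⟨j, hj⟩ := hE.exists_mem_closure hΩ.subset_closure hq
  have hσ : (E j).size ≤ σ q := by
    obtain ⟨x, y, hxy, hsize⟩ := (E j).exists_isSide_dist_eq_size
    exact hsize ▸ hE.obeys j q ⟨hregion j hj, hq⟩ x y hxy
  have hσ0 : 0 ≤ σ q := (Element.size_pos (hE.proper j)).le.trans hσ
  have hcross : 0 ≤ dist p q + σ q * (2 * A * κ) := by positivity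
  rw [div_le_iff₀' hκ]
  calc (E i).size / sizeRatio A ≤ (E j).size + 2 * A * (κ * dist p q) :=
        hE.size_div_le_of_mem_closure hA hΩ hi hj
    _ ≤ (1 + 2 * A * κ) * (dist p q + σ q) := by linarith

end IsMesh

/-! ### Counting -/

section Counting

variable {o a : ℂ} {D : Finset (ℕ × ℂ)} {Ω : Set ℂ} {σ : ℂ → ℝ} {A B C lam : ℝ} {κ : ℝ≥0} {n : ℕ}

lemma finite_elementsMeeting_meshOf (ha : a ≠ 0) (hD : IsDownClosed o a D)
    (hΩ : Bornology.IsBounded Ω) : (elementsMeeting (meshOf o a D) Ω).Finite := by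
  obtain ⟨R, hR⟩ := hΩ.subset_closedBall (0 : ℂ)
  have hanti := (sideLen_strictAnti ha).antitone
  refine (finite_and_ncard_le_of_isUncutCorner ha hD (w := 0) (R := 2 * sideLen a 0 + R)
    (sideLen_pos ha (D.sup Prod.fst + 1)) ?_).1
  rintro Q ⟨hQ, z, hz, hzΩ⟩
  obtain ⟨k, y, h, hzy⟩ := exists_isUncutCorner ha hD hQ hz
  refine ⟨k, y, h, hanti ?_, ?_⟩
  · rcases k with _ | k
    · exact Nat.zero_le _
    · obtain ⟨x, hx, -⟩ := h.exists_mem_level_dist_le ha hD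
      exact Nat.succ_le_succ (Finset.le_sup (f := Prod.fst) (show (k, x) ∈ D from hx))
  · have hzR := Metric.mem_closedBall.1 (hR hzΩ)
    linarith [dist_triangle_left y 0 z, hanti (Nat.zero_le (k + 1))]

lemma IsUncutCorner.sideLen_le_mul (ha : a ≠ 0) (hD : IsDownClosed o a D) {k k' : ℕ}
    {y y' z z' : ℂ} {Q Q' : Fin 4 → ℂ} (h : IsUncutCorner o a D k y Q)
    (hz : dist z y ≤ 2 * sideLen a (k + 1)) (h' : IsUncutCorner o a D k' y' Q')
    (hz' : dist z' y' ≤ 2 * sideLen a (k' + 1)) (hB : 1 ≤ B)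
    (hd : dist z z' ≤ 4 * B * sideLen a k') : sideLen a k ≤ 16 * B * sideLen a k' := by
  rcases le_or_gt (dist z z') (sideLen a k / 4) with hnear | hfar
  · have hk := (sideLen_strictAnti ha).antitone (h.level_le_add_four ha hD hz h' hz' hnear)
    calc sideLen a k = 9 * sideLen a (k + 4) := by
          rw [sideLen_eq_three_mul a k, sideLen_eq_three_mul a (k + 2)]; ring
      _ ≤ 16 * B * sideLen a k' := by
          gcongr
          · exact sideLen_nonneg a _
          · linarith
  · linarith

lemma ncard_le_of_forall_exists_isUncutCorner (ha : a ≠ 0) (hD : IsDownClosed o a D)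
    {S : Set (Fin 4 → ℂ)} {Z : Set ℂ} {ρ : ℝ} (hB : 1 ≤ B)
    (hZ : ∀ z ∈ Z, ∀ z' ∈ Z, dist z z' ≤ 4 * ρ)
    (hS : ∀ Q ∈ S, ∃ k y, ∃ z ∈ Z, IsUncutCorner o a D k y Q ∧
      dist z y ≤ 2 * sideLen a (k + 1) ∧ ρ ≤ B * sideLen a k) :
    (S.ncard : ℝ) ≤ 24 * (1728 * B ^ 2 + 1) ^ 2 := by
  have : 0 < B := one_pos.trans_le hB
  rcases S.eq_empty_or_nonempty with rfl | ⟨Q₀, hQ₀⟩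
  · rw [Set.ncard_empty, Nat.cast_zero]
    positivity
  obtain ⟨k₀, y₀, z₀, hz₀, h₀, hzy₀, hρ₀⟩ := hS Q₀ hQ₀
  have hs₀ := sideLen_pos ha k₀
  refine (finite_and_ncard_le_of_isUncutCorner ha hD (r := sideLen a k₀ / (16 * B))
    (R := 36 * B * sideLen a k₀) (w := z₀) (by positivity) ?_).2.trans_eq ?_
  · intro Q hQ
    obtain ⟨k, y, z, hz, h, hzy, hρ⟩ := hS Q hQ
    have hle₀ := h₀.sideLen_le_mul ha hD hzy₀ h hzy hB (by linarith [hZ z₀ hz₀ z hz])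
    have hle := h.sideLen_le_mul ha hD hzy h₀ hzy₀ hB (by linarith [hZ z hz z₀ hz₀])
    refine ⟨k, y, h, by rwa [div_le_iff₀' (by positivity)], ?_⟩
    linarith [dist_triangle_left y z₀ z, hZ z hz z₀ hz₀, sideLen_strictAnti ha k.lt_succ_self]
  · field_simp
    ring

lemma IsCoarse.min_diam_le_mul (h : IsCoarse lam Ω σ ‖a‖) (hlam : 1 ≤ lam) (hC : 1 ≤ C) {z : ℂ}
    (hz : z ∈ Ω) {s : ℝ} (hs : s ≤ C * localFeatureSize Ω σ z) {k : ℕ}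
    (hk : k = 0 ∨ localFeatureSize Ω σ z ≤ 10 * sideLen a k) :
    min s (Metric.diam Ω) ≤ 10 * C * lam * sideLen a k := by
  have hC0 : 0 ≤ C := zero_le_one.trans hC
  have hk0 := sideLen_nonneg a k
  rcases hk with rfl | hk
  · have hdiam : Metric.diam Ω ≤ C * Metric.diam Ω := le_mul_of_one_le_left Metric.diam_nonneg hC
    calc min s (Metric.diam Ω) ≤ min (C * localFeatureSize Ω σ z) (C * Metric.diam Ω) :=
          min_le_min hs hdiam
      _ = C * min (localFeatureSize Ω σ z) (Metric.diam Ω) := (mul_min_of_nonneg _ _ hC0).symm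
      _ ≤ C * (lam * sideLen a 0) := by
          rw [sideLen_zero]
          exact mul_le_mul_of_nonneg_left (h z hz) hC0
      _ ≤ 10 * C * lam * sideLen a 0 := by
          linarith [show 0 ≤ C * (lam * sideLen a 0) by positivity]
  · calc min s (Metric.diam Ω) ≤ C * (10 * sideLen a k) :=
          (min_le_left _ _).trans (hs.trans (mul_le_mul_of_nonneg_left hk hC0))
      _ ≤ C * (10 * sideLen a k) * lam := le_mul_of_one_le_right (by positivity) hlam
      _ = 10 * C * lam * sideLen a k := by ring

lemma ncard_elementsMeeting_meshOf_le (ha : a ≠ 0) (hD : IsDownClosed o a D)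
    (hΩ : Bornology.IsBounded Ω) (hσ : ∀ p ∈ Ω, 0 ≤ σ p)
    (hDσ : (D : Set (ℕ × ℂ)) ⊆ oversizedSteps o a Ω σ) (hcoarse : IsCoarse lam Ω σ ‖a‖)
    (hlam : 1 ≤ lam) (hC : 1 ≤ C) (e : Element) :
    ((elementsMeeting (meshOf o a D)
      {z | z ∈ e.region ∩ Ω ∧ e.size ≤ C * localFeatureSize Ω σ z}).ncard : ℝ) ≤
      24 * (1728 * (10 * C * lam) ^ 2 + 1) ^ 2 := by
  have hB : 1 ≤ 10 * C * lam := by nlinarith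
  refine ncard_le_of_forall_exists_isUncutCorner ha hD (ρ := min e.size (Metric.diam Ω))
    (Z := {z | z ∈ e.region ∩ Ω ∧ e.size ≤ C * localFeatureSize Ω σ z}) hB
    (fun z hz z' hz' => ?_) ?_
  · have hdiam := Metric.dist_le_diam_of_mem hΩ hz.1.2 hz'.1.2
    rw [mul_min_of_nonneg _ _ zero_le_four]
    exact le_min (Element.dist_le_of_mem_region hz.1.1 hz'.1.1)
      (by linarith [dist_nonneg.trans hdiam])
  · rintro Q ⟨hQ, z, hzQ, hz⟩
    obtain ⟨k, y, h, hzy⟩ := exists_isUncutCorner ha hD hQ hzQ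
    exact ⟨k, y, z, hz, h, hzy, hcoarse.min_diam_le_mul hlam hC hz.1.2 hz.2
      (h.eq_zero_or_localFeatureSize_le ha hD hσ hDσ hzy)⟩

lemma elementsMeeting_iUnion {ι : Sort*} (M : QuadMesh) (Z : ι → Set ℂ) :
    elementsMeeting M (⋃ i, Z i) = ⋃ i, elementsMeeting M (Z i) := by
  ext Q
  simp only [elementsMeeting, Set.mem_ofPred_eq, Set.inter_iUnion, Set.nonempty_iUnion,
    Set.mem_iUnion, exists_and_left]

/-- A bound for the number of elements of the coarsest diamond-kite mesh per element of a comparison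
mesh, for `1 ≤ A` and `1 ≤ lam`. -/
def countBound (A lam : ℝ) (κ : ℝ≥0) : ℕ :=
  ⌈24 * (1728 * (10 * (IsMesh.sizeRatio A * (1 + 2 * A * κ)) * lam) ^ 2 + 1) ^ 2⌉₊

lemma IsMesh.ncard_elementsMeeting_le {E : Fin n → Element} (hE : IsMesh E A Ω σ) (ha : a ≠ 0)
    (hD : IsDownClosed o a D) (hΩ : IsMeshDomain κ Ω) (hσ : ∀ p ∈ Ω, 0 ≤ σ p)
    (hDσ : (D : Set (ℕ × ℂ)) ⊆ oversizedSteps o a Ω σ) (hcoarse : IsCoarse lam Ω σ ‖a‖)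
    (hA : 1 ≤ A) (hlam : 1 ≤ lam) :
    (elementsMeeting (meshOf o a D) Ω).ncard ≤ countBound A lam κ * n := by
  set C := sizeRatio A * (1 + 2 * A * κ)
  have hC : 1 ≤ C := one_le_mul_of_one_le_of_one_le (one_le_sizeRatio hA)
    (le_add_of_nonneg_right (by positivity))
  set Z : Fin n → Set ℂ := fun i =>
    {z | z ∈ (E i).region ∩ Ω ∧ (E i).size ≤ C * localFeatureSize Ω σ z}
  have hΩZ : Ω = ⋃ i, Z i := by
    refine Set.Subset.antisymm (fun z hz => ?_) (Set.iUnion_subset fun i z hz => hz.1.2)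
    obtain ⟨i, hi, hsize⟩ := hE.exists_size_le_localFeatureSize hA hΩ hz
    exact Set.mem_iUnion.2 ⟨i, ⟨hi, hz⟩, hsize⟩
  have hcard : ∀ i, (elementsMeeting (meshOf o a D) (Z i)).ncard ≤ countBound A lam κ := fun i =>
    Nat.cast_le.1 ((ncard_elementsMeeting_meshOf_le ha hD hΩ.bounded hσ hDσ hcoarse hlam hC
      (E i)).trans (Nat.le_ceil _))
  calc (elementsMeeting (meshOf o a D) Ω).ncard
      = (⋃ i, elementsMeeting (meshOf o a D) (Z i)).ncard := by
        rw [← elementsMeeting_iUnion, ← hΩZ]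
    _ ≤ ∑ i, (elementsMeeting (meshOf o a D) (Z i)).ncard := Set.ncard_iUnion_le_of_fintype _
    _ ≤ ∑ _i : Fin n, countBound A lam κ := Finset.sum_le_sum fun i _ => hcard i
    _ = countBound A lam κ * n := by rw [Finset.sum_const, Finset.card_fin, smul_eq_mul, mul_comm]

lemma IsMesh.mono {E : Fin n → Element} (hE : IsMesh E A Ω σ) (hAB : A ≤ B) : IsMesh E B Ω σ :=
  { hE with aspect := fun i => (hE.aspect i).mono hAB }

lemma IsCoarse.mono {s lam' : ℝ} (h : IsCoarse lam Ω σ s) (hs : 0 ≤ s) (hlam : lam ≤ lam') :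
    IsCoarse lam' Ω σ s :=
  fun p hp => (h p hp).trans (mul_le_mul_of_nonneg_right hlam hs)

end Counting

end DiamondKite

end

theorem mainTheorem1 (A lam : ℝ) (κ : NNReal) :
    ∃ C : ℕ, ∀ (o a : ℂ) (Ω : Set ℂ) (σ : ℂ → ℝ), a ≠ 0 →
      DiamondKite.IsMeshDomain κ Ω →
      (∃ δ > 0, ∀ p ∈ Ω, δ ≤ σ p) →
      DiamondKite.IsCoarse lam Ω σ ‖a‖ →
      (∃ M, DiamondKite.IsCoarsest (DiamondKite.rhombille o a) Ω σ M) ∧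
      ∀ M, DiamondKite.IsCoarsest (DiamondKite.rhombille o a) Ω σ M →
        (DiamondKite.elementsMeeting M Ω).Finite ∧
        ∀ (n : ℕ) (E : Fin n → DiamondKite.Element), DiamondKite.IsMesh E A Ω σ →
          (DiamondKite.elementsMeeting M Ω).ncard ≤ C * n := by
  refine ⟨DiamondKite.countBound (max A 1) (max lam 1) κ, ?_⟩
  rintro o a Ω σ ha hΩ ⟨δ, hδ, hσ⟩ hcoarse
  refine ⟨DiamondKite.exists_isCoarsest ha hΩ.bounded hδ hσ, fun M hM => ?_⟩
  obtain ⟨D, hD, hDσ, rfl⟩ := hM.exists_eq_meshOf ha hΩ.bounded hδ hσ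
  refine ⟨DiamondKite.finite_elementsMeeting_meshOf ha hD hΩ.bounded, fun n E hE => ?_⟩
  have hσ0 : ∀ p ∈ Ω, 0 ≤ σ p := fun p hp => hδ.le.trans (hσ p hp)
  exact (hE.mono (le_max_left A 1)).ncard_elementsMeeting_le ha hD hΩ hσ0 hDσ
    (hcoarse.mono (norm_nonneg a) (le_max_left lam 1)) (le_max_right A 1) (le_max_right lam 1)
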